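/- Consider the stationary incompressible Euler equations $$u\cdot\nabla u+\nabla p=0,\qquad \nabla\cdot u=0 \tag{E}$$ for a velocity $u$ and a pressure $p$ in three dimensions. For $\alpha\in\mathbb R$, a solution $(u,p)$ is called $(-\alpha)$-homogeneous if $u(x)=\lambda^{\alpha}u(\lambda x)$ and $p(x)=\lambda^{2\alpha}p(\lambda x)$ for all $\lambda>0$ and all $x$ in the domain. It is called axisymmetric if, in cylindrical coordinates $(r,\phi,z)$ with orthonormal frame $e_r,e_\phi,e_z$, $u=u^r e_r+u^\phi e_\phi+u^z e_z$ with $u^r,u^\phi,u^z$ independent of $\phi$; write $u^P=u^re_r+u^ze_z$ for its poloidal part. It is called rotational if $\nabla\times u$ is not identically zero. The Bernoulli function is $\Pi=p+|u|^2/2$. Solutions of class $C^1$ on $\mathbb R^3\setminus\{0\}$ satisfy (E) pointwise in $\mathbb R^3\setminus\{0\}$; for solutions that are merely continuous on $\mathbb R^3$, (E) (with $u\cdot\nabla u=\nabla\cdot(u\otimes u)$) and $\nabla\times u\not\equiv0$ are understood in the sense of distributions on $\mathbb R^3$. **Theorem 1.5.** The following holds for rotational axisymmetric $(-\alpha)$-homogeneous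 solutions of (E). (i) For $1\le\alpha\le2$, no such solution $(u,p)\in C^1(\mathbb R^3\setminus\{0\})$ exists. (ii) For $0\le\alpha<1$, no such solution $(u,p)\in C^2(\mathbb R^3\setminus\{0\})$ exists. (iii) For every $\alpha>2$, there exists such a solution $(u,p)\in C^1(\mathbb R^3\setminus\{0\})$ with nonconstant Bernoulli function such that $u^P,p\in C^2(\mathbb R^3\setminus\{0\})$ and $u^\phi e_\phi\in C^1(\mathbb R^3\setminus\{0\})$. (iv) For every $\alpha<-2$, there exists such a solution $(u,p)\in C(\mathbb R^3)$ with nonconstant Bernoulli function such that $u^P,p\in C^1(\mathbb R^3\setminus\{r=0\})\cap C(\mathbb R^3)$ and $u^\phi e_\phi\in C(\mathbb R^3)$. -/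

import Mathlib

open scoped ContDiff

noncomputable section

namespace HomEuler

/-- Euclidean three-space. The coordinates `x₁, x₂, x₃` are `x 0, x 1, x 2`. -/
abbrev E3 : Type := EuclideanSpace ℝ (Fin 3)

/-- Three-space without the origin. -/
def punctured : Set E3 := {x | x ≠ 0}

/-- The cylindrical radius `r = √(x₁² + x₂²)`. -/
def cylRadius (x : E3) : ℝ := Real.sqrt (x 0 ^ 2 + x 1 ^ 2)

/-- Three-space without the axis `{r = 0}`. -/
def offAxis : Set E3 := {x | cylRadius x ≠ 0}

/-! ### Differential operators -/

/-- The partial derivative `∂ᵢ f` at `x`. -/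
def pd (i : Fin 3) (f : E3 → ℝ) (x : E3) : ℝ :=
  fderiv ℝ f x (EuclideanSpace.single i 1)

/-- The divergence `∇ · u`. -/
def divergence (u : E3 → E3) (x : E3) : ℝ := ∑ i, pd i (fun y => u y i) x

/-- The rotation `∇ × u`. -/
def curl (u : E3 → E3) (x : E3) : E3 :=
  !₂[pd 1 (fun y => u y 2) x - pd 2 (fun y => u y 1) x,
     pd 2 (fun y => u y 0) x - pd 0 (fun y => u y 2) x,
     pd 0 (fun y => u y 1) x - pd 1 (fun y => u y 0) x]

/-! ### The stationary Euler equations -/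

/-- `(u, p)` satisfies `u · ∇u + ∇p = 0`, `∇ · u = 0` pointwise in `Ω`; used for `u`, `p` that are
`C¹` on the open set `Ω`. -/
def EulerClassical (Ω : Set E3) (u : E3 → E3) (p : E3 → ℝ) : Prop :=
  ∀ x ∈ Ω, (∀ i, ∑ j, u x j * pd j (fun y => u y i) x + pd i p x = 0) ∧ divergence u x = 0

/-- `(u, p)` satisfies `∇ · (u ⊗ u) + ∇p = 0`, `∇ · u = 0` in the sense of distributions on the
whole space; used for continuous `u`, `p`. -/
def EulerDistributional (u : E3 → E3) (p : E3 → ℝ) : Prop :=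
  (∀ Φ : E3 → E3, ContDiff ℝ ∞ Φ → HasCompactSupport Φ →
    ∫ x, (∑ i, ∑ j, u x i * u x j * pd j (fun y => Φ y i) x + p x * divergence Φ x) = 0) ∧
  (∀ η : E3 → ℝ, ContDiff ℝ ∞ η → HasCompactSupport η →
    ∫ x, ∑ i, u x i * pd i η x = 0)

/-- `u(x) = λ^α u(λ x)` and `p(x) = λ^(2α) p(λ x)` for all `λ > 0` and `x ∈ Ω`. -/
def Homogeneous (α : ℝ) (Ω : Set E3) (u : E3 → E3) (p : E3 → ℝ) : Prop :=
  ∀ c : ℝ, 0 < c → ∀ x ∈ Ω, u x = c ^ α • u (c • x) ∧ p x = c ^ (2 * α) * p (c • x)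

/-- `∇ × u` is not identically zero in `Ω`; used for `u` that is `C¹` on the open set `Ω`. -/
def Rotational (Ω : Set E3) (u : E3 → E3) : Prop := ∃ x ∈ Ω, curl u x ≠ 0

/-- The distribution `∇ × u` on the whole space is not zero; used for continuous `u`. -/
def RotationalDistributional (u : E3 → E3) : Prop :=
  ∃ Φ : E3 → E3, ContDiff ℝ ∞ Φ ∧ HasCompactSupport Φ ∧ ∫ x, ∑ i, u x i * curl Φ x i ≠ 0

/-- The Bernoulli function `Π = p + |u|² / 2`. -/
def bernoulliHead (u : E3 → E3) (p : E3 → ℝ) (x : E3) : ℝ := p x + ‖u x‖ ^ 2 / 2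

/-- The Bernoulli function takes two different values in `Ω`. -/
def NonconstantBernoulli (Ω : Set E3) (u : E3 → E3) (p : E3 → ℝ) : Prop :=
  ∃ x ∈ Ω, ∃ y ∈ Ω, bernoulliHead u p x ≠ bernoulliHead u p y

/-! ### Axial symmetry -/

/-- The rotation by the angle `t` about the `x₃`-axis. -/
def rotZ (t : ℝ) (x : E3) : E3 :=
  !₂[Real.cos t * x 0 - Real.sin t * x 1, Real.sin t * x 0 + Real.cos t * x 1, x 2]

/-- The field `u` on the rotation-invariant set `Ω` commutes with all rotations about the
`x₃`-axis, that is, its components in the frame `e_r, e_φ, e_z` depend on `(r, z)` only. -/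
def Axisymmetric (Ω : Set E3) (u : E3 → E3) : Prop :=
  ∀ t : ℝ, ∀ x ∈ Ω, u (rotZ t x) = rotZ t (u x)

/-- The unit vector `e_r`. On the axis it has the value `0`; there an axisymmetric field has only
a vertical component. -/
def eR (x : E3) : E3 := !₂[x 0 / cylRadius x, x 1 / cylRadius x, 0]

/-- The unit vector `e_φ`, with the value `0` on the axis. -/
def ePhi (x : E3) : E3 := !₂[-x 1 / cylRadius x, x 0 / cylRadius x, 0]

/-- The unit vector `e_z`. -/
def eZ : E3 := !₂[0, 0, 1]

/-- The poloidal component `u^P = u^r e_r + u^z e_z`. -/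
def poloidal (u : E3 → E3) (x : E3) : E3 :=
  inner ℝ (u x) (eR x) • eR x + inner ℝ (u x) eZ • eZ

/-- The toroidal component `u^φ e_φ`. -/
def toroidal (u : E3 → E3) (x : E3) : E3 := inner ℝ (u x) (ePhi x) • ePhi x

/-! ### Homogeneous solutions -/

/-- `(u, p)` is a rotational axisymmetric `(-α)`-homogeneous solution of class `C^k` in the
punctured space (`1 ≤ k`). The values of `u` and `p` at the origin play no role. -/
structure PuncturedSolution (k : ℕ∞) (α : ℝ) (u : E3 → E3) (p : E3 → ℝ) : Prop where
  contDiffOn_velocity : ContDiffOn ℝ k u punctured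
  contDiffOn_pressure : ContDiffOn ℝ k p punctured
  homogeneous : Homogeneous α punctured u p
  euler : EulerClassical punctured u p
  axisymmetric : Axisymmetric punctured u
  rotational : Rotational punctured u

/-- `(u, p)` is a continuous rotational axisymmetric `(-α)`-homogeneous solution in the whole
space, in the sense of distributions. -/
structure ContinuousSolution (α : ℝ) (u : E3 → E3) (p : E3 → ℝ) : Prop where
  continuous_velocity : Continuous u
  continuous_pressure : Continuous p
  homogeneous : Homogeneous α Set.univ u p
  euler : EulerDistributional u p
  axisymmetric : Axisymmetric Set.univ u
  rotational : RotationalDistributional u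

end HomEuler

end

/-! Existence. A swirl-free axisymmetric field comes from a stream function ψ. It solves the Euler
equations once its azimuthal vorticity divided by r equals -Π'(ψ), where Π is the Bernoulli
function. For ψ = |x|^k W(cos θ) with k = 2 - α, homogeneity suggests Π = -(c/q)|ψ|^q with qk = 2k -
4. What remains is (1 - t²)W'' + k(k-1)W + c(1 - t²)|W|^(q-2)W = 0 with W(±1) = 0. Since q = 2 -
4/k, the condition q > 1 means k < 0 or k > 4, that is α > 2 or α < -2, and then K = k(k-1) > 0.

A profile W is found by minimizing ∫ w'² - K ∫ w²/(1 - t²) on the set ∫ |w|^q = 1. The pointwise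
bound w² ≤ ‖w'‖² (1 - t²)/2 tames the singular weight and makes the second term weakly continuous.
The constant c is the minimum itself, and rotationality requires c ≠ 0. The linear problem -w'' = K
w/(1 - t²) has lowest eigenvalue 2 on all functions and 6 on odd ones. So the minimum is negative
for large K, and positive for small K if only odd functions compete; the two ranges overlap, and K =
3 is a safe place to switch. The equation is singular at t = ±1, but w/(1 - t²) is as smooth as w',
so regularity bootstraps up to the poles. The carrying statements are `exists_integral_solution`,
`exists_profile` and `IsProfile.eulerClassical`.

Nonexistence. Homogeneity and axial symmetry reduce the equations to an ordinary differential system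
in t = cos θ on one meridian (`MeridianSystem`), for the radial velocity a, the weighted polar
velocity W with W' = -(2 - α)a, the weighted swirl γ and the pressure. Regularity at the axis makes
suitable combinations vanish at both poles. The proof exhibits combinations that are conserved
wherever they do not vanish, or that are monotone; such quantities are zero.

For 0 < α < 2 this first kills the Bernoulli function (`head_eq_zero`). For 1 ≤ α < 2 the function
WW' is then nondecreasing, so the flow is trivial. For α = 2 the flow is radial. For 0 ≤ α < 1 the
swirl vanishes and W solves a linear equation, which a comparison with its explicit solution 1 - t²
at α = 0 settles: the flow is zero, or uniform if α = 0. All these flows are irrotational. Only one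
derivative of the solution is used. -/

namespace HomEuler

open MeasureTheory Set Filter Topology

/-! ### Pointwise bounds, weak continuity and coercivity of the functionals -/

section Variational

variable {H : Type*} [NormedAddCommGroup H] [InnerProductSpace ℝ H]

/-- The quadratic form `∫ w² / (1 - t²)` of `w t = ⟪f, g t⟫`, polarized. -/
noncomputable def singularForm (g : ℝ → H) (f h : H) : ℝ :=
  ∫ t in Ioo (-1 : ℝ) 1, inner ℝ f (g t) * inner ℝ h (g t) / (1 - t ^ 2)

/-- The functional `∫ |w|^q` of `w t = ⟪f, g t⟫`. -/
noncomputable def powerFunctional (g : ℝ → H) (q : ℝ) (f : H) : ℝ :=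
  ∫ t in Ioo (-1 : ℝ) 1, |inner ℝ f (g t)| ^ q

/-- A curve in a Hilbert space, continuous on `[-1, 1]`, with `‖g t‖² ≤ (1 - t²) / 2`. -/
structure IsKernelCurve (g : ℝ → H) : Prop where
  continuousOn : ContinuousOn g (Icc (-1) 1)
  norm_sq_le : ∀ t ∈ Icc (-1 : ℝ) 1, ‖g t‖ ^ 2 ≤ (1 - t ^ 2) / 2

lemma one_sub_sq_pos {t : ℝ} (ht : t ∈ Ioo (-1 : ℝ) 1) : 0 < 1 - t ^ 2 := by
  have := ht.1; have := ht.2; nlinarith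

namespace IsKernelCurve

variable {g : ℝ → H} (hg : IsKernelCurve g)
include hg

lemma inner_sq_le (f : H) {t : ℝ} (ht : t ∈ Icc (-1 : ℝ) 1) :
    (inner ℝ f (g t)) ^ 2 ≤ ‖f‖ ^ 2 * ((1 - t ^ 2) / 2) := by
  have h1 := abs_real_inner_le_norm f (g t)
  calc (inner ℝ f (g t)) ^ 2 = |inner ℝ f (g t)| ^ 2 := (sq_abs _).symm
    _ ≤ (‖f‖ * ‖g t‖) ^ 2 := by gcongr
    _ = ‖f‖ ^ 2 * ‖g t‖ ^ 2 := by ring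
    _ ≤ _ := by gcongr; exact hg.norm_sq_le t ht

lemma norm_le_one {t : ℝ} (ht : t ∈ Icc (-1 : ℝ) 1) : ‖g t‖ ≤ 1 := by
  have h1 := hg.norm_sq_le t ht
  have := norm_nonneg (g t)
  nlinarith [sq_nonneg t]

lemma abs_inner_le (f : H) {t : ℝ} (ht : t ∈ Icc (-1 : ℝ) 1) : |inner ℝ f (g t)| ≤ ‖f‖ :=
  (abs_real_inner_le_norm f (g t)).trans
    (mul_le_of_le_one_right (norm_nonneg _) (hg.norm_le_one ht))

lemma continuousOn_inner (f : H) : ContinuousOn (fun t => inner ℝ f (g t)) (Icc (-1 : ℝ) 1) :=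
  continuousOn_const.inner hg.continuousOn

lemma aesm_inner (f : H) :
    AEStronglyMeasurable (fun t => inner ℝ f (g t)) (volume.restrict (Ioo (-1 : ℝ) 1)) :=
  ((hg.continuousOn_inner f).mono Ioo_subset_Icc_self).aestronglyMeasurable measurableSet_Ioo

lemma abs_form_le (f h : H) {t : ℝ} (ht : t ∈ Ioo (-1 : ℝ) 1) :
    |inner ℝ f (g t) * inner ℝ h (g t) / (1 - t ^ 2)| ≤ (‖f‖ ^ 2 + ‖h‖ ^ 2) / 4 := by
  have h0 := one_sub_sq_pos ht
  have h1 := hg.inner_sq_le f (Ioo_subset_Icc_self ht)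
  have h2 := hg.inner_sq_le h (Ioo_subset_Icc_self ht)
  rw [abs_div, abs_of_pos h0, div_le_iff₀ h0, abs_mul]
  nlinarith [sq_nonneg (|inner ℝ f (g t)| - |inner ℝ h (g t)|), sq_abs (inner ℝ f (g t)),
    sq_abs (inner ℝ h (g t))]

lemma aesm_form (f h : H) :
    AEStronglyMeasurable (fun t => inner ℝ f (g t) * inner ℝ h (g t) / (1 - t ^ 2))
      (volume.restrict (Ioo (-1 : ℝ) 1)) := by
  refine ((hg.aesm_inner f).mul (hg.aesm_inner h)).div₀ ?_
  exact (by fun_prop : Continuous fun t : ℝ => 1 - t ^ 2).aestronglyMeasurable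

lemma integrable_of_bound {F : ℝ → ℝ} {C : ℝ}
    (hF : AEStronglyMeasurable F (volume.restrict (Ioo (-1 : ℝ) 1)))
    (hC : ∀ t ∈ Ioo (-1 : ℝ) 1, |F t| ≤ C) : IntegrableOn F (Ioo (-1 : ℝ) 1) :=
  Integrable.of_bound hF C
    ((ae_restrict_iff' measurableSet_Ioo).2 (Eventually.of_forall fun t ht => hC t ht))

lemma integrable_form (f h : H) :
    IntegrableOn (fun t => inner ℝ f (g t) * inner ℝ h (g t) / (1 - t ^ 2)) (Ioo (-1 : ℝ) 1) :=
  hg.integrable_of_bound (hg.aesm_form f h) fun _ ht => hg.abs_form_le f h ht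

lemma abs_rpow_le (f : H) {q : ℝ} (hq : 0 ≤ q) {t : ℝ} (ht : t ∈ Icc (-1 : ℝ) 1) :
    |(|inner ℝ f (g t)| ^ q)| ≤ ‖f‖ ^ q := by
  rw [abs_of_nonneg (by positivity)]
  exact Real.rpow_le_rpow (abs_nonneg _) (hg.abs_inner_le f ht) hq

lemma aesm_rpow (f : H) {q : ℝ} (hq : 0 ≤ q) :
    AEStronglyMeasurable (fun t => |inner ℝ f (g t)| ^ q) (volume.restrict (Ioo (-1 : ℝ) 1)) :=
  (((hg.continuousOn_inner f).mono Ioo_subset_Icc_self).abs.rpow_const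
    fun _ _ => Or.inr hq).aestronglyMeasurable measurableSet_Ioo

lemma integrable_rpow (f : H) {q : ℝ} (hq : 0 ≤ q) :
    IntegrableOn (fun t => |inner ℝ f (g t)| ^ q) (Ioo (-1 : ℝ) 1) :=
  hg.integrable_of_bound (hg.aesm_rpow f hq)
    fun _ ht => hg.abs_rpow_le f hq (Ioo_subset_Icc_self ht)

/-- Weak convergence is pointwise convergence of w here, because w t is the pairing with the fixed
vector g t. The bound `norm_sq_le` cancels the weight, so a constant dominates the integrands
although 1/(1 - t²) is not integrable. -/
lemma tendsto_form {f : ℕ → H} {f₀ : H} {R : ℝ} (hR : ∀ n, ‖f n‖ ≤ R)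
    (hf : ∀ h, Tendsto (fun n => inner ℝ (f n) h) atTop (𝓝 (inner ℝ f₀ h))) :
    Tendsto (fun n => singularForm g (f n) (f n)) atTop (𝓝 (singularForm g f₀ f₀)) := by
  refine tendsto_integral_of_dominated_convergence (fun _ => (R ^ 2 + R ^ 2) / 4)
    (fun n => hg.aesm_form _ _) (integrable_const _) (fun n => ?_) ?_
  · refine (ae_restrict_iff' measurableSet_Ioo).2 (Eventually.of_forall fun t ht => ?_)
    refine (hg.abs_form_le _ _ ht).trans ?_
    have := hR n
    gcongr
  · exact Eventually.of_forall fun t => ((hf _).mul (hf _)).div_const _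

lemma tendsto_power {q : ℝ} (hq : 0 ≤ q) {f : ℕ → H} {f₀ : H} {R : ℝ} (hR : ∀ n, ‖f n‖ ≤ R)
    (hf : ∀ h, Tendsto (fun n => inner ℝ (f n) h) atTop (𝓝 (inner ℝ f₀ h))) :
    Tendsto (fun n => powerFunctional g q (f n)) atTop (𝓝 (powerFunctional g q f₀)) := by
  refine tendsto_integral_of_dominated_convergence (fun _ => R ^ q)
    (fun n => hg.aesm_rpow _ hq) (integrable_const _) (fun n => ?_) ?_
  · refine (ae_restrict_iff' measurableSet_Ioo).2 (Eventually.of_forall fun t ht => ?_)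
    refine (hg.abs_rpow_le _ hq (Ioo_subset_Icc_self ht)).trans ?_
    exact Real.rpow_le_rpow (norm_nonneg _) (hR n) hq
  · exact Eventually.of_forall fun t => ((hf _).abs).rpow_const (Or.inr hq)

/-- Coercivity: for large norm the singular form is controlled by the power functional. -/
lemma form_le {q : ℝ} (hq : 1 < q) (f : H) {η : ℝ} (hη : 0 < η) (hη' : η ≤ 1) :
    singularForm g f f ≤ η * ‖f‖ ^ 2 + (2 + ‖f‖ * powerFunctional g q f) / η := by
  have hpt : ∀ t ∈ Ioo (-1 : ℝ) 1, inner ℝ f (g t) * inner ℝ f (g t) / (1 - t ^ 2) ≤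
      (Ioo (-1) (-1 + η) ∪ Ioo (1 - η) 1).indicator (fun _ => ‖f‖ ^ 2 / 2) t
        + (1 + ‖f‖ * |inner ℝ f (g t)| ^ q) / η := by
    intro t ht
    have h0 := one_sub_sq_pos ht
    have hJ : 0 ≤ (1 + ‖f‖ * |inner ℝ f (g t)| ^ q) / η := by positivity
    -- Within η of the end points the kernel bound is used, on a set of measure at most 2η.
    -- Elsewhere 1 - t² ≥ η and the weight is harmless.
    by_cases hm : t ∈ Ioo (-1) (-1 + η) ∪ Ioo (1 - η) 1
    · rw [indicator_of_mem hm]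
      have h1 := hg.inner_sq_le f (Ioo_subset_Icc_self ht)
      have : inner ℝ f (g t) * inner ℝ f (g t) / (1 - t ^ 2) ≤ ‖f‖ ^ 2 / 2 := by
        rw [div_le_iff₀ h0]; nlinarith
      linarith
    · rw [indicator_of_notMem hm, zero_add]
      have h1 : -1 + η ≤ t := by
        by_contra h; exact hm (Or.inl ⟨ht.1, not_le.1 h⟩)
      have h2 : t ≤ 1 - η := by
        by_contra h; exact hm (Or.inr ⟨not_le.1 h, ht.2⟩)
      have h3 : η ≤ 1 - t ^ 2 := by nlinarith
      -- For |w| ≤ 1 the square is at most 1. For |w| ≥ 1 one factor is bounded by ‖f‖ and the other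
      -- by |w|^q. On the constraint set this bound is linear in ‖f‖ for every q > 1, including q <
      -- 2.
      have h4 : inner ℝ f (g t) * inner ℝ f (g t) ≤ 1 + ‖f‖ * |inner ℝ f (g t)| ^ q := by
        rw [← abs_mul_abs_self (inner ℝ f (g t))]
        have hx := hg.abs_inner_le f (Ioo_subset_Icc_self ht)
        have hx0 := abs_nonneg (inner ℝ f (g t))
        generalize |inner ℝ f (g t)| = x at *
        rcases le_total x 1 with h | h
        · have : 0 ≤ ‖f‖ * x ^ q := by positivity
          nlinarith
        · have : x ≤ x ^ q := by
            simpa using Real.rpow_le_rpow_of_exponent_le h hq.le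
          nlinarith [norm_nonneg f]
      calc _ ≤ (1 + ‖f‖ * |inner ℝ f (g t)| ^ q) / (1 - t ^ 2) := by gcongr
        _ ≤ _ := by gcongr
  have hi1 : IntegrableOn ((Ioo (-1) (-1 + η) ∪ Ioo (1 - η) 1).indicator fun _ => ‖f‖ ^ 2 / 2)
      (Ioo (-1 : ℝ) 1) :=
    (integrable_const _).indicator (measurableSet_Ioo.union measurableSet_Ioo)
  have hi2 : IntegrableOn (fun t => 1 + ‖f‖ * |inner ℝ f (g t)| ^ q) (Ioo (-1 : ℝ) 1) :=
    (integrable_const _).add ((hg.integrable_rpow f (by linarith)).const_mul _)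
  calc singularForm g f f ≤ ∫ t in Ioo (-1 : ℝ) 1,
        ((Ioo (-1) (-1 + η) ∪ Ioo (1 - η) 1).indicator (fun _ => ‖f‖ ^ 2 / 2) t
        + (1 + ‖f‖ * |inner ℝ f (g t)| ^ q) / η) :=
        setIntegral_mono_on (hg.integrable_form f f) (hi1.add (hi2.div_const η))
          measurableSet_Ioo hpt
    _ = (∫ t in Ioo (-1 : ℝ) 1,
          (Ioo (-1) (-1 + η) ∪ Ioo (1 - η) 1).indicator (fun _ => ‖f‖ ^ 2 / 2) t)
        + (∫ t in Ioo (-1 : ℝ) 1, (1 + ‖f‖ * |inner ℝ f (g t)| ^ q)) / η := by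
        rw [integral_add hi1 (hi2.div_const η), integral_div]
    _ ≤ η * ‖f‖ ^ 2 + (2 + ‖f‖ * powerFunctional g q f) / η := by
        gcongr
        · rw [integral_indicator (measurableSet_Ioo.union measurableSet_Ioo), setIntegral_const,
            Measure.real, Measure.restrict_apply (measurableSet_Ioo.union measurableSet_Ioo),
            smul_eq_mul]
          have h5 : (volume ((Ioo (-1) (-1 + η) ∪ Ioo (1 - η) 1) ∩ Ioo (-1 : ℝ) 1)).toReal
              ≤ 2 * η := by
            have : volume ((Ioo (-1) (-1 + η) ∪ Ioo (1 - η) 1) ∩ Ioo (-1 : ℝ) 1)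
                ≤ ENNReal.ofReal (2 * η) := by
              refine (measure_mono inter_subset_left).trans ((measure_union_le _ _).trans ?_)
              rw [Real.volume_Ioo, Real.volume_Ioo, ← ENNReal.ofReal_add (by linarith) (by linarith)]
              apply ENNReal.ofReal_le_ofReal; linarith
            exact ENNReal.toReal_le_of_le_ofReal (by linarith) this
          nlinarith [sq_nonneg ‖f‖]
        · rw [integral_add (integrable_const _) ((hg.integrable_rpow f (by linarith)).const_mul _),
            integral_const_mul, setIntegral_const, Real.volume_real_Ioo]
          unfold powerFunctional
          norm_num

end IsKernelCurve

end Variational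

/-- Sequential Banach–Alaoglu in the dual of a separable space, carried back to H by the Riesz
isomorphism. -/
lemma exists_weakly_convergent_subseq {H : Type*} [NormedAddCommGroup H] [InnerProductSpace ℝ H]
    [CompleteSpace H] [TopologicalSpace.SeparableSpace H] {f : ℕ → H} {R : ℝ}
    (hR : ∀ n, ‖f n‖ ≤ R) : ∃ f₀ : H, ∃ s : ℕ → ℕ, StrictMono s ∧
      ∀ h, Tendsto (fun n => inner ℝ (f (s n)) h) atTop (𝓝 (inner ℝ f₀ h)) := by
  obtain ⟨φ, -, s, hs, hφ⟩ := WeakDual.isSeqCompact_closedBall ℝ H (0 : StrongDual ℝ H) R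
    (x := fun n => StrongDual.toWeakDual (InnerProductSpace.toDual ℝ H (f n))) (by
      intro n
      simpa using hR n)
  refine ⟨(InnerProductSpace.toDual ℝ H).symm (WeakDual.toStrongDual φ), s, hs, fun h => ?_⟩
  have h1 := ((WeakDual.eval_continuous (𝕜 := ℝ) (E := H) h).tendsto φ).comp hφ
  simpa [Function.comp_def] using h1

/-! ### Minimization under the constraint and its first variation -/

section Variational

variable {H : Type*} [NormedAddCommGroup H] [InnerProductSpace ℝ H] [CompleteSpace H]
  [TopologicalSpace.SeparableSpace H] {g : ℝ → H} (hg : IsKernelCurve g)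
include hg

/-- The direct method: the quadratic form `‖f‖² - K ∫ w² / (1 - t²)` attains its minimum on
`{∫ |w|^q = 1}`. -/
theorem IsKernelCurve.exists_minimizer {q K : ℝ} (hq : 1 < q) (hK : 0 < K)
    (hne : ∃ f, powerFunctional g q f = 1) :
    ∃ f, powerFunctional g q f = 1 ∧ ∀ h, powerFunctional g q h = 1 →
      ‖f‖ ^ 2 - K * singularForm g f f ≤ ‖h‖ ^ 2 - K * singularForm g h h := by
  set Q : H → ℝ := fun f => ‖f‖ ^ 2 - K * singularForm g f f with hQ
  set S : Set ℝ := Q '' {f | powerFunctional g q f = 1} with hS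
  obtain ⟨f₁, hf₁⟩ := hne
  -- With this η one has Kη ≤ 1/2, so half of ‖f‖² survives the singular term.
  set η : ℝ := 1 / (2 * (K + 1)) with hη
  have hη0 : 0 < η := by positivity
  have hη1 : η ≤ 1 := by rw [hη, div_le_one (by positivity)]; linarith
  have hηK : K * η ≤ 1 / 2 := by
    rw [hη, mul_one_div, div_le_iff₀ (by positivity)]; linarith
  have hco : ∀ f, powerFunctional g q f = 1 →
      ‖f‖ ^ 2 / 2 - K / η * (2 + ‖f‖) ≤ Q f := by
    intro f hf
    have h1 := hg.form_le hq f hη0 hη1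
    rw [hf, mul_one] at h1
    have h2 := mul_le_mul_of_nonneg_left h1 hK.le
    have h3 : K * (η * ‖f‖ ^ 2 + (2 + ‖f‖) / η) = (K * η) * ‖f‖ ^ 2 + K / η * (2 + ‖f‖) := by
      ring
    have h4 := mul_le_mul_of_nonneg_right hηK (sq_nonneg ‖f‖)
    simp only [hQ]
    linarith
  set M : ℝ := K / η with hM
  have hbdd : BddBelow S := by
    -- The minimum of r²/2 - M(2 + r), attained at r = M.
    refine ⟨- M ^ 2 / 2 - 2 * M, ?_⟩
    rintro _ ⟨f, hf, rfl⟩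
    have := hco f hf
    nlinarith [sq_nonneg (‖f‖ - M)]
  have hSne : S.Nonempty := ⟨_, f₁, hf₁, rfl⟩
  obtain ⟨y, hymono, hylim, hyS⟩ := exists_seq_tendsto_sInf hSne hbdd
  choose f hf hfy using hyS
  have hR : ∃ R, ∀ n, ‖f n‖ ≤ R := by
    refine ⟨2 * M + 3 + |y 0|, fun n => ?_⟩
    have h1 := hco (f n) (hf n)
    rw [hfy] at h1
    have h2 : y n ≤ y 0 := hymono (Nat.zero_le n)
    have hM0 : 0 ≤ M := by positivity
    have h3 := le_abs_self (y 0)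
    have h4 := abs_nonneg (y 0)
    by_contra hcon
    push Not at hcon
    nlinarith [norm_nonneg (f n)]
  obtain ⟨R, hR⟩ := hR
  obtain ⟨f₀, s, hs, hweak⟩ := exists_weakly_convergent_subseq hR
  have hI := hg.tendsto_form (fun n => hR (s n)) hweak
  have hJ := hg.tendsto_power (q := q) (by linarith) (fun n => hR (s n)) hweak
  have hJ1 : powerFunctional g q f₀ = 1 := by
    refine tendsto_nhds_unique hJ ?_
    have : (fun n => powerFunctional g q (f (s n))) = fun _ => 1 := funext fun n => hf (s n)
    rw [this]; exact tendsto_const_nhds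
  have hnorm : Tendsto (fun n => ‖f (s n)‖ ^ 2) atTop
      (𝓝 (sInf S + K * singularForm g f₀ f₀)) := by
    have h1 := (hylim.comp hs.tendsto_atTop).add (hI.const_mul K)
    refine h1.congr fun n => ?_
    simp only [Function.comp, ← hfy, hQ]; ring
  -- Weak lower semicontinuity of the norm, from 2⟪f n, f₀⟫ ≤ ‖f n‖² + ‖f₀‖² in the limit.
  have hle : ‖f₀‖ ^ 2 ≤ sInf S + K * singularForm g f₀ f₀ := by
    have h1 := hweak f₀
    rw [real_inner_self_eq_norm_sq] at h1
    have h2 : Tendsto (fun n => (‖f (s n)‖ ^ 2 + ‖f₀‖ ^ 2) / 2) atTop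
      (𝓝 ((sInf S + K * singularForm g f₀ f₀ + ‖f₀‖ ^ 2) / 2)) :=
      (hnorm.add_const _).div_const _
    have h3 := le_of_tendsto_of_tendsto' h1 h2 fun n => by
      have := real_inner_le_norm (f (s n)) f₀
      nlinarith [sq_nonneg (‖f (s n)‖ - ‖f₀‖)]
    linarith
  refine ⟨f₀, hJ1, fun h hh => ?_⟩
  have h1 : sInf S ≤ Q h := csInf_le hbdd ⟨h, hh, rfl⟩
  have h2 : Q f₀ ≤ sInf S := by simp only [hQ]; linarith
  exact h2.trans h1

omit [CompleteSpace H] [TopologicalSpace.SeparableSpace H] in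
lemma IsKernelCurve.singularForm_add_smul (f h : H) (ε : ℝ) :
    singularForm g (f + ε • h) (f + ε • h) =
      singularForm g f f + 2 * ε * singularForm g f h + ε ^ 2 * singularForm g h h := by
  unfold singularForm
  rw [← integral_const_mul, ← integral_const_mul, ← integral_add, ← integral_add]
  · refine integral_congr_ae (Eventually.of_forall fun t => ?_)
    simp only [inner_add_left, real_inner_smul_left]
    ring
  · exact (hg.integrable_form f f).add ((hg.integrable_form f h).const_mul _)
  · exact (hg.integrable_form h h).const_mul _
  · exact hg.integrable_form f f
  · exact (hg.integrable_form f h).const_mul _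

omit [CompleteSpace H] [TopologicalSpace.SeparableSpace H] in
lemma IsKernelCurve.hasDerivAt_powerFunctional {q : ℝ} (hq : 1 < q) (f h : H) :
    HasDerivAt (fun ε : ℝ => powerFunctional g q (f + ε • h))
      (∫ t in Ioo (-1 : ℝ) 1,
        q * |inner ℝ f (g t)| ^ (q - 2) * inner ℝ f (g t) * inner ℝ h (g t)) 0 := by
  have hder : ∀ t ε : ℝ, HasDerivAt (fun ε : ℝ => |inner ℝ (f + ε • h) (g t)| ^ q)
      (q * |inner ℝ (f + ε • h) (g t)| ^ (q - 2) * inner ℝ (f + ε • h) (g t)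
        * inner ℝ h (g t)) ε := by
    intro t ε
    have h1 : HasDerivAt (fun ε : ℝ => inner ℝ (f + ε • h) (g t)) (inner ℝ h (g t)) ε := by
      have : (fun ε : ℝ => inner ℝ (f + ε • h) (g t)) =
          fun ε : ℝ => inner ℝ f (g t) + ε * inner ℝ h (g t) := by
        funext ε; rw [inner_add_left, real_inner_smul_left]
      rw [this]
      simpa using ((hasDerivAt_id ε).mul_const (inner ℝ h (g t))).const_add (inner ℝ f (g t))
    exact (hasDerivAt_abs_rpow _ hq).comp ε h1
  have hb : ∀ t ∈ Ioo (-1 : ℝ) 1, ∀ ε ∈ Metric.ball (0 : ℝ) 1,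
      ‖q * |inner ℝ (f + ε • h) (g t)| ^ (q - 2) * inner ℝ (f + ε • h) (g t)
        * inner ℝ h (g t)‖ ≤ q * (‖f‖ + ‖h‖) ^ (q - 1) * ‖h‖ := by
    intro t ht ε hε
    have ht' := Ioo_subset_Icc_self ht
    have hn : ‖f + ε • h‖ ≤ ‖f‖ + ‖h‖ := by
      refine (norm_add_le _ _).trans ?_
      rw [norm_smul]
      have : ‖ε‖ ≤ 1 := by simpa using (mem_ball_zero_iff.1 hε).le
      have := mul_le_of_le_one_left (norm_nonneg h) this
      linarith
    have h1 := (hg.abs_inner_le (f + ε • h) ht').trans hn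
    have h2 := hg.abs_inner_le h ht'
    simp only [norm_mul, Real.norm_eq_abs]
    rw [abs_of_pos (by linarith : 0 < q), abs_of_nonneg (by positivity :
      0 ≤ |inner ℝ (f + ε • h) (g t)| ^ (q - 2)), mul_assoc q]
    have h3 : |inner ℝ (f + ε • h) (g t)| ^ (q - 2) * |inner ℝ (f + ε • h) (g t)|
        ≤ (‖f‖ + ‖h‖) ^ (q - 1) := by
      have h0 := abs_nonneg (inner ℝ (f + ε • h) (g t))
      generalize |inner ℝ (f + ε • h) (g t)| = x at *
      -- For q < 2 the factor |w|^(q-2) alone is unbounded near w = 0; only its product with w is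
      -- controlled, and the value 0 is treated apart.
      rcases h0.eq_or_lt with h | h
      · rw [← h, mul_zero]; positivity
      · rw [← Real.rpow_add_one h.ne']
        have : q - 2 + 1 = q - 1 := by ring
        rw [this]
        exact Real.rpow_le_rpow h0 h1 (by linarith)
    have hq0 : 0 < q := by linarith
    gcongr
  have key := hasDerivAt_integral_of_dominated_loc_of_deriv_le
    (μ := volume.restrict (Ioo (-1 : ℝ) 1)) (𝕜 := ℝ) (x₀ := (0 : ℝ))
    (s := Metric.ball (0 : ℝ) 1)
    (F := fun ε t => |inner ℝ (f + ε • h) (g t)| ^ q)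
    (F' := fun ε t => q * |inner ℝ (f + ε • h) (g t)| ^ (q - 2) * inner ℝ (f + ε • h) (g t)
        * inner ℝ h (g t)) (bound := fun _ => q * (‖f‖ + ‖h‖) ^ (q - 1) * ‖h‖)
    (Metric.ball_mem_nhds _ one_pos)
    (Eventually.of_forall fun ε => hg.aesm_rpow _ (by linarith))
    (hg.integrable_rpow _ (by linarith)) ?_ ?_ (integrable_const _) ?_
  · simpa [powerFunctional] using key.2
  · have h1 := (hg.aesm_inner (f + (0 : ℝ) • h)).aemeasurable
    exact ((((h1.abs.pow_const (q - 2)).const_mul q).mul h1).mul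
      (hg.aesm_inner h).aemeasurable).aestronglyMeasurable
  · exact (ae_restrict_iff' measurableSet_Ioo).2 (Eventually.of_forall hb)
  · exact Eventually.of_forall fun t ε _ => hder t ε

omit [CompleteSpace H] [TopologicalSpace.SeparableSpace H] in
lemma IsKernelCurve.powerFunctional_smul {q : ℝ} (f : H) {c : ℝ} (hc : 0 ≤ c) :
    powerFunctional g q (c • f) = c ^ q * powerFunctional g q f := by
  unfold powerFunctional
  rw [← integral_const_mul]
  refine integral_congr_ae (Eventually.of_forall fun t => ?_)
  simp only [real_inner_smul_left, abs_mul, abs_of_nonneg hc]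
  exact Real.mul_rpow hc (abs_nonneg _)

omit [CompleteSpace H] [TopologicalSpace.SeparableSpace H] in
/-- The Euler–Lagrange equation of the constrained minimization problem. -/
theorem IsKernelCurve.euler_lagrange {q K : ℝ} (hq : 1 < q) {f : H}
    (hf : powerFunctional g q f = 1)
    (hmin : ∀ h, powerFunctional g q h = 1 →
      ‖f‖ ^ 2 - K * singularForm g f f ≤ ‖h‖ ^ 2 - K * singularForm g h h) (h : H) :
    inner ℝ f h - K * singularForm g f h = (‖f‖ ^ 2 - K * singularForm g f f) *
      ∫ t in Ioo (-1 : ℝ) 1, |inner ℝ f (g t)| ^ (q - 2) * inner ℝ f (g t) * inner ℝ h (g t) := by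
  have hq0 : q ≠ 0 := by linarith
  set Q : H → ℝ := fun f => ‖f‖ ^ 2 - K * singularForm g f f with hQ
  -- Q is homogeneous of degree 2 and the power functional of degree q. Rescaling onto the
  -- constraint therefore turns minimality into an unconstrained inequality, with equality at f.
  -- Differentiating it along f + ε h yields the multiplier explicitly: it is the minimum Q f.
  have hscale : ∀ φ, 0 < powerFunctional g q φ →
      0 ≤ Q φ - Q f * powerFunctional g q φ ^ (2 / q) := by
    intro φ hφ
    set c := powerFunctional g q φ ^ (-(1 / q)) with hc
    have hc0 : 0 < c := by positivity
    have h1 : powerFunctional g q (c • φ) = 1 := by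
      rw [hg.powerFunctional_smul _ hc0.le, hc, ← Real.rpow_mul hφ.le]
      have : -(1 / q) * q = -1 := by field_simp
      rw [this, Real.rpow_neg_one, inv_mul_cancel₀ hφ.ne']
    have h2 : Q f ≤ Q (c • φ) := hmin _ h1
    have h3 : Q (c • φ) = c ^ 2 * Q φ := by
      have h4 := hg.singularForm_add_smul 0 φ c
      have h5 : singularForm g 0 (0 : H) = 0 := by simp [singularForm]
      have h6 : singularForm g 0 φ = 0 := by simp [singularForm]
      rw [zero_add, h5, h6] at h4
      simp only [hQ, h4, norm_smul, Real.norm_eq_abs, mul_pow, sq_abs]; ring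
    have h7 : c ^ 2 * powerFunctional g q φ ^ (2 / q) = 1 := by
      rw [hc, ← Real.rpow_natCast, ← Real.rpow_mul hφ.le, ← Real.rpow_add hφ]
      have : -(1 / q) * ((2 : ℕ) : ℝ) + 2 / q = 0 := by push_cast; ring
      rw [this, Real.rpow_zero]
    have h8 : 0 ≤ c ^ 2 * (Q φ - Q f * powerFunctional g q φ ^ (2 / q)) := by
      rw [mul_sub, ← mul_assoc, mul_comm (c ^ 2) (Q f), mul_assoc, h7, mul_one, ← h3]; linarith
    exact nonneg_of_mul_nonneg_right h8 (by positivity)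
  have hJd := hg.hasDerivAt_powerFunctional hq f h
  set D := ∫ t in Ioo (-1 : ℝ) 1,
    |inner ℝ f (g t)| ^ (q - 2) * inner ℝ f (g t) * inner ℝ h (g t) with hD
  have hDq : (∫ t in Ioo (-1 : ℝ) 1,
        q * |inner ℝ f (g t)| ^ (q - 2) * inner ℝ f (g t) * inner ℝ h (g t)) = q * D := by
    rw [hD, ← integral_const_mul]
    refine integral_congr_ae (Eventually.of_forall fun t => ?_)
    simp only; ring
  rw [hDq] at hJd
  have hJ0 : powerFunctional g q (f + (0 : ℝ) • h) = 1 := by simpa using hf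
  have hQd : HasDerivAt (fun ε : ℝ => Q (f + ε • h))
      (2 * (inner ℝ f h - K * singularForm g f h)) 0 := by
    have : (fun ε : ℝ => Q (f + ε • h)) = fun ε : ℝ => Q f +
        ε * (2 * (inner ℝ f h - K * singularForm g f h)) + ε ^ 2 * Q h := by
      funext ε
      simp only [hQ, hg.singularForm_add_smul, ← real_inner_self_eq_norm_sq]
      simp only [inner_add_left, inner_add_right, real_inner_smul_left, real_inner_smul_right,
        real_inner_comm f h]
      ring
    rw [this]
    have h1 := (((hasDerivAt_id (0 : ℝ)).mul_const
      (2 * (inner ℝ f h - K * singularForm g f h))).const_add (Q f)).fun_add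
      (((hasDerivAt_id (0 : ℝ)).fun_pow 2).mul_const (Q h))
    exact h1.congr_deriv (by simp)
  have hPd : HasDerivAt (fun ε : ℝ => Q (f + ε • h) - Q f *
      powerFunctional g q (f + ε • h) ^ (2 / q))
      (2 * (inner ℝ f h - K * singularForm g f h) - Q f * (2 * D)) 0 := by
    have h1 := hJd.rpow_const (p := 2 / q) (Or.inl (by rw [hJ0]; exact one_ne_zero))
    have h2 := hQd.sub (h1.const_mul (Q f))
    rw [hJ0, Real.one_rpow, mul_one] at h2
    refine h2.congr_deriv ?_
    field_simp
  have hloc : IsLocalMin (fun ε : ℝ => Q (f + ε • h) - Q f *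
      powerFunctional g q (f + ε • h) ^ (2 / q)) 0 := by
    have h1 : ∀ᶠ ε : ℝ in 𝓝 0, 0 < powerFunctional g q (f + ε • h) :=
      hJd.continuousAt.eventually (lt_mem_nhds (by simp [hf]))
    filter_upwards [h1] with ε hε
    rw [hJ0, Real.one_rpow]
    simpa using hscale _ hε
  have := hloc.hasDerivAt_eq_zero hPd
  linarith

end Variational

/-! ### Kernel curves in `L²(ℝ)` -/

/-- The Green function of `-d²/dt²` on `(-1, 1)` with Dirichlet conditions. -/
noncomputable def green (s t : ℝ) : ℝ := (1 + min s t) * (1 - max s t) / 2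

/-- The indicator function of `(-1, t]` in `L²(ℝ)`. -/
noncomputable def stepL2 (t : ℝ) : Lp ℝ 2 (volume : Measure ℝ) :=
  indicatorConstLp 2 (measurableSet_Ioc (a := -1) (b := t)) (by simp) 1

lemma inner_stepL2 {s t : ℝ} (hs : -1 ≤ s) (ht : -1 ≤ t) :
    inner ℝ (stepL2 s) (stepL2 t) = 1 + min s t := by
  unfold stepL2
  rw [L2.inner_indicatorConstLp_indicatorConstLp (hμs := by simp) (hμt := by simp)]
  rw [Ioc_inter_Ioc, Real.volume_real_Ioc]
  have h1 : 0 ≤ min s t - max (-1) (-1) := by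
    rw [max_self, sub_nonneg]; exact le_min hs ht
  rw [max_eq_left h1, max_self]
  simp; ring

/-- The curve representing the evaluation of the primitive vanishing at `±1`. -/
noncomputable def greenCurve (t : ℝ) : Lp ℝ 2 (volume : Measure ℝ) :=
  stepL2 t - ((1 + t) / 2) • stepL2 1

/-- Pairing f with `greenCurve t` integrates over (-1, t] the part of f with mean zero on (-1, 1],
which gives a primitive vanishing at ±1. Thus L² replaces the Sobolev space of functions vanishing
at the ends, and the Gram kernel of the evaluations is the Green function. -/
lemma inner_greenCurve {s t : ℝ} (hs : s ∈ Icc (-1 : ℝ) 1) (ht : t ∈ Icc (-1 : ℝ) 1) :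
    inner ℝ (greenCurve s) (greenCurve t) = green s t := by
  unfold greenCurve green
  simp only [inner_sub_left, inner_sub_right, real_inner_smul_left, real_inner_smul_right]
  rw [inner_stepL2 hs.1 ht.1, inner_stepL2 hs.1 (by norm_num), inner_stepL2 (by norm_num) ht.1,
    inner_stepL2 (by norm_num) (by norm_num), min_eq_left hs.2, min_eq_right ht.2, min_self]
  rcases le_total s t with h | h
  · rw [min_eq_left h, max_eq_right h]; ring
  · rw [min_eq_right h, max_eq_left h]; ring

lemma green_self (t : ℝ) : green t t = (1 - t ^ 2) / 2 := by
  unfold green; rw [min_self, max_self]; ring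

lemma continuousOn_greenCurve : ContinuousOn greenCurve (Icc (-1) 1) := by
  intro t ht
  rw [ContinuousWithinAt, tendsto_iff_norm_sub_tendsto_zero]
  have h1 : Tendsto (fun s => √(green s s - 2 * green s t + green t t)) (𝓝[Icc (-1) 1] t) (𝓝 0) := by
    have : Continuous fun s => √(green s s - 2 * green s t + green t t) := by
      unfold green; fun_prop
    have h2 := this.tendsto t
    have h3 : green t t - 2 * green t t + green t t = 0 := by ring
    rw [h3, Real.sqrt_zero] at h2
    exact h2.mono_left nhdsWithin_le_nhds
  refine h1.congr' ?_
  filter_upwards [self_mem_nhdsWithin] with s hs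
  rw [← Real.sqrt_sq (norm_nonneg (greenCurve s - greenCurve t))]
  congr 1
  rw [norm_sub_sq_real, ← real_inner_self_eq_norm_sq, ← real_inner_self_eq_norm_sq,
    inner_greenCurve hs hs, inner_greenCurve hs ht, inner_greenCurve ht ht]

lemma isKernelCurve_greenCurve : IsKernelCurve greenCurve where
  continuousOn := continuousOn_greenCurve
  norm_sq_le t ht := by
    rw [← real_inner_self_eq_norm_sq, inner_greenCurve ht ht, green_self]

/-- The odd part of `greenCurve`. -/
noncomputable def oddCurve (t : ℝ) : Lp ℝ 2 (volume : Measure ℝ) :=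
  (1 / 2 : ℝ) • (greenCurve t - greenCurve (-t))

lemma neg_mem_Icc {t : ℝ} (ht : t ∈ Icc (-1 : ℝ) 1) : -t ∈ Icc (-1 : ℝ) 1 :=
  ⟨by linarith [ht.2], by linarith [ht.1]⟩

lemma oddCurve_neg (t : ℝ) : oddCurve (-t) = -oddCurve t := by
  unfold oddCurve; rw [neg_neg, ← smul_neg, neg_sub]

lemma green_neg (s t : ℝ) : green (-s) (-t) = green s t := by
  unfold green; rw [min_neg_neg, max_neg_neg]; ring

lemma green_neg_left (s t : ℝ) : green (-s) t = green s (-t) := by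
  rw [← green_neg, neg_neg]

lemma inner_oddCurve {s t : ℝ} (hs : s ∈ Icc (-1 : ℝ) 1) (ht : t ∈ Icc (-1 : ℝ) 1) :
    inner ℝ (oddCurve s) (oddCurve t) = (green s t - green s (-t)) / 2 := by
  unfold oddCurve
  simp only [inner_sub_left, inner_sub_right, real_inner_smul_left, real_inner_smul_right]
  rw [inner_greenCurve hs ht, inner_greenCurve hs (neg_mem_Icc ht),
    inner_greenCurve (neg_mem_Icc hs) ht, inner_greenCurve (neg_mem_Icc hs) (neg_mem_Icc ht),
    green_neg, green_neg_left]
  ring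

/-- The additional zero at t = 0 is what makes the singular form small on odd functions. -/
lemma norm_sq_oddCurve {t : ℝ} (ht : t ∈ Icc (-1 : ℝ) 1) :
    ‖oddCurve t‖ ^ 2 = |t| * (1 - |t|) / 2 := by
  rw [← real_inner_self_eq_norm_sq, inner_oddCurve ht ht, green_self]
  unfold green
  rcases le_total 0 t with h | h
  · rw [abs_of_nonneg h, min_eq_right (by linarith), max_eq_left (by linarith)]; ring
  · rw [abs_of_nonpos h, min_eq_left (by linarith), max_eq_right (by linarith)]; ring

lemma isKernelCurve_oddCurve : IsKernelCurve oddCurve where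
  continuousOn := by
    have h := continuousOn_greenCurve.comp continuous_neg.continuousOn fun t ht => neg_mem_Icc ht
    exact (continuousOn_greenCurve.sub h).const_smul (1 / 2 : ℝ)
  norm_sq_le t ht := by
    rw [norm_sq_oddCurve ht]
    have h1 : |t| ≤ 1 := abs_le.2 ht
    have h2 := abs_nonneg t
    have h3 := sq_abs t
    nlinarith

/-! ### The value of the minimum -/

/-- Quadratics in |t| serve as rational majorants and minorants of the weighted integrands, whose
exact integrals contain logarithms. -/
lemma integral_quadratic_abs (a b c : ℝ) :
    ∫ t in Ioo (-1 : ℝ) 1, (a + b * |t| + c * |t| ^ 2) = 2 * a + b + 2 * c / 3 := by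
  have hI : ∀ x y : ℝ, IntervalIntegrable (fun t : ℝ => a + b * |t| + c * |t| ^ 2) volume x y :=
    fun x y => (by fun_prop : Continuous fun t : ℝ =>
      a + b * |t| + c * |t| ^ 2).intervalIntegrable x y
  rw [← integral_Ioc_eq_integral_Ioo, ← intervalIntegral.integral_of_le (by norm_num),
    ← intervalIntegral.integral_add_adjacent_intervals (hI (-1) 0) (hI 0 1)]
  have h1 : ∫ t in (-1 : ℝ)..0, (a + b * |t| + c * |t| ^ 2) =
      ∫ t in (-1 : ℝ)..0, (a - b * t + c * t ^ 2) := by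
    refine intervalIntegral.integral_congr fun t ht => ?_
    rw [uIcc_of_le (by norm_num)] at ht
    simp only [abs_of_nonpos ht.2]; ring
  have h2 : ∫ t in (0 : ℝ)..1, (a + b * |t| + c * |t| ^ 2) =
      ∫ t in (0 : ℝ)..1, (a + b * t + c * t ^ 2) := by
    refine intervalIntegral.integral_congr fun t ht => ?_
    rw [uIcc_of_le (by norm_num)] at ht
    simp only [abs_of_nonneg ht.1]
  have hd : ∀ b t : ℝ, HasDerivAt (fun t => a * t + b * t ^ 2 / 2 + c * t ^ 3 / 3)
      (a + b * t + c * t ^ 2) t := by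
    intro b t
    have h3 := (((hasDerivAt_id t).const_mul a).fun_add
      (((hasDerivAt_id t).fun_pow 2).const_mul b |>.div_const 2)).fun_add
      (((hasDerivAt_id t).fun_pow 3).const_mul c |>.div_const 3)
    refine h3.congr_deriv ?_
    simp; ring
  rw [h1, h2, intervalIntegral.integral_eq_sub_of_hasDerivAt (fun t _ => by
      simpa [sub_eq_add_neg] using hd (-b) t) ((by fun_prop : Continuous fun t : ℝ =>
        a - b * t + c * t ^ 2).intervalIntegrable _ _),
    intervalIntegral.integral_eq_sub_of_hasDerivAt (fun t _ => hd b t)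
      ((by fun_prop : Continuous fun t : ℝ => a + b * t + c * t ^ 2).intervalIntegrable _ _)]
  ring

lemma integrableOn_quadratic_abs (a b c : ℝ) :
    IntegrableOn (fun t : ℝ => a + b * |t| + c * |t| ^ 2) (Ioo (-1 : ℝ) 1) :=
  ((by fun_prop : Continuous fun t : ℝ => a + b * |t| + c * |t| ^ 2).integrableOn_Icc
    (a := -1) (b := 1)).mono_set Ioo_subset_Icc_self

/-- By Cauchy–Schwarz the integrand is at most ‖f‖² x/(2(1 + x)) with x = |t|. The quadratic 1/36 +
x/3 - x²/9 touches x/(2(1 + x)) at x = 1/2 and lies above it on [0, 1]. Since 17/54 < 1/3, the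
quadratic form stays positive on odd functions for K ≤ 3. -/
lemma singularForm_oddCurve_le (f : Lp ℝ 2 (volume : Measure ℝ)) :
    singularForm oddCurve f f ≤ 17 / 54 * ‖f‖ ^ 2 := by
  have h : ∀ t ∈ Ioo (-1 : ℝ) 1, inner ℝ f (oddCurve t) * inner ℝ f (oddCurve t) / (1 - t ^ 2) ≤
      ‖f‖ ^ 2 / 36 + ‖f‖ ^ 2 / 3 * |t| + (-(‖f‖ ^ 2 / 9)) * |t| ^ 2 := by
    intro t ht
    have h0 := one_sub_sq_pos ht
    rw [div_le_iff₀ h0]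
    have h1 : inner ℝ f (oddCurve t) * inner ℝ f (oddCurve t) ≤
        ‖f‖ ^ 2 * (|t| * (1 - |t|) / 2) := by
      rw [← norm_sq_oddCurve (Ioo_subset_Icc_self ht), ← mul_pow, ← sq, ← sq_abs]
      gcongr
      exact abs_real_inner_le_norm _ _
    refine h1.trans ?_
    rw [← sq_abs t]
    have hx0 := abs_nonneg t
    have hx1 : |t| < 1 := abs_lt.2 ht
    generalize |t| = x at *
    have h2 : 0 ≤ (1 - x) ^ 2 * (x - 1 / 2) ^ 2 := by positivity
    have h3 : x * (1 - x) / 2 ≤ (1 / 36 + x / 3 - x ^ 2 / 9) * (1 - x ^ 2) := by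
      nlinarith [mul_nonneg (mul_nonneg hx0 (sq_nonneg (1 - x))) (sq_nonneg (x - 1 / 2)), h2]
    calc _ ≤ ‖f‖ ^ 2 * ((1 / 36 + x / 3 - x ^ 2 / 9) * (1 - x ^ 2)) := by gcongr
      _ = _ := by ring
  refine (setIntegral_mono_on (isKernelCurve_oddCurve.integrable_form f f)
    (integrableOn_quadratic_abs _ _ _) measurableSet_Ioo h).trans ?_
  rw [integral_quadratic_abs]
  apply le_of_eq; ring

/-- The test function is the tent (1 - |t|)/2. Its integrand (1 - x)/(4(1 + x)), x = |t|, is convex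
and lies above its tangent 7/36 - 2x/9 at x = 1/2. -/
lemma le_singularForm_greenCurve_zero :
    1 / 6 ≤ singularForm greenCurve (greenCurve 0) (greenCurve 0) := by
  have h : ∀ t ∈ Ioo (-1 : ℝ) 1, 7 / 36 + (-(2 / 9)) * |t| + 0 * |t| ^ 2 ≤
      inner ℝ (greenCurve 0) (greenCurve t) * inner ℝ (greenCurve 0) (greenCurve t)
        / (1 - t ^ 2) := by
    intro t ht
    have h0 := one_sub_sq_pos ht
    rw [le_div_iff₀ h0, inner_greenCurve (by norm_num) (Ioo_subset_Icc_self ht)]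
    have h1 : green 0 t = (1 - |t|) / 2 := by
      unfold green
      rcases le_total 0 t with h | h
      · rw [abs_of_nonneg h, min_eq_left h, max_eq_right h]; ring
      · rw [abs_of_nonpos h, min_eq_right h, max_eq_left h]; ring
    rw [h1, ← sq_abs t]
    have hx1 : |t| < 1 := abs_lt.2 ht
    generalize |t| = x at *
    nlinarith [mul_nonneg (sub_nonneg.2 hx1.le) (sq_nonneg (x - 1 / 2))]
  refine le_trans ?_ (setIntegral_mono_on (integrableOn_quadratic_abs _ _ _)
    (isKernelCurve_greenCurve.integrable_form _ _) measurableSet_Ioo h)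
  rw [integral_quadratic_abs]
  norm_num

lemma IsKernelCurve.powerFunctional_pos {H : Type*} [NormedAddCommGroup H] [InnerProductSpace ℝ H]
    {g : ℝ → H} (hg : IsKernelCurve g) {q : ℝ} (hq : 0 < q) {f : H} {t : ℝ}
    (ht : t ∈ Ioo (-1 : ℝ) 1) (hf : inner ℝ f (g t) ≠ 0) : 0 < powerFunctional g q f := by
  have h0 : 0 ≤ powerFunctional g q f := by unfold powerFunctional; positivity
  refine h0.lt_of_ne fun h => ?_
  have h1 := (integral_eq_zero_iff_of_nonneg (fun t => by positivity)
    (hg.integrable_rpow f hq.le)).1 h.symm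
  have h2 := Measure.eqOn_open_of_ae_eq h1 isOpen_Ioo
    (((hg.continuousOn_inner f).mono Ioo_subset_Icc_self).abs.rpow_const fun _ _ => Or.inr hq.le)
    continuousOn_const ht
  simp only [Pi.zero_apply] at h2
  exact hf (abs_eq_zero.1 ((Real.rpow_eq_zero (abs_nonneg _) hq.ne').1 h2))

lemma IsKernelCurve.exists_powerFunctional_eq_one {H : Type*} [NormedAddCommGroup H]
    [InnerProductSpace ℝ H]
    {g : ℝ → H} (hg : IsKernelCurve g) {q : ℝ} (hq : 0 < q) {f : H} {t : ℝ}
    (ht : t ∈ Ioo (-1 : ℝ) 1) (hf : inner ℝ f (g t) ≠ 0) :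
    ∃ c : ℝ, 0 < c ∧ powerFunctional g q (c • f) = 1 := by
  have hJ := hg.powerFunctional_pos hq ht hf
  refine ⟨powerFunctional g q f ^ (-(1 / q)), by positivity, ?_⟩
  rw [hg.powerFunctional_smul _ (by positivity), ← Real.rpow_mul hJ.le]
  have : -(1 / q) * q = -1 := by field_simp
  rw [this, Real.rpow_neg_one, inv_mul_cancel₀ hJ.ne']

/-! ### The nonlinearity and the integral equation of the profile -/

lemma continuous_signedPow {q : ℝ} (hq : 1 < q) : Continuous fun x : ℝ => |x| ^ (q - 2) * x := by
  -- Up to the factor q the function is the derivative of the C¹ function |x|^q. This gives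
  -- continuity at 0 also for q < 2, where |x|^(q-2) is singular.
  have h1 : Continuous (deriv fun x : ℝ => ‖x‖ ^ q) :=
    (contDiff_norm_rpow hq).continuous_deriv_one
  have h2 : (deriv fun x : ℝ => ‖x‖ ^ q) = fun x => q * (|x| ^ (q - 2) * x) := by
    funext x
    rw [← mul_assoc]
    exact (hasDerivAt_abs_rpow x hq).deriv
  have h3 : (fun x : ℝ => |x| ^ (q - 2) * x) = fun x => q⁻¹ * deriv (fun x : ℝ => ‖x‖ ^ q) x := by
    funext x
    rw [h2]
    simp only
    rw [inv_mul_cancel_left₀ (by linarith)]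
  rw [h3]
  exact continuous_const.mul h1

lemma integrableOn_inv_sqrt : IntegrableOn (fun t : ℝ => 1 / √(1 - t ^ 2)) (Ioo (-1) 1) := by
  have h := intervalIntegral.integrableOn_deriv_of_nonneg (a := -1) (b := 1) (g := Real.arcsin)
    (g' := fun t => 1 / √(1 - t ^ 2)) Real.continuous_arcsin.continuousOn
    (fun t ht => Real.hasDerivAt_arcsin ht.1.ne' ht.2.ne) fun t _ => by positivity
  exact h.mono_set Ioo_subset_Ioc_self

lemma continuousOn_profile_rhs {w : ℝ → ℝ} {q : ℝ} (hq : 1 < q) (K c : ℝ)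
    (hw : ContinuousOn w (Icc (-1) 1)) :
    ContinuousOn (fun t => K * (w t / (1 - t ^ 2)) + c * (|w t| ^ (q - 2) * w t)) (Ioo (-1) 1) := by
  have hw' := hw.mono Ioo_subset_Icc_self
  refine (continuousOn_const.mul (hw'.div (by fun_prop) fun t ht => (one_sub_sq_pos ht).ne')).add
    (continuousOn_const.mul ?_)
  exact (continuous_signedPow hq).comp_continuousOn hw'

/-- The square-root decay of w at ±1 leaves a singularity of order (1 - t²)^(-1/2), which is
integrable, being the derivative of arcsin. -/
lemma integrableOn_profile_rhs {w : ℝ → ℝ} {q C : ℝ} (hq : 1 < q) (K c : ℝ)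
    (hw : ContinuousOn w (Icc (-1) 1))
    (hC : ∀ t ∈ Icc (-1 : ℝ) 1, w t ^ 2 ≤ C ^ 2 * (1 - t ^ 2)) :
    IntegrableOn (fun t => K * (w t / (1 - t ^ 2)) + c * (|w t| ^ (q - 2) * w t)) (Ioo (-1) 1) := by
  have hw' := hw.mono Ioo_subset_Icc_self
  refine Integrable.add ?_ ?_
  · refine Integrable.const_mul ?_ K
    refine Integrable.mono' (integrableOn_inv_sqrt.const_mul |C|) ?_ ?_
    · exact (hw'.div (by fun_prop) fun t ht => (one_sub_sq_pos ht).ne').aestronglyMeasurable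
        measurableSet_Ioo
    · refine (ae_restrict_iff' measurableSet_Ioo).2 (Eventually.of_forall fun t ht => ?_)
      have h0 := one_sub_sq_pos ht
      have h1 : |w t| ≤ |C| * √(1 - t ^ 2) := by
        rw [← Real.sqrt_sq_eq_abs, ← Real.sqrt_sq_eq_abs, ← Real.sqrt_mul (sq_nonneg C)]
        exact Real.sqrt_le_sqrt (hC t (Ioo_subset_Icc_self ht))
      have h2 : √(1 - t ^ 2) * √(1 - t ^ 2) = 1 - t ^ 2 := Real.mul_self_sqrt h0.le
      have h3 : 0 < √(1 - t ^ 2) := Real.sqrt_pos.2 h0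
      rw [Real.norm_eq_abs, abs_div, abs_of_pos h0, mul_one_div, div_le_div_iff₀ h0 h3]
      calc |w t| * √(1 - t ^ 2) ≤ (|C| * √(1 - t ^ 2)) * √(1 - t ^ 2) := by gcongr
        _ = |C| * (1 - t ^ 2) := by rw [mul_assoc, h2]
  · refine Integrable.const_mul ?_ c
    exact (((continuous_signedPow hq).comp_continuousOn hw).integrableOn_Icc).mono_set
      Ioo_subset_Icc_self

/-- For every `K > 0` the integral equation of the profile has a nontrivial solution. -/
theorem exists_integral_solution {q K : ℝ} (hq : 1 < q) (hK : 0 < K) :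
    ∃ (w : ℝ → ℝ) (c C : ℝ), c ≠ 0 ∧ ContinuousOn w (Icc (-1) 1) ∧
      (∀ t ∈ Icc (-1 : ℝ) 1, w t ^ 2 ≤ C ^ 2 * (1 - t ^ 2)) ∧ (∃ t ∈ Ioo (-1 : ℝ) 1, w t ≠ 0) ∧
      ∀ s ∈ Icc (-1 : ℝ) 1, w s = ∫ t in Ioo (-1 : ℝ) 1,
        (K * (w t / (1 - t ^ 2)) + c * (|w t| ^ (q - 2) * w t)) * green s t := by
  have common : ∀ (g : ℝ → Lp ℝ 2 (volume : Measure ℝ)) (hg : IsKernelCurve g)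
      (f : Lp ℝ 2 (volume : Measure ℝ)) (hf : powerFunctional g q f = 1),
      (∀ t ∈ Icc (-1 : ℝ) 1, (inner ℝ f (g t)) ^ 2 ≤ ‖f‖ ^ 2 * (1 - t ^ 2)) ∧
      (∃ t ∈ Ioo (-1 : ℝ) 1, inner ℝ f (g t) ≠ 0) ∧
      ((∀ h, powerFunctional g q h = 1 →
        ‖f‖ ^ 2 - K * singularForm g f f ≤ ‖h‖ ^ 2 - K * singularForm g h h) →
      ∀ s ∈ Icc (-1 : ℝ) 1, inner ℝ f (g s) = ∫ t in Ioo (-1 : ℝ) 1,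
        (K * (inner ℝ f (g t) / (1 - t ^ 2)) + (‖f‖ ^ 2 - K * singularForm g f f) *
          (|inner ℝ f (g t)| ^ (q - 2) * inner ℝ f (g t))) * inner ℝ (g s) (g t)) := by
    intro g hg f hf
    refine ⟨fun t ht => ?_, ?_, fun hmin s hs => ?_⟩
    · refine (hg.inner_sq_le f ht).trans ?_
      have : 0 ≤ 1 - t ^ 2 := by nlinarith [ht.1, ht.2]
      gcongr; linarith
    · by_contra! hcon
      have : powerFunctional g q f = 0 := by
        unfold powerFunctional
        rw [setIntegral_congr_fun measurableSet_Ioo (g := fun _ => (0 : ℝ)) fun t ht => by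
          simp only [hcon t ht, abs_zero]
          exact Real.zero_rpow (by linarith)]
        simp
      rw [this] at hf; exact zero_ne_one hf
    -- Testing with the evaluation vector g s turns the weak equation into a pointwise one, since
    -- ⟪f, g s⟫ = w s.
    · have h1 := hg.euler_lagrange (K := K) hq hf hmin (g s)
      have hint : IntegrableOn (fun t => |inner ℝ f (g t)| ^ (q - 2) * inner ℝ f (g t) *
          inner ℝ (g s) (g t)) (Ioo (-1 : ℝ) 1) := by
        refine hg.integrable_of_bound (C := ‖f‖ ^ (q - 1) * ‖g s‖) ?_ fun t ht => ?_
        · exact (((hg.aesm_inner f).aemeasurable.abs.pow_const (q - 2)).mul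
            (hg.aesm_inner f).aemeasurable |>.mul
            (hg.aesm_inner (g s)).aemeasurable).aestronglyMeasurable
        · have ht' := Ioo_subset_Icc_self ht
          have h2 := hg.abs_inner_le f ht'
          have h3 := hg.abs_inner_le (g s) ht'
          rw [abs_mul, abs_mul, abs_of_nonneg (by positivity : 0 ≤ |inner ℝ f (g t)| ^ (q - 2))]
          have h4 : |inner ℝ f (g t)| ^ (q - 2) * |inner ℝ f (g t)| ≤ ‖f‖ ^ (q - 1) := by
            have h0 := abs_nonneg (inner ℝ f (g t))
            generalize |inner ℝ f (g t)| = x at *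
            rcases h0.eq_or_lt with h | h
            · rw [← h, mul_zero]; positivity
            · rw [← Real.rpow_add_one h.ne']
              have : q - 2 + 1 = q - 1 := by ring
              rw [this]
              exact Real.rpow_le_rpow h0 h2 (by linarith)
          gcongr
      have h2 : inner ℝ f (g s) = K * singularForm g f (g s) +
          (‖f‖ ^ 2 - K * singularForm g f f) * ∫ t in Ioo (-1 : ℝ) 1,
            |inner ℝ f (g t)| ^ (q - 2) * inner ℝ f (g t) * inner ℝ (g s) (g t) := by linarith
      rw [h2]
      unfold singularForm
      rw [← integral_const_mul, ← integral_const_mul, ← integral_add]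
      · refine integral_congr_ae (Eventually.of_forall fun t => ?_)
        simp only; ring
      · exact (hg.integrable_form f (g s)).const_mul _
      · exact hint.const_mul _
  have : Fact ((2 : ENNReal) ≠ ⊤) := ⟨by simp⟩
  have : SecondCountableTopology (Lp ℝ 2 (volume : Measure ℝ)) := Lp.SecondCountableTopology
  -- The multiplier must not vanish. For K > 3 the tent function makes the minimum negative. For K ≤
  -- 3, where the full problem may have minimum zero (as at the eigenvalue K = 2), only odd
  -- functions compete, and the minimum is positive.
  rcases lt_or_ge 3 K with hK3 | hK3
  · have hg := isKernelCurve_greenCurve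
    have h0 : inner ℝ (greenCurve 0) (greenCurve 0) = (1 / 2 : ℝ) := by
      rw [inner_greenCurve (by norm_num) (by norm_num), green_self]; norm_num
    obtain ⟨c, hc, hc1⟩ := hg.exists_powerFunctional_eq_one (q := q) (by linarith)
      (f := greenCurve 0) (t := 0) (by norm_num) (by rw [h0]; norm_num)
    obtain ⟨f, hf, hmin⟩ := hg.exists_minimizer hq hK ⟨_, hc1⟩
    obtain ⟨h1, h2, h3⟩ := common _ hg f hf
    refine ⟨fun t => inner ℝ f (greenCurve t), ‖f‖ ^ 2 - K * singularForm greenCurve f f, ‖f‖,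
      ?_, hg.continuousOn_inner f, h1, h2, fun s hs => ?_⟩
    · have h4 := hmin _ hc1
      have h5 := hg.singularForm_add_smul 0 (greenCurve 0) c
      have h6 : singularForm greenCurve 0 (0 : Lp ℝ 2 (volume : Measure ℝ)) = 0 := by
        simp [singularForm]
      have h7 : singularForm greenCurve 0 (greenCurve 0) = 0 := by simp [singularForm]
      rw [zero_add, h6, h7] at h5
      have h8 := le_singularForm_greenCurve_zero
      rw [h5, norm_smul, mul_pow, ← real_inner_self_eq_norm_sq (greenCurve 0), h0,
        Real.norm_eq_abs, sq_abs] at h4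
      have h9 : 0 < c ^ 2 := by positivity
      have h10 : K * (1 / 6) ≤ K * singularForm greenCurve (greenCurve 0) (greenCurve 0) := by
        gcongr
      -- The minimum is at most c²(1/2 - K/6), which is negative for K > 3.
      apply ne_of_lt
      nlinarith
    · refine (h3 hmin s hs).trans ?_
      refine setIntegral_congr_fun measurableSet_Ioo fun t ht => ?_
      simp only
      rw [inner_greenCurve hs (Ioo_subset_Icc_self ht)]
  · have hg := isKernelCurve_oddCurve
    have hhalf : (1 / 2 : ℝ) ∈ Icc (-1 : ℝ) 1 := by norm_num
    obtain ⟨c, hc, hc1⟩ := hg.exists_powerFunctional_eq_one (q := q) (by linarith)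
      (f := oddCurve (1 / 2)) (t := 1 / 2) (by norm_num) (by
        rw [real_inner_self_eq_norm_sq, norm_sq_oddCurve hhalf, abs_of_pos (by norm_num)]
        norm_num)
    obtain ⟨f, hf, hmin⟩ := hg.exists_minimizer hq hK ⟨_, hc1⟩
    obtain ⟨h1, h2, h3⟩ := common _ hg f hf
    set μ := ‖f‖ ^ 2 - K * singularForm oddCurve f f with hμ
    set w : ℝ → ℝ := fun t => inner ℝ f (oddCurve t) with hw
    set h : ℝ → ℝ := fun t => K * (w t / (1 - t ^ 2)) + μ * (|w t| ^ (q - 2) * w t) with hh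
    have hwodd : ∀ t, w (-t) = - w t := fun t => by
      simp only [hw, oddCurve_neg, inner_neg_right]
    have hhodd : ∀ t, h (-t) = - h t := fun t => by
      simp only [hh, hwodd, abs_neg, neg_sq]; ring
    refine ⟨w, μ, ‖f‖, ?_, hg.continuousOn_inner f, h1, h2, fun s hs => ?_⟩
    · have h4 := singularForm_oddCurve_le f
      have h5 : f ≠ 0 := by
        rintro rfl
        obtain ⟨t, -, ht⟩ := h2
        exact ht (by simp)
      have h6 : 0 < ‖f‖ := norm_pos_iff.2 h5
      have h7 : K * singularForm oddCurve f f ≤ 3 * (17 / 54 * ‖f‖ ^ 2) :=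
        (mul_le_mul_of_nonneg_left h4 hK.le).trans (by gcongr)
      -- Here K · 17/54 ≤ 17/18 < 1, and f ≠ 0.
      apply ne_of_gt
      rw [hμ]
      nlinarith
    · have h4 : w s = ∫ t in Ioo (-1 : ℝ) 1, h t * ((green s t - green s (-t)) / 2) := by
        rw [show w s = inner ℝ f (oddCurve s) from rfl, h3 hmin s hs]
        refine setIntegral_congr_fun measurableSet_Ioo fun t ht => ?_
        simp only [hh, hw]
        rw [inner_oddCurve hs (Ioo_subset_Icc_self ht)]
      change w s = ∫ t in Ioo (-1 : ℝ) 1, h t * green s t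
      have hint : ∀ G : ℝ → ℝ, Continuous G → IntegrableOn (fun t => h t * G t) (Ioo (-1) 1) := by
        intro G hG
        obtain ⟨B, hB⟩ := isCompact_Icc.exists_bound_of_continuousOn (s := Icc (-1 : ℝ) 1)
          hG.continuousOn
        refine Integrable.mul_bdd (c := B) (integrableOn_profile_rhs hq K μ (hg.continuousOn_inner f) h1)
          hG.aestronglyMeasurable ?_
        exact (ae_restrict_iff' measurableSet_Ioo).2
          (Eventually.of_forall fun t ht => hB t (Ioo_subset_Icc_self ht))
      -- The right-hand side is odd, so the reflected kernel contributes the same as the original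
      -- one. A critical point among odd functions thus solves the equation with the full Green
      -- function.
      have h5 : ∫ t in Ioo (-1 : ℝ) 1, h t * green s (-t) =
          - ∫ t in Ioo (-1 : ℝ) 1, h t * green s t := by
        rw [← integral_Ioc_eq_integral_Ioo, ← intervalIntegral.integral_of_le (by norm_num),
          ← integral_Ioc_eq_integral_Ioo, ← intervalIntegral.integral_of_le (by norm_num)]
        have h6 := intervalIntegral.integral_comp_neg (a := -1) (b := 1)
          fun t => h (-t) * green s t
        simp only [neg_neg] at h6
        rw [h6, ← intervalIntegral.integral_neg]
        refine intervalIntegral.integral_congr fun t _ => ?_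
        simp only [hhodd]; ring
      have h7 : ∫ t in Ioo (-1 : ℝ) 1, h t * ((green s t - green s (-t)) / 2) =
          (∫ t in Ioo (-1 : ℝ) 1, h t * green s t) / 2 -
          (∫ t in Ioo (-1 : ℝ) 1, h t * green s (-t)) / 2 := by
        rw [← integral_div, ← integral_div, ← integral_sub]
        · refine integral_congr_ae (Eventually.of_forall fun t => ?_)
          simp only; ring
        · exact (hint _ (by unfold green; fun_prop)).div_const 2
        · exact (hint _ (by unfold green; fun_prop)).div_const 2
      rw [h4, h7, h5]
      ring

/-- The odd power `|x|^(q-2) x`. -/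
noncomputable def signedPow (q x : ℝ) : ℝ := |x| ^ (q - 2) * x

lemma hasDerivAt_signedPow {q : ℝ} (hq : 2 < q) (x : ℝ) :
    HasDerivAt (signedPow q) ((q - 1) * |x| ^ (q - 2)) x := by
  rcases eq_or_ne x 0 with rfl | hx
  · rw [abs_zero, Real.zero_rpow (by linarith), mul_zero, hasDerivAt_iff_tendsto_slope]
    have h1 : ContinuousAt (fun x : ℝ => |x| ^ (q - 2)) 0 :=
      (continuous_abs.rpow_const fun _ => Or.inr (by linarith)).continuousAt
    have h2 : Tendsto (fun x : ℝ => |x| ^ (q - 2)) (𝓝[≠] 0) (𝓝 0) := by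
      have h3 := h1.tendsto
      rw [abs_zero, Real.zero_rpow (by linarith)] at h3
      exact h3.mono_left nhdsWithin_le_nhds
    refine h2.congr' ?_
    filter_upwards [self_mem_nhdsWithin] with y hy
    have hy' : y ≠ 0 := hy
    simp only [slope_def_field, signedPow, mul_zero, sub_zero]
    field_simp
  · have hx0 : 0 < |x| := abs_pos.2 hx
    have h1 := ((hasDerivAt_abs hx).rpow_const (p := q - 2) (Or.inl hx0.ne')).fun_mul
      (hasDerivAt_id x)
    refine h1.congr_deriv ?_
    have h2 : (SignType.sign x : ℝ) * x = |x| := sign_mul_self x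
    have h3 : |x| ^ (q - 2 - 1) * |x| = |x| ^ (q - 2) := by
      rw [← Real.rpow_add_one hx0.ne']; congr 1; ring
    simp only [id, mul_one]
    calc _ = (q - 2) * (|x| ^ (q - 2 - 1) * ((SignType.sign x : ℝ) * x)) + |x| ^ (q - 2) := by ring
      _ = _ := by rw [h2, h3]; ring

lemma contDiff_signedPow {q : ℝ} (hq : 2 < q) : ContDiff ℝ 1 (signedPow q) := by
  rw [contDiff_one_iff_deriv]
  refine ⟨fun x => (hasDerivAt_signedPow hq x).differentiableAt, ?_⟩
  have : deriv (signedPow q) = fun x => (q - 1) * |x| ^ (q - 2) :=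
    funext fun x => (hasDerivAt_signedPow hq x).deriv
  rw [this]
  exact continuous_const.mul (continuous_abs.rpow_const fun _ => Or.inr (by linarith))

lemma continuous_signedPow' {q : ℝ} (hq : 1 < q) : Continuous (signedPow q) :=
  continuous_signedPow hq

/-! ### From the integral equation to the differential equation -/

lemma hasDerivAt_primitive_Ioo {F : ℝ → ℝ} (hi : IntegrableOn F (Ioo (-1) 1))
    (hc : ContinuousOn F (Ioo (-1) 1)) {s : ℝ} (hs : s ∈ Ioo (-1 : ℝ) 1) :
    HasDerivAt (fun s => ∫ t in (-1 : ℝ)..s, F t) (F s) s := by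
  have h1 : IntervalIntegrable F volume (-1) s := by
    rw [intervalIntegrable_iff_integrableOn_Ioo_of_le hs.1.le]
    exact hi.mono_set (Ioo_subset_Ioo_right hs.2.le)
  exact intervalIntegral.integral_hasDerivAt_right h1
    (hc.stronglyMeasurableAtFilter isOpen_Ioo s hs) (hc.continuousAt (isOpen_Ioo.mem_nhds hs))

lemma continuousOn_primitive_Icc {F : ℝ → ℝ} (hi : IntegrableOn F (Ioo (-1) 1)) :
    ContinuousOn (fun s => ∫ t in (-1 : ℝ)..s, F t) (Icc (-1) 1) := by
  have := intervalIntegral.continuousOn_primitive_interval (μ := volume) (f := F)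
    (a := -1) (b := 1) (by
      rw [uIcc_of_le (by norm_num), integrableOn_Icc_iff_integrableOn_Ioo]; exact hi)
  rwa [uIcc_of_le (by norm_num)] at this

/-- A Green potential of an integrable function, continuous in the open interval, has two
derivatives; the first one is continuous up to the end points. -/
theorem green_potential {w h : ℝ → ℝ} (hi : IntegrableOn h (Ioo (-1) 1))
    (hc : ContinuousOn h (Ioo (-1) 1))
    (hw : ∀ s ∈ Icc (-1 : ℝ) 1, w s = ∫ t in Ioo (-1 : ℝ) 1, h t * green s t) :
    ∃ w₁ : ℝ → ℝ, ContinuousOn w₁ (Icc (-1) 1) ∧ w (-1) = 0 ∧ w 1 = 0 ∧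
      (∀ s ∈ Ioo (-1 : ℝ) 1, HasDerivAt w (w₁ s) s) ∧
      ∀ s ∈ Ioo (-1 : ℝ) 1, HasDerivAt w₁ (-h s) s := by
  have hm : ∀ G : ℝ → ℝ, Continuous G → IntegrableOn (fun t => h t * G t) (Ioo (-1) 1) := by
    intro G hG
    obtain ⟨B, hB⟩ := isCompact_Icc.exists_bound_of_continuousOn (s := Icc (-1 : ℝ) 1)
      hG.continuousOn
    refine Integrable.mul_bdd (c := B) hi hG.aestronglyMeasurable ?_
    exact (ae_restrict_iff' measurableSet_Ioo).2
      (Eventually.of_forall fun t ht => hB t (Ioo_subset_Icc_self ht))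
  set A : ℝ → ℝ := fun s => ∫ t in (-1 : ℝ)..s, h t * (1 + t) with hA
  set B : ℝ → ℝ := fun s => ∫ t in (-1 : ℝ)..s, h t * (1 - t) with hB
  have hAi := hm (fun t => 1 + t) (by fun_prop)
  have hBi := hm (fun t => 1 - t) (by fun_prop)
  have hAd : ∀ s ∈ Ioo (-1 : ℝ) 1, HasDerivAt A (h s * (1 + s)) s := fun s hs =>
    hasDerivAt_primitive_Ioo hAi (hc.mul (by fun_prop)) hs
  have hBd : ∀ s ∈ Ioo (-1 : ℝ) 1, HasDerivAt B (h s * (1 - s)) s := fun s hs =>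
    hasDerivAt_primitive_Ioo hBi (hc.mul (by fun_prop)) hs
  -- Splitting the integral at t = s resolves the minimum and maximum in the kernel. The terms from
  -- differentiating the limits of integration cancel in w', which is why w' is continuous up to ±1.
  have hw' : ∀ s ∈ Icc (-1 : ℝ) 1, w s = ((1 - s) * A s + (1 + s) * (B 1 - B s)) / 2 := by
    intro s hs
    have hgi : ∀ a b : ℝ, a ∈ Icc (-1 : ℝ) 1 → b ∈ Icc (-1 : ℝ) 1 → ∀ G : ℝ → ℝ, Continuous G →
        IntervalIntegrable (fun t => h t * G t) volume a b := by
      intro a b ha hb G hG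
      rw [intervalIntegrable_iff]
      have := (integrableOn_Icc_iff_integrableOn_Ioo (μ := volume)).2 (hm G hG)
      exact this.mono_set (uIoc_subset_uIcc.trans (uIcc_subset_Icc ha hb))
    have hl : (-1 : ℝ) ∈ Icc (-1 : ℝ) 1 := by norm_num
    have hr : (1 : ℝ) ∈ Icc (-1 : ℝ) 1 := by norm_num
    have hg : Continuous fun t => green s t := by unfold green; fun_prop
    rw [hw s hs, ← integral_Ioc_eq_integral_Ioo, ← intervalIntegral.integral_of_le (by norm_num),
      ← intervalIntegral.integral_add_adjacent_intervals (hgi (-1) s hl hs _ hg)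
        (hgi s 1 hs hr _ hg)]
    have h1 : ∫ t in (-1 : ℝ)..s, h t * green s t = (1 - s) / 2 * A s := by
      rw [hA]
      simp only
      rw [← intervalIntegral.integral_const_mul]
      refine intervalIntegral.integral_congr fun t ht => ?_
      rw [uIcc_of_le hs.1] at ht
      simp only [green, min_eq_right ht.2, max_eq_left ht.2]; ring
    have h2 : ∫ t in s..1, h t * green s t = (1 + s) / 2 * (B 1 - B s) := by
      rw [hB]
      simp only
      rw [intervalIntegral.integral_interval_sub_left (hgi (-1) 1 hl hr _ (by fun_prop))
        (hgi (-1) s hl hs _ (by fun_prop)), ← intervalIntegral.integral_const_mul]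
      refine intervalIntegral.integral_congr fun t ht => ?_
      rw [uIcc_of_le hs.2] at ht
      simp only [green, min_eq_left ht.1, max_eq_right ht.1]; ring
    rw [h1, h2]; ring
  refine ⟨fun s => (B 1 - B s - A s) / 2, ?_, ?_, ?_, fun s hs => ?_, fun s hs => ?_⟩
  · exact ((continuousOn_const.sub (continuousOn_primitive_Icc hBi)).sub
      (continuousOn_primitive_Icc hAi)).div_const 2
  · rw [hw' _ (by norm_num)]; simp [hA]
  · rw [hw' _ (by norm_num)]; simp
  · have h1 : HasDerivAt (fun s => ((1 - s) * A s + (1 + s) * (B 1 - B s)) / 2)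
        ((B 1 - B s - A s) / 2) s := by
      have h2 := ((((hasDerivAt_id s).const_sub 1).fun_mul (hAd s hs)).fun_add
        (((hasDerivAt_id s).const_add 1).fun_mul ((hBd s hs).const_sub (B 1)))).div_const 2
      refine h2.congr_deriv ?_
      simp only [id]; ring
    refine h1.congr_of_eventuallyEq ?_
    filter_upwards [isOpen_Ioo.mem_nhds hs] with y hy using hw' y (Ioo_subset_Icc_self hy)
  · have h2 := (((hBd s hs).const_sub (B 1)).fun_sub (hAd s hs)).div_const 2
    refine h2.congr_deriv ?_
    ring

/-! ### Regularity up to the end points -/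

/-- Weighted Hadamard mean `∫₀¹ κ(σ) φ(t + σ (e - t)) dσ`. -/
noncomputable def hadamardMean (e : ℝ) (κ φ : ℝ → ℝ) (t : ℝ) : ℝ :=
  ∫ σ in (0 : ℝ)..1, κ σ * φ (t + σ * (e - t))

lemma continuous_hadamardMean (e : ℝ) {κ φ : ℝ → ℝ} (hκ : Continuous κ) (hφ : Continuous φ) :
    Continuous (hadamardMean e κ φ) := by
  unfold hadamardMean
  exact intervalIntegral.continuous_parametric_intervalIntegral_of_continuous' (by fun_prop) 0 1

/-- Differentiation brings out a factor 1 - σ. Allowing a general weight κ keeps the class of means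
closed under differentiation, as the induction on smoothness requires. -/
lemma hasDerivAt_hadamardMean (e : ℝ) {κ φ : ℝ → ℝ} (hκ : Continuous κ) (hφ : ContDiff ℝ 1 φ)
    (t : ℝ) : HasDerivAt (hadamardMean e κ φ)
      (hadamardMean e (fun σ => κ σ * (1 - σ)) (deriv φ) t) t := by
  have hφ' := hφ.continuous_deriv_one
  have hφc := hφ.continuous
  have hcont : Continuous fun z : ℝ × ℝ => κ z.2 * (1 - z.2) * deriv φ (z.1 + z.2 * (e - z.1)) := by
    fun_prop
  obtain ⟨C, hC⟩ := ((isCompact_closedBall t 1).prod (isCompact_Icc (a := (0 : ℝ)) (b := 1))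
    ).exists_bound_of_continuousOn hcont.continuousOn
  have := intervalIntegral.hasDerivAt_integral_of_dominated_loc_of_deriv_le (𝕜 := ℝ)
    (μ := volume) (a := 0) (b := 1) (x₀ := t) (s := Metric.ball t 1)
    (F := fun t σ => κ σ * φ (t + σ * (e - t)))
    (F' := fun t σ => κ σ * (1 - σ) * deriv φ (t + σ * (e - t))) (bound := fun _ => C)
    (Metric.ball_mem_nhds t one_pos)
    (Eventually.of_forall fun t => (by fun_prop :
      Continuous fun σ => κ σ * φ (t + σ * (e - t))).aestronglyMeasurable)
    ((by fun_prop : Continuous fun σ => κ σ * φ (t + σ * (e - t))).intervalIntegrable _ _)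
    ((by fun_prop : Continuous fun σ =>
      κ σ * (1 - σ) * deriv φ (t + σ * (e - t))).aestronglyMeasurable)
    (Eventually.of_forall fun σ hσ x hx => hC (x, σ)
      ⟨Metric.ball_subset_closedBall hx, by
        rw [uIoc_of_le zero_le_one] at hσ; exact Ioc_subset_Icc_self hσ⟩)
    intervalIntegrable_const
    (Eventually.of_forall fun σ _ x _ => by
      have h1 : HasDerivAt (fun x => x + σ * (e - x)) (1 - σ) x := by
        refine ((hasDerivAt_id x).fun_add (((hasDerivAt_id x).const_sub e).const_mul σ)).congr_deriv ?_
        ring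
      have h2 := ((hφ.differentiable one_ne_zero _).hasDerivAt.comp x h1).const_mul (κ σ)
      exact h2.congr_deriv (by ring))
  exact this.2

lemma contDiff_hadamardMean (e : ℝ) (n : ℕ) : ∀ {κ φ : ℝ → ℝ}, Continuous κ → ContDiff ℝ n φ →
    ContDiff ℝ n (hadamardMean e κ φ) := by
  induction n with
  | zero =>
    intro κ φ hκ hφ
    simp only [Nat.cast_zero, contDiff_zero] at hφ ⊢
    exact continuous_hadamardMean e hκ hφ
  | succ n ih =>
    intro κ φ hκ hφ
    have h1 : ContDiff ℝ 1 φ := hφ.of_le (by norm_cast; omega)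
    push_cast at hφ ⊢
    rw [contDiff_succ_iff_deriv] at hφ ⊢
    refine ⟨fun t => (hasDerivAt_hadamardMean e hκ h1 t).differentiableAt, by simp, ?_⟩
    rw [funext fun t => (hasDerivAt_hadamardMean e hκ h1 t).deriv]
    exact ih (by fun_prop) hφ.2.2

/-- The primitive of `φ` vanishing at `-1`. -/
noncomputable def primitiveFrom (φ : ℝ → ℝ) (t : ℝ) : ℝ := ∫ s in (-1 : ℝ)..t, φ s

/-- The quotient of `primitiveFrom φ` by `1 - t²`, when `φ` has mean zero on `[-1, 1]`. -/
noncomputable def primitiveQuotient (φ : ℝ → ℝ) (t : ℝ) : ℝ :=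
  (hadamardMean (-1) (fun _ => 1) φ t - hadamardMean 1 (fun _ => 1) φ t) / 2

lemma hasDerivAt_primitiveFrom {φ : ℝ → ℝ} (hφ : Continuous φ) (t : ℝ) :
    HasDerivAt (primitiveFrom φ) (φ t) t :=
  intervalIntegral.integral_hasDerivAt_right (hφ.intervalIntegrable _ _)
    (hφ.stronglyMeasurableAtFilter _ _) hφ.continuousAt

lemma contDiff_primitiveFrom {φ : ℝ → ℝ} {n : ℕ} (hφ : ContDiff ℝ n φ) :
    ContDiff ℝ (n + 1) (primitiveFrom φ) := by
  rw [contDiff_succ_iff_deriv]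
  refine ⟨fun t => (hasDerivAt_primitiveFrom hφ.continuous t).differentiableAt, by simp, ?_⟩
  rwa [funext fun t => (hasDerivAt_primitiveFrom hφ.continuous t).deriv]

lemma contDiff_primitiveQuotient {φ : ℝ → ℝ} {n : ℕ} (hφ : ContDiff ℝ n φ) :
    ContDiff ℝ n (primitiveQuotient φ) :=
  ((contDiff_hadamardMean _ n continuous_const hφ).sub
    (contDiff_hadamardMean _ n continuous_const hφ)).div_const 2

lemma mul_hadamardMean_one (e : ℝ) (φ : ℝ → ℝ) (t : ℝ) :
    (e - t) * hadamardMean e (fun _ => 1) φ t = ∫ s in t..e, φ s := by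
  unfold hadamardMean
  have := intervalIntegral.mul_integral_comp_add_mul (a := 0) (b := 1) (f := φ) (e - t) t
  simp only [mul_zero, add_zero, mul_one, add_sub_cancel] at this
  rw [← this]
  simp only [one_mul, mul_comm (e - t)]

/-- With zero mean, the primitive F is (1 + t) times the mean of φ between t and -1, and also -(1 -
t) times the mean between t and 1. Weighting these by (1 - t)/2 and (1 + t)/2 extracts the factor 1
- t² without division, so the quotient is as smooth as φ. -/
lemma primitiveFrom_eq_mul {φ : ℝ → ℝ} (hφ : Continuous φ) (h0 : primitiveFrom φ 1 = 0) (t : ℝ) :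
    primitiveFrom φ t = (1 - t ^ 2) * primitiveQuotient φ t := by
  have h1 := mul_hadamardMean_one (-1) φ t
  have h2 := mul_hadamardMean_one 1 φ t
  have h3 : ∫ s in t..(-1), φ s = - primitiveFrom φ t := intervalIntegral.integral_symm _ _
  have h4 : primitiveFrom φ t + ∫ s in t..1, φ s = 0 := by
    rw [← h0]
    exact intervalIntegral.integral_add_adjacent_intervals (hφ.intervalIntegrable _ _)
      (hφ.intervalIntegrable _ _)
  rw [h3] at h1
  unfold primitiveQuotient
  linear_combination (1 - t) / 2 * h1 + (1 + t) / 2 * h2 + (1 + t) / 2 * h4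

lemma primitiveFrom_congr {φ χ : ℝ → ℝ} (h : EqOn φ χ (Icc (-1) 1)) :
    EqOn (primitiveFrom φ) (primitiveFrom χ) (Icc (-1) 1) := by
  intro t ht
  refine intervalIntegral.integral_congr fun s hs => h ?_
  rw [uIcc_of_le ht.1] at hs
  exact ⟨hs.1, hs.2.trans ht.2⟩

/-- The segments from t to ±1 stay in the interval, so the way φ is extended outside is immaterial.
-/
lemma primitiveQuotient_congr {φ χ : ℝ → ℝ} (h : EqOn φ χ (Icc (-1) 1)) :
    EqOn (primitiveQuotient φ) (primitiveQuotient χ) (Icc (-1) 1) := by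
  intro t ht
  have key : ∀ e ∈ Icc (-1 : ℝ) 1, hadamardMean e (fun _ => 1) φ t =
      hadamardMean e (fun _ => 1) χ t := by
    intro e he
    refine intervalIntegral.integral_congr fun σ hσ => ?_
    rw [uIcc_of_le zero_le_one] at hσ
    simp only [one_mul]
    refine h ?_
    have := (convex_Icc (-1 : ℝ) 1) ht he (sub_nonneg.2 hσ.2) hσ.1 (by ring)
    simp only [smul_eq_mul] at this
    convert this using 1
    ring
  unfold primitiveQuotient
  rw [key _ (by norm_num), key _ (by norm_num)]

/-- One step of the regularity bootstrap: if `w'' = -(K w / (1 - t²) + c w |w|^(q-2))` and `φ`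
extends `w'`, then so does the integral of the extended right-hand side. -/
noncomputable def bootstrap (K c q : ℝ) (φ : ℝ → ℝ) (t : ℝ) : ℝ :=
  φ 0 - ∫ s in (0 : ℝ)..t, (K * primitiveQuotient φ s + c * signedPow q (primitiveFrom φ s))

section Bootstrap

variable {K c q : ℝ} {φ w₁ : ℝ → ℝ}

lemma continuous_bootstrap_rhs (hq : 1 < q) (hφ : Continuous φ) :
    Continuous fun s => K * primitiveQuotient φ s + c * signedPow q (primitiveFrom φ s) := by
  have h1 : Continuous (primitiveQuotient φ) :=
    (contDiff_primitiveQuotient (n := 0) (by simpa using hφ)).continuous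
  have h2 : Continuous (primitiveFrom φ) :=
    (contDiff_primitiveFrom (n := 0) (by simpa using hφ)).continuous
  exact (h1.const_mul K).add (((continuous_signedPow' hq).comp h2).const_mul c)

lemma hasDerivAt_bootstrap (hq : 1 < q) (hφ : Continuous φ) (t : ℝ) :
    HasDerivAt (bootstrap K c q φ)
      (-(K * primitiveQuotient φ t + c * signedPow q (primitiveFrom φ t))) t := by
  have hc := continuous_bootstrap_rhs (K := K) (c := c) hq hφ
  exact (intervalIntegral.integral_hasDerivAt_right (hc.intervalIntegrable _ _)
    (hc.stronglyMeasurableAtFilter _ _) hc.continuousAt).const_sub (φ 0)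

lemma contDiff_bootstrap (hq : 1 < q) (hφ : Continuous φ) : ContDiff ℝ 1 (bootstrap K c q φ) := by
  rw [contDiff_one_iff_deriv]
  refine ⟨fun t => (hasDerivAt_bootstrap hq hφ t).differentiableAt, ?_⟩
  rw [funext fun t => (hasDerivAt_bootstrap (K := K) (c := c) hq hφ t).deriv]
  exact (continuous_bootstrap_rhs hq hφ).neg

lemma contDiff_two_bootstrap (hq : 2 < q) (hφ : ContDiff ℝ 1 φ) :
    ContDiff ℝ 2 (bootstrap K c q φ) := by
  have hq1 : 1 < q := by linarith
  rw [show (2 : WithTop ℕ∞) = 1 + 1 by norm_num, contDiff_succ_iff_deriv]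
  refine ⟨fun t => (hasDerivAt_bootstrap hq1 hφ.continuous t).differentiableAt, by simp, ?_⟩
  rw [funext fun t => (hasDerivAt_bootstrap (K := K) (c := c) hq1 hφ.continuous t).deriv]
  have h1 : ContDiff ℝ 1 (primitiveQuotient φ) :=
    contDiff_primitiveQuotient (n := 1) (by simpa using hφ)
  have h2 : ContDiff ℝ 1 (primitiveFrom φ) :=
    (contDiff_primitiveFrom (n := 1) (by simpa using hφ)).of_le (by norm_cast)
  exact ((contDiff_const.mul h1).add
    (contDiff_const.mul ((contDiff_signedPow hq).comp h2))).neg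

/-- Both functions have the same derivative on the open interval and the same value at 0; continuity
carries the equality to the end points. This lets the smoother function `bootstrap` replace φ as an
extension of w'. -/
lemma bootstrap_eqOn (hq : 1 < q) (hφ : Continuous φ) (hφ1 : primitiveFrom φ 1 = 0)
    (hφw : EqOn φ w₁ (Icc (-1) 1))
    (hw₁ : ∀ t ∈ Ioo (-1 : ℝ) 1, HasDerivAt w₁
      (-(K * (primitiveFrom φ t / (1 - t ^ 2)) + c * signedPow q (primitiveFrom φ t))) t) :
    EqOn (bootstrap K c q φ) w₁ (Icc (-1) 1) := by
  have hopen : EqOn (bootstrap K c q φ) φ (Ioo (-1) 1) := by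
    refine isOpen_Ioo.eqOn_of_deriv_eq (𝕜 := ℝ) isPreconnected_Ioo
      (fun t _ => (hasDerivAt_bootstrap hq hφ t).differentiableAt.differentiableWithinAt) ?_ ?_
      (show (0 : ℝ) ∈ Ioo (-1) 1 by norm_num) ?_
    · intro t ht
      refine ((hw₁ t ht).congr_of_eventuallyEq ?_).differentiableAt.differentiableWithinAt
      filter_upwards [isOpen_Ioo.mem_nhds ht] with y hy using hφw (Ioo_subset_Icc_self hy)
    · intro t ht
      have h1 : HasDerivAt φ _ t := (hw₁ t ht).congr_of_eventuallyEq (by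
        filter_upwards [isOpen_Ioo.mem_nhds ht] with y hy using hφw (Ioo_subset_Icc_self hy))
      rw [(hasDerivAt_bootstrap hq hφ t).deriv, h1.deriv]
      have h2 := primitiveFrom_eq_mul hφ hφ1 t
      have h3 : primitiveFrom φ t / (1 - t ^ 2) = primitiveQuotient φ t := by
        rw [h2, mul_div_cancel_left₀ _ (one_sub_sq_pos ht).ne']
      rw [h3]
    · simp [bootstrap]
  have hb : Continuous (bootstrap K c q φ) := (contDiff_bootstrap hq hφ).continuous
  have hcl := hopen.closure hb hφ
  rw [closure_Ioo (by norm_num)] at hcl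
  exact hcl.trans hφw

end Bootstrap

/-- The profile of a homogeneous solution without swirl: for all `K > 0`, `q > 1` there is a
nontrivial solution of `(1 - t²) W'' + K W + c (1 - t²) |W|^(q-2) W = 0`, `W(±1) = 0`, `c ≠ 0`. -/
theorem exists_profile {K q : ℝ} (hK : 0 < K) (hq : 1 < q) :
    ∃ (c : ℝ) (W V : ℝ → ℝ), c ≠ 0 ∧ ContDiff ℝ 2 W ∧ ContDiff ℝ 1 V ∧
      (2 < q → ContDiff ℝ 3 W ∧ ContDiff ℝ 2 V) ∧
      (∀ t ∈ Icc (-1 : ℝ) 1, W t = (1 - t ^ 2) * V t) ∧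
      (∀ t ∈ Icc (-1 : ℝ) 1, deriv (deriv W) t = -(K * V t + c * signedPow q (W t))) ∧
      ∃ t ∈ Ioo (-1 : ℝ) 1, W t ≠ 0 := by
  obtain ⟨w, c, C, hc, hw, hC, hne, heq⟩ := exists_integral_solution hq hK
  obtain ⟨w₁, hw₁, hwl, hwr, hd, hd₁⟩ := green_potential (integrableOn_profile_rhs hq K c hw hC)
    (continuousOn_profile_rhs hq K c hw) heq
  have hprim : ∀ φ : ℝ → ℝ, Continuous φ → EqOn φ w₁ (Icc (-1) 1) →
      EqOn (primitiveFrom φ) w (Icc (-1) 1) := by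
    intro φ hφ hφw t ht
    unfold primitiveFrom
    rw [intervalIntegral.integral_eq_sub_of_hasDerivAt_of_le ht.1
      (hw.mono (Icc_subset_Icc_right ht.2)) (fun s hs => ?_) (hφ.intervalIntegrable _ _),
      hwl, sub_zero]
    rw [hφw ⟨hs.1.le, hs.2.le.trans ht.2⟩]
    exact hd s ⟨hs.1, hs.2.trans_le ht.2⟩
  have hstep : ∀ φ : ℝ → ℝ, Continuous φ → EqOn φ w₁ (Icc (-1) 1) →
      EqOn (bootstrap K c q φ) w₁ (Icc (-1) 1) := by
    intro φ hφ hφw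
    have h1 := hprim φ hφ hφw
    refine bootstrap_eqOn hq hφ (by rw [h1 (by norm_num), hwr]) hφw fun t ht => ?_
    rw [h1 (Ioo_subset_Icc_self ht)]
    exact hd₁ t ht
  have hfin : ∀ φ : ℝ → ℝ, Continuous φ → EqOn φ w₁ (Icc (-1) 1) →
      (∀ t ∈ Icc (-1 : ℝ) 1, primitiveFrom (bootstrap K c q φ) t =
        (1 - t ^ 2) * primitiveQuotient (bootstrap K c q φ) t) ∧
      (∀ t ∈ Icc (-1 : ℝ) 1, deriv (deriv (primitiveFrom (bootstrap K c q φ))) t =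
        -(K * primitiveQuotient (bootstrap K c q φ) t
          + c * signedPow q (primitiveFrom (bootstrap K c q φ) t))) ∧
      ∃ t ∈ Ioo (-1 : ℝ) 1, primitiveFrom (bootstrap K c q φ) t ≠ 0 := by
    intro φ hφ hφw
    have hb := (contDiff_bootstrap (K := K) (c := c) hq hφ).continuous
    have hbw := hstep φ hφ hφw
    have hφb : EqOn φ (bootstrap K c q φ) (Icc (-1) 1) := hφw.trans hbw.symm
    refine ⟨fun t _ => primitiveFrom_eq_mul hb ?_ t, fun t ht => ?_, ?_⟩
    · rw [hprim _ hb hbw (by norm_num), hwr]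
    · rw [funext fun t => (hasDerivAt_primitiveFrom hb t).deriv,
        (hasDerivAt_bootstrap hq hφ t).deriv, primitiveQuotient_congr hφb ht,
        primitiveFrom_congr hφb ht]
    · obtain ⟨t, ht, h⟩ := hne
      exact ⟨t, ht, by rwa [hprim _ hb hbw (Ioo_subset_Icc_self ht)]⟩
  -- The start of the bootstrap is merely continuous: w' extended by its end values. Each step gains
  -- one derivative as long as the nonlinearity permits.
  set φ₀ : ℝ → ℝ := IccExtend (show (-1 : ℝ) ≤ 1 by norm_num) (domRestrict (Icc (-1) 1) w₁) with hφ₀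
  have hφ₀c : Continuous φ₀ := hw₁.domRestrict.Icc_extend'
  have hφ₀w : EqOn φ₀ w₁ (Icc (-1) 1) := fun t ht => by
    rw [hφ₀, IccExtend_of_mem _ _ ht]; rfl
  have hφ₁ := contDiff_bootstrap (K := K) (c := c) hq hφ₀c
  -- For q > 2 the nonlinearity is C¹ and a second step is possible; otherwise one step suffices.
  rcases lt_or_ge 2 q with h2 | h2
  · have hφ₂ := contDiff_two_bootstrap (K := K) (c := c) h2 hφ₁
    obtain ⟨h3, h4, h5⟩ := hfin _ hφ₁.continuous (hstep _ hφ₀c hφ₀w)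
    have h6 := contDiff_primitiveFrom (n := 2) (by simpa using hφ₂)
    have h7 := contDiff_primitiveQuotient (n := 2) (by simpa using hφ₂)
    exact ⟨c, _, _, hc, h6.of_le (by norm_cast), h7.of_le (by norm_cast),
      fun _ => ⟨h6.of_le (by norm_cast), h7.of_le (by norm_cast)⟩, h3, h4, h5⟩
  · obtain ⟨h3, h4, h5⟩ := hfin _ hφ₀c hφ₀w
    have h6 := contDiff_primitiveFrom (n := 1) (by simpa using hφ₁)
    have h7 := contDiff_primitiveQuotient (n := 1) (by simpa using hφ₁)
    exact ⟨c, _, _, hc, h6.of_le (by norm_cast), h7.of_le (by norm_cast),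
      fun h => absurd h (not_lt.2 h2), h3, h4, h5⟩

/-! ### Homogeneous functions of the polar angle -/

/-- The homogeneous function `|x|^m φ(cos θ)` of degree `m`. -/
noncomputable def homFn (m : ℝ) (φ : ℝ → ℝ) (x : E3) : ℝ := ‖x‖ ^ m * φ (x 2 / ‖x‖)

lemma isOpen_punctured : IsOpen punctured := isOpen_ne

/-- The coordinate functional `x ↦ x j`. -/
noncomputable abbrev coordL (j : Fin 3) : E3 →L[ℝ] ℝ := EuclideanSpace.proj (𝕜 := ℝ) j

lemma contDiff_coord (j : Fin 3) {n : WithTop ℕ∞} : ContDiff (E := E3) (F := ℝ) ℝ n fun x : E3 => x j :=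
  (coordL j).contDiff

lemma hasFDerivAt_coord (j : Fin 3) (x : E3) :
    HasFDerivAt (𝕜 := ℝ) (E := E3) (F := ℝ) (fun x : E3 => x j) (coordL j) x :=
  (coordL j).hasFDerivAt

lemma pd_eq {f : E3 → ℝ} {L : E3 →L[ℝ] ℝ} {x : E3} (h : HasFDerivAt f L x) (j : Fin 3) :
    pd j f x = L (EuclideanSpace.single j 1) := by
  rw [pd, h.fderiv]

lemma pd_mul {f g : E3 → ℝ} {x : E3} (hf : DifferentiableAt ℝ f x) (hg : DifferentiableAt ℝ g x)
    (j : Fin 3) : pd j (fun y => f y * g y) x = f x * pd j g x + g x * pd j f x := by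
  rw [pd_eq (hf.hasFDerivAt.fun_mul hg.hasFDerivAt)]
  simp [pd]

lemma pd_neg (f : E3 → ℝ) (x : E3) (j : Fin 3) : pd j (fun y => -f y) x = -pd j f x := by
  simp [pd, fderiv_fun_neg]

lemma pd_coord (i j : Fin 3) (x : E3) : pd j (fun y : E3 => y i) x = if i = j then 1 else 0 := by
  rw [pd_eq (hasFDerivAt_coord i x)]
  simp

lemma pd_congr {f g : E3 → ℝ} {x : E3} (h : f =ᶠ[𝓝 x] g) (j : Fin 3) : pd j f x = pd j g x := by
  rw [pd, pd, h.fderiv_eq]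

lemma hasFDerivAt_norm_E3 {x : E3} (hx : x ≠ 0) :
    HasFDerivAt (fun y : E3 => ‖y‖) (‖x‖⁻¹ • innerSL ℝ x) x := by
  have h0 : ‖x‖ ^ 2 ≠ 0 := by positivity
  have h1 := (hasStrictFDerivAt_norm_sq x).hasFDerivAt.sqrt h0
  have h2 : (fun y : E3 => √(‖y‖ ^ 2)) = fun y => ‖y‖ := by
    funext y; exact Real.sqrt_sq (norm_nonneg y)
  rw [h2, Real.sqrt_sq (norm_nonneg x)] at h1
  refine h1.congr_fderiv ?_
  ext y
  simp
  field_simp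

lemma hasFDerivAt_homFn (m : ℝ) {φ : ℝ → ℝ} {φ' : ℝ} {x : E3} (hx : x ≠ 0)
    (hφ : HasDerivAt φ φ' (x 2 / ‖x‖)) :
    HasFDerivAt (homFn m φ)
      ((‖x‖ ^ (m - 2) * (m * φ (x 2 / ‖x‖) - x 2 / ‖x‖ * φ')) • innerSL ℝ x
        + (‖x‖ ^ (m - 1) * φ') • coordL 2) x := by
  have hn : ‖x‖ ≠ 0 := norm_ne_zero_iff.2 hx
  have hn0 : 0 < ‖x‖ := norm_pos_iff.2 hx
  have h1 := hasFDerivAt_norm_E3 hx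
  have h2 := HasFDerivAt.fun_mul (𝔸' := ℝ) (hasFDerivAt_coord 2 x)
    ((hasDerivAt_inv hn).comp_hasFDerivAt x h1)
  have h3 : HasFDerivAt (𝕜 := ℝ) (E := E3) (F := ℝ) (fun y : E3 => y 2 / ‖y‖)
      (x 2 • ((-(‖x‖ ^ 2)⁻¹) • (‖x‖⁻¹ • innerSL ℝ x)) + ‖x‖⁻¹ • coordL 2) x := by
    simp only [div_eq_mul_inv]
    exact h2
  have h4 := (h1.rpow_const (p := m) (Or.inl hn)).fun_mul (hφ.comp_hasFDerivAt x h3)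
  refine h4.congr_fderiv ?_
  have e1 : ‖x‖ ^ m = ‖x‖ ^ (m - 2) * ‖x‖ ^ 2 := by
    rw [← Real.rpow_natCast, ← Real.rpow_add hn0]; congr 1; norm_num
  have e2 : ‖x‖ ^ (m - 1) = ‖x‖ ^ (m - 2) * ‖x‖ := by
    rw [← Real.rpow_add_one hn]; congr 1; ring
  ext y
  simp [e1, e2]
  field_simp
  ring

/-- Partial derivatives of homogeneous functions of the polar angle. -/
lemma pd_homFn (m : ℝ) {φ : ℝ → ℝ} {φ' : ℝ} {x : E3} (hx : x ≠ 0)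
    (hφ : HasDerivAt φ φ' (x 2 / ‖x‖)) (j : Fin 3) :
    pd j (homFn m φ) x = ‖x‖ ^ (m - 1) * (x j / ‖x‖ * (m * φ (x 2 / ‖x‖) - x 2 / ‖x‖ * φ')
      + if j = 2 then φ' else 0) := by
  have hn : ‖x‖ ≠ 0 := norm_ne_zero_iff.2 hx
  have e2 : ‖x‖ ^ (m - 1) = ‖x‖ ^ (m - 2) * ‖x‖ := by
    rw [← Real.rpow_add_one hn]; congr 1; ring
  rw [pd_eq (hasFDerivAt_homFn m hx hφ)]
  have h1 : (coordL 2) (EuclideanSpace.single j (1 : ℝ)) =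
      if j = 2 then 1 else 0 := by
    simp [eq_comm]
  simp only [add_apply, smul_apply, innerSL_apply_apply,
    EuclideanSpace.inner_single_right, smul_eq_mul, h1, e2]
  simp only [conj_trivial, one_mul]
  split_ifs
  · field_simp
  · field_simp
    ring

lemma contDiffOn_homFn (m : ℝ) {φ : ℝ → ℝ} {n : WithTop ℕ∞} (hφ : ContDiff ℝ n φ) :
    ContDiffOn ℝ n (homFn m φ) punctured := by
  have hnorm : ContDiffOn ℝ n (fun x : E3 => ‖x‖) punctured := fun x hx =>
    (contDiffAt_norm ℝ hx).contDiffWithinAt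
  refine (hnorm.rpow_const_of_ne fun x hx => norm_ne_zero_iff.2 hx).mul ?_
  exact hφ.comp_contDiffOn ((contDiff_coord 2).contDiffOn.div hnorm
    fun x hx => norm_ne_zero_iff.2 hx)

lemma homFn_smul (m : ℝ) (φ : ℝ → ℝ) {c : ℝ} (hc : 0 < c) (x : E3) :
    homFn m φ (c • x) = c ^ m * homFn m φ x := by
  unfold homFn
  rw [norm_smul, Real.norm_eq_abs, abs_of_pos hc, PiLp.smul_apply, smul_eq_mul,
    mul_div_mul_left _ _ hc.ne', Real.mul_rpow hc.le (norm_nonneg _), mul_assoc]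

lemma norm_sq_E3 (x : E3) : ‖x‖ ^ 2 = x 0 ^ 2 + x 1 ^ 2 + x 2 ^ 2 := by
  rw [EuclideanSpace.norm_sq_eq, Fin.sum_univ_three]
  simp only [Real.norm_eq_abs, sq_abs]

lemma abs_coord_div_norm_le (x : E3) (j : Fin 3) : |x j / ‖x‖| ≤ 1 := by
  rw [abs_div, abs_norm]
  exact div_le_one_of_le₀ (PiLp.norm_apply_le x j) (norm_nonneg x)

lemma coord_div_norm_mem (x : E3) (j : Fin 3) : x j / ‖x‖ ∈ Icc (-1 : ℝ) 1 :=
  abs_le.1 (abs_coord_div_norm_le x j)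

lemma sum_sq_div_norm {x : E3} (hx : x ≠ 0) :
    (x 0 / ‖x‖) ^ 2 + (x 1 / ‖x‖) ^ 2 + (x 2 / ‖x‖) ^ 2 = 1 := by
  have hn : ‖x‖ ≠ 0 := norm_ne_zero_iff.2 hx
  have := norm_sq_E3 x
  field_simp
  linarith

lemma norm_rotZ (t : ℝ) (x : E3) : ‖rotZ t x‖ = ‖x‖ := by
  rw [← sq_eq_sq₀ (norm_nonneg _) (norm_nonneg _), norm_sq_E3, norm_sq_E3]
  simp [rotZ]
  linear_combination (x 0 ^ 2 + x 1 ^ 2) * Real.sin_sq_add_cos_sq t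

lemma homFn_rotZ (m : ℝ) (φ : ℝ → ℝ) (t : ℝ) (x : E3) : homFn m φ (rotZ t x) = homFn m φ x := by
  unfold homFn
  rw [norm_rotZ]
  simp [rotZ]

lemma homFn_zero {m : ℝ} (hm : m ≠ 0) (φ : ℝ → ℝ) : homFn m φ 0 = 0 := by
  simp [homFn, Real.zero_rpow hm]

/-- Homogeneous functions of degree larger than one are continuously differentiable in the
whole space. -/
lemma contDiff_homFn {m : ℝ} (hm : 1 < m) {φ : ℝ → ℝ} (hφ : ContDiff ℝ 1 φ) :
    ContDiff ℝ 1 (homFn m φ) := by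
  have hφd : ∀ t, HasDerivAt φ (deriv φ t) t := fun t =>
    (hφ.differentiable one_ne_zero t).hasDerivAt
  have hφ' := hφ.continuous_deriv_one
  obtain ⟨C, hC⟩ := (isCompact_Icc (a := (-1 : ℝ)) (b := 1)).exists_bound_of_continuousOn
    hφ.continuous.continuousOn
  obtain ⟨C', hC'⟩ := (isCompact_Icc (a := (-1 : ℝ)) (b := 1)).exists_bound_of_continuousOn
    hφ'.continuousOn
  have hC0 : 0 ≤ C := (norm_nonneg _).trans (hC 0 (by norm_num))
  have hC0' : 0 ≤ C' := (norm_nonneg _).trans (hC' 0 (by norm_num))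
  have hlim : ∀ (r : ℝ), 0 < r → Tendsto (fun x : E3 => ‖x‖ ^ r) (𝓝 0) (𝓝 0) := by
    intro r hr
    have h1 : Continuous fun x : E3 => ‖x‖ ^ r := continuous_norm.rpow_const fun _ => Or.inr hr.le
    have h2 := h1.tendsto 0
    rwa [norm_zero, Real.zero_rpow hr.ne'] at h2
  have hbound : ∀ x : E3, |homFn m φ x| ≤ ‖x‖ ^ m * C := by
    intro x
    unfold homFn
    rw [abs_mul, abs_of_nonneg (by positivity : 0 ≤ ‖x‖ ^ m)]
    gcongr
    exact hC _ (coord_div_norm_mem x 2)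
  have hd0 : HasFDerivAt (homFn m φ) (0 : E3 →L[ℝ] ℝ) 0 := by
    rw [hasFDerivAt_iff_isLittleO_nhds_zero]
    simp only [zero_add, homFn_zero (by linarith : m ≠ 0), sub_zero,
      zero_apply]
    have h1 : (fun x : E3 => homFn m φ x) =O[𝓝 0] fun x => ‖x‖ ^ (m - 1) * ‖x‖ := by
      refine Asymptotics.IsBigO.of_bound C (Eventually.of_forall fun x => ?_)
      rw [Real.norm_eq_abs, Real.norm_eq_abs, abs_of_nonneg (by positivity :
        0 ≤ ‖x‖ ^ (m - 1) * ‖x‖)]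
      refine (hbound x).trans ?_
      rcases eq_or_ne x 0 with rfl | hx
      · simp [Real.zero_rpow (by linarith : m ≠ 0)]
      · rw [← Real.rpow_add_one (norm_ne_zero_iff.2 hx), sub_add_cancel, mul_comm]
    have h2 : (fun x : E3 => ‖x‖ ^ (m - 1) * ‖x‖) =o[𝓝 0] fun x : E3 => x := by
      have h3 := ((Asymptotics.isLittleO_one_iff ℝ).2 (hlim (m - 1) (by linarith))).mul_isBigO
        (Asymptotics.isBigO_refl (fun x : E3 => ‖x‖) (𝓝 0))
      simp only [one_mul] at h3
      exact Asymptotics.isLittleO_norm_right.1 h3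
    exact h1.trans_isLittleO h2
  rw [contDiff_one_iff_fderiv]
  have hd : ∀ x, DifferentiableAt ℝ (homFn m φ) x := by
    intro x
    rcases eq_or_ne x 0 with rfl | hx
    · exact hd0.differentiableAt
    · exact (hasFDerivAt_homFn m hx (hφd _)).differentiableAt
  refine ⟨hd, continuous_iff_continuousAt.2 fun x => ?_⟩
  rcases eq_or_ne x 0 with rfl | hx
  · rw [ContinuousAt, hd0.fderiv, tendsto_zero_iff_norm_tendsto_zero]
    -- The derivative is homogeneous of degree m - 1 > 0 with bounded angular part, so it tends to 0
    -- at the origin.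
    have h1 : ∀ x : E3, ‖fderiv ℝ (homFn m φ) x‖ ≤ (|m| * C + C' + C') * ‖x‖ ^ (m - 1) := by
      intro x
      rcases eq_or_ne x 0 with rfl | hx
      · rw [hd0.fderiv, norm_zero]; positivity
      · rw [(hasFDerivAt_homFn m hx (hφd _)).fderiv]
        have hn : ‖x‖ ≠ 0 := norm_ne_zero_iff.2 hx
        have e2 : ‖x‖ ^ (m - 1) = ‖x‖ ^ (m - 2) * ‖x‖ := by
          rw [← Real.rpow_add_one hn]; congr 1; ring
        set t := x 2 / ‖x‖ with ht
        have htm := coord_div_norm_mem x 2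
        have h2 : |m * φ t - t * deriv φ t| ≤ |m| * C + C' := by
          refine (abs_sub _ _).trans ?_
          rw [abs_mul, abs_mul]
          have h3 := hC t htm
          have h4 := hC' t htm
          have h5 := abs_coord_div_norm_le x 2
          rw [Real.norm_eq_abs] at h3 h4
          have := mul_le_mul h5 h4 (abs_nonneg _) zero_le_one
          gcongr
          simpa using this
        have h6 : ‖coordL 2‖ ≤ 1 := by
          refine ContinuousLinearMap.opNorm_le_bound _ zero_le_one fun y => ?_
          rw [one_mul]; exact PiLp.norm_apply_le y 2
        refine (norm_add_le _ _).trans ?_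
        rw [norm_smul, norm_smul, innerSL_apply_norm, norm_mul, norm_mul, Real.norm_eq_abs,
          Real.norm_eq_abs, Real.norm_eq_abs, Real.norm_eq_abs,
          abs_of_nonneg (by positivity : 0 ≤ ‖x‖ ^ (m - 2)),
          abs_of_nonneg (by positivity : 0 ≤ ‖x‖ ^ (m - 1))]
        have h7 := hC' t htm
        rw [Real.norm_eq_abs] at h7
        calc _ ≤ ‖x‖ ^ (m - 2) * (|m| * C + C') * ‖x‖ + ‖x‖ ^ (m - 1) * C' * 1 := by gcongr
          _ = _ := by rw [e2]; ring
    refine squeeze_zero (fun _ => norm_nonneg _) h1 ?_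
    simpa using (hlim (m - 1) (by linarith)).const_mul (|m| * C + C' + C')
  · exact ((contDiffOn_homFn m hφ).contDiffAt (isOpen_punctured.mem_nhds hx)
      ).continuousAt_fderiv one_ne_zero

/-! ### The flow of a profile -/

/-- `W` and `V` are a profile of the stream function `ψ = |x|^k W(cos θ)` of a `(k-2)`-homogeneous
solution without swirl, whose Bernoulli function is `-(c / q) |ψ|^q`. -/
structure IsProfile (k q c : ℝ) (W V : ℝ → ℝ) : Prop where
  exponent : q * k = 2 * k - 4
  one_lt : 1 < q
  ne_zero : k ≠ 0
  contDiff_W : ContDiff ℝ 2 W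
  contDiff_V : ContDiff ℝ 1 V
  eq_mul : ∀ t ∈ Icc (-1 : ℝ) 1, W t = (1 - t ^ 2) * V t
  ode : ∀ t ∈ Icc (-1 : ℝ) 1, deriv (deriv W) t = -(k * (k - 1) * V t + c * signedPow q (W t))

/-- The angular part of `u^z`. -/
noncomputable def axialPart (k : ℝ) (W : ℝ → ℝ) (t : ℝ) : ℝ := k * W t - t * deriv W t

/-- The angular part of `-u^r / r`. -/
noncomputable def radialPart (k : ℝ) (W V : ℝ → ℝ) (t : ℝ) : ℝ := k * t * V t + deriv W t

/-- The angular part of the Bernoulli function. -/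
noncomputable def headPart (q c : ℝ) (W : ℝ → ℝ) (t : ℝ) : ℝ := -(c / q) * |W t| ^ q

/-- The angular part of the pressure. -/
noncomputable def pressurePart (k q c : ℝ) (W V : ℝ → ℝ) (t : ℝ) : ℝ :=
  headPart q c W t - ((1 - t ^ 2) * radialPart k W V t ^ 2 + axialPart k W t ^ 2) / 2

/-- The velocity `∇ψ × ∇φ`. -/
noncomputable def flowVelocity (k : ℝ) (W V : ℝ → ℝ) (x : E3) : E3 :=
  !₂[-(x 0 * homFn (k - 3) (radialPart k W V) x), -(x 1 * homFn (k - 3) (radialPart k W V) x),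
    homFn (k - 2) (axialPart k W) x]

/-- The pressure of the flow with velocity `flowVelocity`. -/
noncomputable def flowPressure (k q c : ℝ) (W V : ℝ → ℝ) : E3 → ℝ :=
  homFn (2 * k - 4) (pressurePart k q c W V)

lemma abs_rpow_eq_signedPow_mul {q : ℝ} (hq : q ≠ 0) (x : ℝ) : |x| ^ q = signedPow q x * x := by
  unfold signedPow
  rcases eq_or_ne x 0 with rfl | hx
  · simp [Real.zero_rpow hq]
  · have h0 : 0 < |x| := abs_pos.2 hx
    rw [mul_assoc, ← abs_mul_abs_self, ← mul_assoc, ← Real.rpow_add_one h0.ne',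
      ← Real.rpow_add_one h0.ne']
    congr 1; ring

namespace IsProfile

variable {k q c : ℝ} {W V : ℝ → ℝ} (h : IsProfile k q c W V)
include h

lemma contDiff_deriv_W : ContDiff ℝ 1 (deriv W) := by
  have := h.contDiff_W
  rw [show (2 : WithTop ℕ∞) = 1 + 1 by norm_num, contDiff_succ_iff_deriv] at this
  exact this.2.2

lemma hasDerivAt_W (t : ℝ) : HasDerivAt W (deriv W t) t :=
  (h.contDiff_W.differentiable two_ne_zero t).hasDerivAt

lemma hasDerivAt_deriv_W (t : ℝ) : HasDerivAt (deriv W) (deriv (deriv W) t) t :=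
  (h.contDiff_deriv_W.differentiable one_ne_zero t).hasDerivAt

lemma hasDerivAt_V (t : ℝ) : HasDerivAt V (deriv V t) t :=
  (h.contDiff_V.differentiable one_ne_zero t).hasDerivAt

/-- W and (1 - t²)V need agree only on the closed interval. At its end points the derivative is
still determined, by one-sided uniqueness. -/
lemma deriv_W_eq {t : ℝ} (ht : t ∈ Icc (-1 : ℝ) 1) :
    deriv W t = (1 - t ^ 2) * deriv V t - 2 * t * V t := by
  have h1 : HasDerivAt (fun t => (1 - t ^ 2) * V t) ((1 - t ^ 2) * deriv V t - 2 * t * V t) t := by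
    refine ((((hasDerivAt_id t).fun_pow 2).const_sub 1).fun_mul (h.hasDerivAt_V t)).congr_deriv ?_
    simp; ring
  have h2 : HasDerivWithinAt W ((1 - t ^ 2) * deriv V t - 2 * t * V t) (Icc (-1) 1) t :=
    h1.hasDerivWithinAt.congr h.eq_mul (h.eq_mul t ht)
  exact (uniqueDiffOn_Icc (by norm_num) t ht).eq_deriv _ (h.hasDerivAt_W t).hasDerivWithinAt h2

lemma hasDerivAt_axialPart (t : ℝ) :
    HasDerivAt (axialPart k W) ((k - 1) * deriv W t - t * deriv (deriv W) t) t := by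
  refine (((h.hasDerivAt_W t).const_mul k).fun_sub
    ((hasDerivAt_id t).fun_mul (h.hasDerivAt_deriv_W t))).congr_deriv ?_
  simp; ring

lemma hasDerivAt_radialPart (t : ℝ) :
    HasDerivAt (radialPart k W V) (k * V t + k * t * deriv V t + deriv (deriv W) t) t := by
  refine ((((hasDerivAt_id t).const_mul k).fun_mul (h.hasDerivAt_V t)).fun_add
    (h.hasDerivAt_deriv_W t)).congr_deriv ?_
  simp

lemma hasDerivAt_headPart (t : ℝ) :
    HasDerivAt (headPart q c W) (-c * (signedPow q (W t) * deriv W t)) t := by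
  have hq := h.one_lt
  refine (((hasDerivAt_abs_rpow (W t) hq).comp t (h.hasDerivAt_W t)).const_mul
    (-(c / q))).congr_deriv ?_
  unfold signedPow
  field_simp

lemma hasDerivAt_pressurePart (t : ℝ) :
    HasDerivAt (pressurePart k q c W V) (-c * (signedPow q (W t) * deriv W t)
      + t * radialPart k W V t ^ 2
      - (1 - t ^ 2) * radialPart k W V t * (k * V t + k * t * deriv V t + deriv (deriv W) t)
      - axialPart k W t * ((k - 1) * deriv W t - t * deriv (deriv W) t)) t := by
  refine ((h.hasDerivAt_headPart t).fun_sub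
    (((((hasDerivAt_id t).fun_pow 2).const_sub 1).fun_mul ((h.hasDerivAt_radialPart t).fun_pow 2)
      |>.fun_add ((h.hasDerivAt_axialPart t).fun_pow 2)).div_const 2)).congr_deriv ?_
  simp; ring

lemma contDiff_axialPart : ContDiff ℝ 1 (axialPart k W) :=
  (contDiff_const.mul (h.contDiff_W.of_le (by norm_cast))).sub (contDiff_id.mul h.contDiff_deriv_W)

lemma contDiff_radialPart : ContDiff ℝ 1 (radialPart k W V) :=
  ((contDiff_const.mul contDiff_id).mul h.contDiff_V).add h.contDiff_deriv_W

lemma contDiff_headPart : ContDiff ℝ 1 (headPart q c W) := by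
  rw [contDiff_one_iff_deriv]
  refine ⟨fun t => (h.hasDerivAt_headPart t).differentiableAt, ?_⟩
  rw [funext fun t => (h.hasDerivAt_headPart t).deriv]
  exact continuous_const.mul (((continuous_signedPow' h.one_lt).comp h.contDiff_W.continuous).mul
    h.contDiff_deriv_W.continuous)

lemma contDiff_pressurePart : ContDiff ℝ 1 (pressurePart k q c W V) :=
  h.contDiff_headPart.sub ((((contDiff_const.sub (contDiff_id.pow 2)).mul
    (h.contDiff_radialPart.pow 2)).add (h.contDiff_axialPart.pow 2)).div_const 2)

/-- The angular form of ∇ · (∇ψ × ∇φ) = 0; the differential equation of the profile plays no part.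
-/
lemma divergence_identity {t : ℝ} (ht : t ∈ Icc (-1 : ℝ) 1) :
    -2 * radialPart k W V t - (1 - t ^ 2) * ((k - 3) * radialPart k W V t
        - t * (k * V t + k * t * deriv V t + deriv (deriv W) t))
      + t * ((k - 2) * axialPart k W t - t * ((k - 1) * deriv W t - t * deriv (deriv W) t))
      + ((k - 1) * deriv W t - t * deriv (deriv W) t) = 0 := by
  have h1 := h.deriv_W_eq ht
  have h2 := h.eq_mul t ht
  simp only [radialPart, axialPart, h2, h1]
  ring

/-- The left side is the angular part of minus the azimuthal vorticity divided by r. The profile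
equation says exactly that it equals Π'(ψ). -/
lemma vorticity_identity {t : ℝ} (ht : t ∈ Icc (-1 : ℝ) 1) :
    t * ((k - 3) * radialPart k W V t - t * (k * V t + k * t * deriv V t + deriv (deriv W) t))
      + (k * V t + k * t * deriv V t + deriv (deriv W) t)
      + ((k - 2) * axialPart k W t - t * ((k - 1) * deriv W t - t * deriv (deriv W) t))
      = -c * signedPow q (W t) := by
  have h1 := h.deriv_W_eq ht
  have h2 := h.eq_mul t ht
  have h3 := h.ode t ht
  simp only [radialPart, axialPart, h3, h1]
  generalize signedPow q (W t) = N
  rw [h2]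
  ring

/-- The exponent relation converts the degree times |W|^q/q into k|W|^(q-2)W · W. The nonlinearity
then enters the momentum identities only through the value of `signedPow q (W t)`, which can be
treated as a free variable. -/
lemma pressurePart_mul {t : ℝ} :
    (2 * k - 4) * pressurePart k q c W V t = -c * k * (signedPow q (W t) * W t)
      - (k - 2) * ((1 - t ^ 2) * radialPart k W V t ^ 2 + axialPart k W t ^ 2) := by
  have hq := h.one_lt
  have hq0 : q ≠ 0 := by linarith
  have h1 := h.exponent
  unfold pressurePart headPart
  rw [abs_rpow_eq_signedPow_mul hq0, ← h1]
  have h2 : q * k * (-(c / q) * (signedPow q (W t) * W t)) =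
      -c * k * (signedPow q (W t) * W t) := by field_simp
  rw [mul_sub, h2, h1]
  ring

/-- This is the component of u · ∇u + ∇p along e_r, stripped of powers of |x|. Eliminating W, W' and
W'' in favour of V, V' and the nonlinearity leaves a polynomial identity; the axial component works
in the same way. -/
lemma radial_momentum_identity {t : ℝ} (ht : t ∈ Icc (-1 : ℝ) 1) :
    radialPart k W V t ^ 2 + (1 - t ^ 2) * radialPart k W V t * ((k - 3) * radialPart k W V t
        - t * (k * V t + k * t * deriv V t + deriv (deriv W) t))
      - axialPart k W t * (t * ((k - 3) * radialPart k W V t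
        - t * (k * V t + k * t * deriv V t + deriv (deriv W) t))
        + (k * V t + k * t * deriv V t + deriv (deriv W) t))
      + ((2 * k - 4) * pressurePart k q c W V t - t * (-c * (signedPow q (W t) * deriv W t)
      + t * radialPart k W V t ^ 2
      - (1 - t ^ 2) * radialPart k W V t * (k * V t + k * t * deriv V t + deriv (deriv W) t)
      - axialPart k W t * ((k - 1) * deriv W t - t * deriv (deriv W) t))) = 0 := by
  rw [h.pressurePart_mul]
  have h1 := h.deriv_W_eq ht
  have h2 := h.eq_mul t ht
  have h3 := h.ode t ht
  simp only [radialPart, axialPart, h3, h1]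
  generalize signedPow q (W t) = N
  rw [h2]
  ring

lemma axial_momentum_identity {t : ℝ} (ht : t ∈ Icc (-1 : ℝ) 1) :
    -((1 - t ^ 2) * radialPart k W V t * ((k - 2) * axialPart k W t
        - t * ((k - 1) * deriv W t - t * deriv (deriv W) t)))
      + axialPart k W t * (t * ((k - 2) * axialPart k W t
        - t * ((k - 1) * deriv W t - t * deriv (deriv W) t))
        + ((k - 1) * deriv W t - t * deriv (deriv W) t))
      + t * ((2 * k - 4) * pressurePart k q c W V t - t * (-c * (signedPow q (W t) * deriv W t)
      + t * radialPart k W V t ^ 2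
      - (1 - t ^ 2) * radialPart k W V t * (k * V t + k * t * deriv V t + deriv (deriv W) t)
      - axialPart k W t * ((k - 1) * deriv W t - t * deriv (deriv W) t)))
      + (-c * (signedPow q (W t) * deriv W t)
      + t * radialPart k W V t ^ 2
      - (1 - t ^ 2) * radialPart k W V t * (k * V t + k * t * deriv V t + deriv (deriv W) t)
      - axialPart k W t * ((k - 1) * deriv W t - t * deriv (deriv W) t)) = 0 := by
  rw [h.pressurePart_mul]
  have h1 := h.deriv_W_eq ht
  have h2 := h.eq_mul t ht
  have h3 := h.ode t ht
  simp only [radialPart, axialPart, h3, h1]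
  generalize signedPow q (W t) = N
  rw [h2]
  ring

/-! ### Partial derivatives of the flow -/

lemma pd_homFn_radial {x : E3} (hx : x ≠ 0) (i j : Fin 3) :
    pd j (fun y => -(y i * homFn (k - 3) (radialPart k W V) y)) x =
      -(‖x‖ ^ (k - 3) * ((if i = j then radialPart k W V (x 2 / ‖x‖) else 0)
        + x i / ‖x‖ * (x j / ‖x‖ * ((k - 3) * radialPart k W V (x 2 / ‖x‖) - x 2 / ‖x‖ *
          (k * V (x 2 / ‖x‖) + k * (x 2 / ‖x‖) * deriv V (x 2 / ‖x‖)
            + deriv (deriv W) (x 2 / ‖x‖)))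
        + if j = 2 then k * V (x 2 / ‖x‖) + k * (x 2 / ‖x‖) * deriv V (x 2 / ‖x‖)
            + deriv (deriv W) (x 2 / ‖x‖) else 0))) := by
  have hn : ‖x‖ ≠ 0 := norm_ne_zero_iff.2 hx
  have hG := h.hasDerivAt_radialPart (x 2 / ‖x‖)
  rw [pd_neg, pd_mul (hasFDerivAt_coord i x).differentiableAt
    (hasFDerivAt_homFn (k - 3) hx hG).differentiableAt, pd_coord, pd_homFn (k - 3) hx hG]
  have e : ‖x‖ ^ (k - 3) = ‖x‖ ^ (k - 3 - 1) * ‖x‖ := by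
    rw [← Real.rpow_add_one hn]; congr 1; ring
  unfold homFn
  rw [e]
  split_ifs <;> field_simp <;> ring

lemma pd_homFn_axial {x : E3} (hx : x ≠ 0) (j : Fin 3) :
    pd j (homFn (k - 2) (axialPart k W)) x = ‖x‖ ^ (k - 3) * (x j / ‖x‖ *
      ((k - 2) * axialPart k W (x 2 / ‖x‖) - x 2 / ‖x‖ *
        ((k - 1) * deriv W (x 2 / ‖x‖) - x 2 / ‖x‖ * deriv (deriv W) (x 2 / ‖x‖)))
      + if j = 2 then (k - 1) * deriv W (x 2 / ‖x‖) - x 2 / ‖x‖ * deriv (deriv W) (x 2 / ‖x‖)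
        else 0) := by
  rw [pd_homFn (k - 2) hx (h.hasDerivAt_axialPart _), show k - 2 - 1 = k - 3 by ring]

theorem eulerClassical : EulerClassical punctured (flowVelocity k W V) (flowPressure k q c W V) := by
  intro x hx
  have hx : x ≠ 0 := hx
  have hn : ‖x‖ ≠ 0 := norm_ne_zero_iff.2 hx
  have hn0 : 0 < ‖x‖ := norm_pos_iff.2 hx
  have ht := coord_div_norm_mem x 2
  have hS := sum_sq_div_norm hx
  have e1 : ‖x‖ ^ (k - 2) = ‖x‖ ^ (k - 3) * ‖x‖ := by
    rw [← Real.rpow_add_one hn]; congr 1; ring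
  have e2 : ‖x‖ ^ (2 * k - 4 - 1) = ‖x‖ ^ (k - 3) * ‖x‖ ^ (k - 3) * ‖x‖ := by
    rw [← Real.rpow_add hn0, ← Real.rpow_add_one hn]; congr 1; ring
  have u0 : ∀ y, flowVelocity k W V y 0 = -(y 0 * homFn (k - 3) (radialPart k W V) y) :=
    fun y => rfl
  have u1 : ∀ y, flowVelocity k W V y 1 = -(y 1 * homFn (k - 3) (radialPart k W V) y) :=
    fun y => rfl
  have u2 : ∀ y, flowVelocity k W V y 2 = homFn (k - 2) (axialPart k W) y := fun y => rfl
  obtain ⟨d00, d01, d02⟩ := And.intro (h.pd_homFn_radial hx 0 0)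
    (And.intro (h.pd_homFn_radial hx 0 1) (h.pd_homFn_radial hx 0 2))
  obtain ⟨d10, d11, d12⟩ := And.intro (h.pd_homFn_radial hx 1 0)
    (And.intro (h.pd_homFn_radial hx 1 1) (h.pd_homFn_radial hx 1 2))
  obtain ⟨d20, d21, d22⟩ := And.intro (h.pd_homFn_axial hx 0)
    (And.intro (h.pd_homFn_axial hx 1) (h.pd_homFn_axial hx 2))
  have dp := pd_homFn (2 * k - 4) hx (h.hasDerivAt_pressurePart (x 2 / ‖x‖))
  rw [show homFn (2 * k - 4) (pressurePart k q c W V) = flowPressure k q c W V from rfl] at dp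
  have I0 := h.divergence_identity ht
  have I1 := h.radial_momentum_identity ht
  have I2 := h.axial_momentum_identity ht
  have c0 : x 0 = x 0 / ‖x‖ * ‖x‖ := by field_simp
  have c1 : x 1 = x 1 / ‖x‖ * ‖x‖ := by field_simp
  have v0 : flowVelocity k W V x 0 =
      -(‖x‖ ^ (k - 3) * ‖x‖ * (x 0 / ‖x‖ * radialPart k W V (x 2 / ‖x‖))) := by
    rw [u0, homFn]; field_simp
  have v1 : flowVelocity k W V x 1 =
      -(‖x‖ ^ (k - 3) * ‖x‖ * (x 1 / ‖x‖ * radialPart k W V (x 2 / ‖x‖))) := by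
    rw [u1, homFn]; field_simp
  have v2 : flowVelocity k W V x 2 = ‖x‖ ^ (k - 3) * ‖x‖ * axialPart k W (x 2 / ‖x‖) := by
    rw [u2, homFn, e1]
  have w0 : (fun y => flowVelocity k W V y 0) =
    fun y => -(y 0 * homFn (k - 3) (radialPart k W V) y) := rfl
  have w1 : (fun y => flowVelocity k W V y 1) =
    fun y => -(y 1 * homFn (k - 3) (radialPart k W V) y) := rfl
  have w2 : (fun y => flowVelocity k W V y 2) = homFn (k - 2) (axialPart k W) := rfl
  rw [e2] at dp
  obtain ⟨f0, f1, f2⟩ := And.intro (dp 0) (And.intro (dp 1) (dp 2))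
  clear dp
  -- With the angular parts, their derivatives and the direction cosines as independent symbols, the
  -- Euler equations become linear combinations of the identities in t and of the relation that the
  -- squared cosines sum to 1.
  generalize k * V (x 2 / ‖x‖) + k * (x 2 / ‖x‖) * deriv V (x 2 / ‖x‖)
            + deriv (deriv W) (x 2 / ‖x‖) = G' at *
  generalize (k - 1) * deriv W (x 2 / ‖x‖) - x 2 / ‖x‖ * deriv (deriv W) (x 2 / ‖x‖) = F' at *
  generalize -c * (signedPow q (W (x 2 / ‖x‖)) * deriv W (x 2 / ‖x‖))
      + x 2 / ‖x‖ * radialPart k W V (x 2 / ‖x‖) ^ 2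
      - (1 - (x 2 / ‖x‖) ^ 2) * radialPart k W V (x 2 / ‖x‖) * G'
      - axialPart k W (x 2 / ‖x‖) * F' = P' at *
  generalize radialPart k W V (x 2 / ‖x‖) = G at *
  generalize axialPart k W (x 2 / ‖x‖) = F at *
  generalize pressurePart k q c W V (x 2 / ‖x‖) = P at *
  generalize ‖x‖ ^ (k - 3) = A at *
  clear c0 c1
  generalize x 0 / ‖x‖ = X0 at *
  generalize x 1 / ‖x‖ = X1 at *
  generalize x 2 / ‖x‖ = t at *
  constructor
  · intro i
    rw [Fin.sum_univ_three, v0, v1, v2]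
    fin_cases i
    · simp only [Fin.zero_eta, w0, d00, d01, d02, f0]
      simp
      linear_combination (A ^ 2 * ‖x‖ * X0) * I1
        + A ^ 2 * ‖x‖ * X0 * G * ((k - 3) * G - t * G') * hS
    · simp only [Fin.mk_one, w1, d10, d11, d12, f1]
      simp
      linear_combination (A ^ 2 * ‖x‖ * X1) * I1
        + A ^ 2 * ‖x‖ * X1 * G * ((k - 3) * G - t * G') * hS
    · simp only [Fin.reduceFinMk, w2, d20, d21, d22, f2]
      simp
      linear_combination (A ^ 2 * ‖x‖) * I2
        - A ^ 2 * ‖x‖ * G * ((k - 2) * F - t * F') * hS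
  · rw [divergence, Fin.sum_univ_three, w0, w1, w2, d00, d11, d22]
    simp
    linear_combination A * I0 - A * ((k - 3) * G - t * G') * hS

end IsProfile

/-! ### Symmetries and regularity of the flow -/

lemma inner_E3 (a b : E3) : inner ℝ a b = a 0 * b 0 + a 1 * b 1 + a 2 * b 2 := by
  rw [PiLp.inner_apply, Fin.sum_univ_three]
  simp [mul_comm]

lemma ext_E3 {a b : E3} (h0 : a 0 = b 0) (h1 : a 1 = b 1) (h2 : a 2 = b 2) : a = b := by
  ext i
  fin_cases i
  · exact h0
  · exact h1
  · exact h2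

lemma contDiffOn_E3 {n : WithTop ℕ∞} {s : Set E3} {u : E3 → E3}
    (h0 : ContDiffOn ℝ n (fun x => u x 0) s) (h1 : ContDiffOn ℝ n (fun x => u x 1) s)
    (h2 : ContDiffOn ℝ n (fun x => u x 2) s) : ContDiffOn ℝ n u s := by
  rw [contDiffOn_euclidean]
  intro i
  fin_cases i
  · exact h0
  · exact h1
  · exact h2

section Symmetries

variable (k q c : ℝ) (W V : ℝ → ℝ)

lemma flowVelocity_zero (x : E3) :
    flowVelocity k W V x 0 = -(x 0 * homFn (k - 3) (radialPart k W V) x) := rfl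

lemma flowVelocity_one (x : E3) :
    flowVelocity k W V x 1 = -(x 1 * homFn (k - 3) (radialPart k W V) x) := rfl

lemma flowVelocity_two (x : E3) :
    flowVelocity k W V x 2 = homFn (k - 2) (axialPart k W) x := rfl

lemma poloidal_flowVelocity : poloidal (flowVelocity k W V) = flowVelocity k W V := by
  funext x
  have hr : cylRadius x ^ 2 = x 0 ^ 2 + x 1 ^ 2 := Real.sq_sqrt (by positivity)
  have key : ∀ y : ℝ, (y = x 0 ∨ y = x 1) →
      (-(x 0 * homFn (k - 3) (radialPart k W V) x) * (x 0 / cylRadius x)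
        + -(x 1 * homFn (k - 3) (radialPart k W V) x) * (x 1 / cylRadius x)) * (y / cylRadius x)
      = -(y * homFn (k - 3) (radialPart k W V) x) := by
    intro y hy
    -- On the axis `eR` is 0 by convention, which is consistent because the horizontal velocity
    -- carries the factors x 0 and x 1.
    by_cases h0 : cylRadius x = 0
    · rw [h0] at hr
      have h1 : x 0 = 0 := by nlinarith [sq_nonneg (x 0), sq_nonneg (x 1)]
      have h2 : x 1 = 0 := by nlinarith [sq_nonneg (x 0), sq_nonneg (x 1)]
      rcases hy with rfl | rfl
      · simp [h1]
      · simp [h2]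
    · field_simp
      linear_combination homFn (k - 3) (radialPart k W V) x * y * hr
  have hin : inner ℝ (flowVelocity k W V x) (eR x) =
      -(x 0 * homFn (k - 3) (radialPart k W V) x) * (x 0 / cylRadius x)
        + -(x 1 * homFn (k - 3) (radialPart k W V) x) * (x 1 / cylRadius x) := by
    rw [inner_E3]; simp [eR, flowVelocity]
  have hin' : inner ℝ (flowVelocity k W V x) eZ = flowVelocity k W V x 2 := by
    rw [inner_E3]; simp [eZ]
  unfold poloidal
  rw [hin, hin']
  refine ext_E3 ?_ ?_ ?_
  · exact Eq.trans (by simp [eR, eZ]) (key (x 0) (Or.inl rfl))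
  · exact Eq.trans (by simp [eR, eZ]) (key (x 1) (Or.inr rfl))
  · simp [eR, eZ]

lemma toroidal_flowVelocity : toroidal (flowVelocity k W V) = fun _ => 0 := by
  funext x
  have : inner ℝ (flowVelocity k W V x) (ePhi x) = 0 := by
    rw [inner_E3]; simp [ePhi, flowVelocity]; ring
  rw [toroidal, this, zero_smul]

lemma homogeneous_flow (α : ℝ) (hα : k = 2 - α) (Ω : Set E3) :
    Homogeneous α Ω (flowVelocity k W V) (flowPressure k q c W V) := by
  intro r hr x _
  have e1 : r ^ α * r ^ (k - 3) * r = 1 := by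
    rw [← Real.rpow_add hr, ← Real.rpow_add_one hr.ne', hα]
    have : α + (2 - α - 3) + 1 = 0 := by ring
    rw [this, Real.rpow_zero]
  have e2 : r ^ α * r ^ (k - 2) = 1 := by
    rw [← Real.rpow_add hr, hα]
    have : α + (2 - α - 2) = 0 := by ring
    rw [this, Real.rpow_zero]
  have e3 : r ^ (2 * α) * r ^ (2 * k - 4) = 1 := by
    rw [← Real.rpow_add hr, hα]
    have : 2 * α + (2 * (2 - α) - 4) = 0 := by ring
    rw [this, Real.rpow_zero]
  constructor
  · refine ext_E3 ?_ ?_ ?_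
    · rw [PiLp.smul_apply, flowVelocity_zero, flowVelocity_zero, homFn_smul _ _ hr,
        PiLp.smul_apply, smul_eq_mul, smul_eq_mul]
      linear_combination x 0 * homFn (k - 3) (radialPart k W V) x * e1
    · rw [PiLp.smul_apply, flowVelocity_one, flowVelocity_one, homFn_smul _ _ hr,
        PiLp.smul_apply, smul_eq_mul, smul_eq_mul]
      linear_combination x 1 * homFn (k - 3) (radialPart k W V) x * e1
    · rw [PiLp.smul_apply, flowVelocity_two, flowVelocity_two, homFn_smul _ _ hr, smul_eq_mul,
        ← mul_assoc, e2, one_mul]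
  · rw [flowPressure, homFn_smul _ _ hr, ← mul_assoc, e3, one_mul]

lemma axisymmetric_flow (Ω : Set E3) : Axisymmetric Ω (flowVelocity k W V) := by
  intro t x _
  refine ext_E3 ?_ ?_ ?_
  · rw [flowVelocity_zero, homFn_rotZ]
    simp [rotZ, flowVelocity]; ring
  · rw [flowVelocity_one, homFn_rotZ]
    simp [rotZ, flowVelocity]; ring
  · rw [flowVelocity_two, homFn_rotZ]
    simp [rotZ, flowVelocity]

end Symmetries

/-- The point of the unit sphere with `cos θ = t` in the half plane `x 1 = 0`, `x 0 ≥ 0`. -/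
noncomputable def meridian (t : ℝ) : E3 := !₂[√(1 - t ^ 2), 0, t]

lemma norm_meridian {t : ℝ} (ht : t ∈ Icc (-1 : ℝ) 1) : ‖meridian t‖ = 1 := by
  have h0 : 0 ≤ 1 - t ^ 2 := by nlinarith [ht.1, ht.2]
  rw [← sq_eq_sq₀ (norm_nonneg _) zero_le_one, norm_sq_E3]
  simp [meridian, Real.sq_sqrt h0]

lemma meridian_ne_zero {t : ℝ} (ht : t ∈ Icc (-1 : ℝ) 1) : meridian t ≠ 0 := by
  rw [← norm_ne_zero_iff, norm_meridian ht]; exact one_ne_zero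

lemma homFn_meridian (m : ℝ) (φ : ℝ → ℝ) {t : ℝ} (ht : t ∈ Icc (-1 : ℝ) 1) :
    homFn m φ (meridian t) = φ t := by
  rw [homFn, norm_meridian ht]; simp [meridian]

namespace IsProfile

variable {k q c : ℝ} {W V : ℝ → ℝ} (h : IsProfile k q c W V)
include h

lemma contDiffOn_flowVelocity : ContDiffOn ℝ 1 (flowVelocity k W V) punctured :=
  contDiffOn_E3
    ((contDiff_coord 0).contDiffOn.mul (contDiffOn_homFn _ h.contDiff_radialPart)).neg
    ((contDiff_coord 1).contDiffOn.mul (contDiffOn_homFn _ h.contDiff_radialPart)).neg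
    (contDiffOn_homFn _ h.contDiff_axialPart)

lemma contDiffOn_flowPressure : ContDiffOn ℝ 1 (flowPressure k q c W V) punctured :=
  contDiffOn_homFn _ h.contDiff_pressurePart

/-- The critical term is the Bernoulli part |W|^q of the pressure: its derivative contains
|W|^(q-2)W, which is C¹ when q > 2. -/
lemma contDiffOn_two_flow (hq : 2 < q) (hW : ContDiff ℝ 3 W) (hV : ContDiff ℝ 2 V) :
    ContDiffOn ℝ 2 (flowVelocity k W V) punctured ∧
      ContDiffOn ℝ 2 (flowPressure k q c W V) punctured := by
  have hW2 : ContDiff ℝ 2 W := hW.of_le (by norm_cast)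
  have hW' : ContDiff ℝ 2 (deriv W) := by
    rw [show (3 : WithTop ℕ∞) = 2 + 1 by norm_num, contDiff_succ_iff_deriv] at hW
    exact hW.2.2
  have hF : ContDiff ℝ 2 (axialPart k W) := (contDiff_const.mul hW2).sub (contDiff_id.mul hW')
  have hG : ContDiff ℝ 2 (radialPart k W V) := ((contDiff_const.mul contDiff_id).mul hV).add hW'
  have hH : ContDiff ℝ 2 (headPart q c W) := by
    rw [show (2 : WithTop ℕ∞) = 1 + 1 by norm_num, contDiff_succ_iff_deriv]
    refine ⟨fun t => (h.hasDerivAt_headPart t).differentiableAt, by simp, ?_⟩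
    rw [funext fun t => (h.hasDerivAt_headPart t).deriv]
    exact contDiff_const.mul (((contDiff_signedPow hq).comp (hW.of_le (by norm_cast))).mul
      h.contDiff_deriv_W)
  have hP : ContDiff ℝ 2 (pressurePart k q c W V) :=
    hH.sub ((((contDiff_const.sub (contDiff_id.pow 2)).mul (hG.pow 2)).add (hF.pow 2)).div_const 2)
  refine ⟨contDiffOn_E3 ?_ ?_ ?_, contDiffOn_homFn _ hP⟩
  · exact ((contDiff_coord 0).contDiffOn.mul (contDiffOn_homFn _ hG)).neg
  · exact ((contDiff_coord 1).contDiffOn.mul (contDiffOn_homFn _ hG)).neg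
  · exact contDiffOn_homFn _ hF

/-- The second component of the curl is x 0/r times the azimuthal vorticity. It alone shows that the
flow is rotational when c ≠ 0 and W is nontrivial. -/
lemma curl_flowVelocity_one {x : E3} (hx : x ≠ 0) : curl (flowVelocity k W V) x 1 =
    ‖x‖ ^ (k - 3) * (x 0 / ‖x‖) * (c * signedPow q (W (x 2 / ‖x‖))) := by
  have h1 : curl (flowVelocity k W V) x 1 =
      pd 2 (fun y => -(y 0 * homFn (k - 3) (radialPart k W V) y)) x
        - pd 0 (homFn (k - 2) (axialPart k W)) x := rfl
  have h2 := h.vorticity_identity (coord_div_norm_mem x 2)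
  rw [h1, h.pd_homFn_radial hx 0 2, h.pd_homFn_axial hx 0]
  simp
  linear_combination -(‖x‖ ^ (k - 3) * (x 0 / ‖x‖)) * h2

lemma bernoulliHead_flow {x : E3} (hx : x ≠ 0) :
    bernoulliHead (flowVelocity k W V) (flowPressure k q c W V) x =
      homFn (2 * k - 4) (headPart q c W) x := by
  have hn : ‖x‖ ≠ 0 := norm_ne_zero_iff.2 hx
  have hn0 : 0 < ‖x‖ := norm_pos_iff.2 hx
  have hS := sum_sq_div_norm hx
  have e1 : ‖x‖ ^ (k - 2) = ‖x‖ ^ (k - 3) * ‖x‖ := by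
    rw [← Real.rpow_add_one hn]; congr 1; ring
  have e2 : ‖x‖ ^ (2 * k - 4) = (‖x‖ ^ (k - 3) * ‖x‖) ^ 2 := by
    rw [← e1, sq, ← Real.rpow_add hn0]; congr 1; ring
  have c0 : x 0 = x 0 / ‖x‖ * ‖x‖ := by field_simp
  have c1 : x 1 = x 1 / ‖x‖ * ‖x‖ := by field_simp
  rw [bernoulliHead, norm_sq_E3, flowVelocity_zero, flowVelocity_one, flowVelocity_two,
    flowPressure]
  unfold homFn
  rw [e1, e2]
  unfold pressurePart
  have v0 : x 0 ^ 2 = (x 0 / ‖x‖) ^ 2 * ‖x‖ ^ 2 := by field_simp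
  have v1 : x 1 ^ 2 = (x 1 / ‖x‖) ^ 2 * ‖x‖ ^ 2 := by field_simp
  rw [neg_sq, neg_sq, mul_pow (x 0), mul_pow (x 1), v0, v1]
  linear_combination (‖x‖ ^ (k - 3) * ‖x‖ * radialPart k W V (x 2 / ‖x‖)) ^ 2 / 2 * hS

lemma curl_meridian_ne_zero (hc : c ≠ 0) {t : ℝ} (ht : t ∈ Ioo (-1 : ℝ) 1) (hW : W t ≠ 0) :
    curl (flowVelocity k W V) (meridian t) 1 ≠ 0 := by
  have ht' := Ioo_subset_Icc_self ht
  rw [h.curl_flowVelocity_one (meridian_ne_zero ht'), norm_meridian ht']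
  have h1 : √(1 - t ^ 2) ≠ 0 := (Real.sqrt_pos.2 (one_sub_sq_pos ht)).ne'
  have h2 : signedPow q (W t) ≠ 0 :=
    mul_ne_zero (Real.rpow_pos_of_pos (abs_pos.2 hW) _).ne' hW
  simp [meridian, h1, h2, hc]

/-- The Bernoulli function vanishes on the axis, where W = 0, but not at an angle with W ≠ 0. -/
lemma nonconstantBernoulli (hc : c ≠ 0) {t : ℝ} (ht : t ∈ Ioo (-1 : ℝ) 1) (hW : W t ≠ 0) :
    NonconstantBernoulli punctured (flowVelocity k W V) (flowPressure k q c W V) := by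
  have ht' := Ioo_subset_Icc_self ht
  have h1 : (1 : ℝ) ∈ Icc (-1 : ℝ) 1 := by norm_num
  have hq := h.one_lt
  have hW1 : W 1 = 0 := by rw [h.eq_mul 1 h1]; ring
  refine ⟨_, meridian_ne_zero ht', _, meridian_ne_zero h1, ?_⟩
  rw [h.bernoulliHead_flow (meridian_ne_zero ht'), h.bernoulliHead_flow (meridian_ne_zero h1),
    homFn_meridian _ _ ht', homFn_meridian _ _ h1]
  unfold headPart
  rw [hW1, abs_zero, Real.zero_rpow (by linarith), mul_zero]
  have := Real.rpow_pos_of_pos (abs_pos.2 hW) q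
  exact mul_ne_zero (neg_ne_zero.2 (div_ne_zero hc (by linarith))) this.ne'

end IsProfile

/-- Profiles exist for all `k < 0` and all `k > 4`. -/
theorem exists_isProfile {k : ℝ} (hk : k < 0 ∨ 4 < k) :
    ∃ (q c : ℝ) (W V : ℝ → ℝ), IsProfile k q c W V ∧ c ≠ 0 ∧ (∃ t ∈ Ioo (-1 : ℝ) 1, W t ≠ 0) ∧
      (k < 0 → 2 < q ∧ ContDiff ℝ 3 W ∧ ContDiff ℝ 2 V) := by
  have hk0 : k ≠ 0 := by rintro rfl; rcases hk with h | h <;> linarith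
  have hK : 0 < k * (k - 1) := by rcases hk with h | h <;> nlinarith
  have hqk : (2 * k - 4) / k * k = 2 * k - 4 := by field_simp
  have hq2 : k < 0 → 2 < (2 * k - 4) / k := by
    intro h
    rw [lt_div_iff_of_neg h]; linarith
  -- The exponent is 2 - 4/k: above 2 for k < 0, and above 1 for positive k only if k > 4. This is
  -- the origin of the ranges α > 2 and α < -2.
  have hq : 1 < (2 * k - 4) / k := by
    rcases hk with h | h
    · linarith [hq2 h]
    · rw [lt_div_iff₀ (by linarith)]; linarith
  obtain ⟨c, W, V, hc, hW, hV, hreg, hWV, hode, hne⟩ := exists_profile hK hq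
  exact ⟨_, c, W, V, ⟨hqk, hq, hk0, hW, hV, hWV, hode⟩, hc, hne, fun h => ⟨hq2 h, hreg (hq2 h)⟩⟩

/-! ### Existence for α > 2 -/

theorem exists_puncturedSolution {α : ℝ} (hα : 2 < α) :
    ∃ (u : E3 → E3) (p : E3 → ℝ), PuncturedSolution 1 α u p ∧
      NonconstantBernoulli punctured u p ∧ ContDiffOn ℝ 2 (poloidal u) punctured ∧
      ContDiffOn ℝ 2 p punctured ∧ ContDiffOn ℝ 1 (toroidal u) punctured := by
  have hk : 2 - α < 0 := by linarith
  obtain ⟨q, c, W, V, h, hc, ⟨t, ht, hWt⟩, hreg⟩ := exists_isProfile (Or.inl hk)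
  obtain ⟨hq, hW, hV⟩ := hreg hk
  obtain ⟨h1, h2⟩ := h.contDiffOn_two_flow hq hW hV
  refine ⟨flowVelocity (2 - α) W V, flowPressure (2 - α) q c W V,
    ⟨h.contDiffOn_flowVelocity, h.contDiffOn_flowPressure,
      homogeneous_flow _ _ _ _ _ α rfl _, h.eulerClassical, axisymmetric_flow _ _ _ _,
      meridian t, meridian_ne_zero (Ioo_subset_Icc_self ht), fun h0 => ?_⟩,
    h.nonconstantBernoulli hc ht hWt, ?_, h2, ?_⟩
  · exact h.curl_meridian_ne_zero hc ht hWt (by rw [h0]; rfl)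
  · rw [poloidal_flowVelocity]; exact h1
  · rw [toroidal_flowVelocity]; exact contDiffOn_const

/-! ### Weak formulation of classical solutions -/

lemma ContDiff.comp_coord {n : WithTop ℕ∞} {u : E3 → E3} (hu : ContDiff ℝ n u) (i : Fin 3) :
    ContDiff ℝ n fun x => u x i := (contDiff_coord i).comp hu

lemma continuous_pd {f : E3 → ℝ} (hf : ContDiff ℝ 1 f) (j : Fin 3) : Continuous (pd j f) :=
  (hf.continuous_fderiv one_ne_zero).clm_apply continuous_const

lemma hasCompactSupport_pd {f : E3 → ℝ} (hf : HasCompactSupport f) (j : Fin 3) :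
    HasCompactSupport (pd j f) :=
  (hf.fderiv ℝ).comp_left (g := fun L : E3 →L[ℝ] ℝ => L (EuclideanSpace.single j 1)) rfl

lemma integral_mul_pd {f η : E3 → ℝ} (hf : ContDiff ℝ 1 f) (hη : ContDiff ℝ 1 η)
    (hs : HasCompactSupport η) (j : Fin 3) :
    ∫ x, f x * pd j η x = -∫ x, pd j f x * η x := by
  refine integral_mul_fderiv_eq_neg_fderiv_mul_of_integrable ?_ ?_ ?_
    (fun x _ => hf.differentiable one_ne_zero x) (fun x _ => hη.differentiable one_ne_zero x)
  · exact ((continuous_pd hf j).mul hη.continuous).integrable_of_hasCompactSupport hs.mul_left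
  · exact (hf.continuous.mul (continuous_pd hη j)).integrable_of_hasCompactSupport
      (hasCompactSupport_pd hs j).mul_left
  · exact (hf.continuous.mul hη.continuous).integrable_of_hasCompactSupport hs.mul_left

lemma hasCompactSupport_coord {Φ : E3 → E3} (hs : HasCompactSupport Φ) (i : Fin 3) :
    HasCompactSupport fun x => Φ x i := hs.comp_left (g := fun y : E3 => y i) rfl

lemma ae_mem_punctured : ∀ᵐ x : E3, x ∈ punctured := by
  rw [ae_iff]
  have : {a : E3 | a ∉ punctured} = {0} := by ext; simp [punctured]
  rw [this]; exact measure_singleton 0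

/-- The equations are known only off the origin, but u and p are C¹ across it. Integration by parts
therefore has no contribution from the origin, and the missing point is a null set. With ∇ · u = 0
the divergence of u ⊗ u is u · ∇u. -/
theorem EulerClassical.distributional {u : E3 → E3} {p : E3 → ℝ} (hu : ContDiff ℝ 1 u)
    (hp : ContDiff ℝ 1 p) (h : EulerClassical punctured u p) : EulerDistributional u p := by
  have hui := fun i => ContDiff.comp_coord hu i
  constructor
  · intro Φ hΦ hs
    have hΦi : ∀ i, ContDiff ℝ 1 fun x => Φ x i := fun i =>
      (ContDiff.comp_coord hΦ i).of_le (by norm_cast)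
    have hsi := fun i => hasCompactSupport_coord hs i
    have hI : ∀ (f : E3 → ℝ) (_ : Continuous f) (i j : Fin 3),
        Integrable fun x => f x * pd j (fun y => Φ y i) x := fun f hf i j =>
      (hf.mul (continuous_pd (hΦi i) j)).integrable_of_hasCompactSupport
        (hasCompactSupport_pd (hsi i) j).mul_left
    have hI' : ∀ (f : E3 → ℝ) (_ : Continuous f) (i : Fin 3),
        Integrable fun x => f x * Φ x i := fun f hf i =>
      (hf.mul (hΦi i).continuous).integrable_of_hasCompactSupport (hsi i).mul_left
    have huu : ∀ i j, ContDiff ℝ 1 fun x => u x i * u x j := fun i j => (hui i).mul (hui j)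
    have e1 : ∫ x, (∑ i, ∑ j, u x i * u x j * pd j (fun y => Φ y i) x + p x * divergence Φ x) =
        ∑ i, ((∑ j, ∫ x, u x i * u x j * pd j (fun y => Φ y i) x)
          + ∫ x, p x * pd i (fun y => Φ y i) x) := by
      rw [integral_add, integral_finsetSum, Finset.sum_add_distrib]
      · congr 1
        · refine Finset.sum_congr rfl fun i _ => ?_
          rw [integral_finsetSum]
          exact fun j _ => hI _ (huu i j).continuous i j
        · simp only [divergence, Finset.mul_sum]
          rw [integral_finsetSum]
          exact fun i _ => hI _ hp.continuous i i
      · exact fun i _ => integrable_finsetSum _ fun j _ => hI _ (huu i j).continuous i j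
      · exact integrable_finsetSum _ fun i _ => integrable_finsetSum _ fun j _ =>
          hI _ (huu i j).continuous i j
      · simp only [divergence, Finset.mul_sum]
        exact integrable_finsetSum _ fun i _ => hI _ hp.continuous i i
    rw [e1]
    refine Finset.sum_eq_zero fun i _ => ?_
    have e2 : ∀ j, ∫ x, u x i * u x j * pd j (fun y => Φ y i) x =
        -∫ x, pd j (fun y => u y i * u y j) x * Φ x i := fun j =>
      integral_mul_pd (huu i j) (hΦi i) (hsi i) j
    have e3 : ∫ x, p x * pd i (fun y => Φ y i) x = -∫ x, pd i p x * Φ x i :=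
      integral_mul_pd hp (hΦi i) (hsi i) i
    simp only [e2]
    rw [e3, Finset.sum_neg_distrib, ← neg_add, neg_eq_zero, ← integral_finsetSum, ← integral_add]
    · refine integral_eq_zero_of_ae ?_
      filter_upwards [ae_mem_punctured] with x hx
      obtain ⟨h1, h2⟩ := h x hx
      have h3 : ∀ j, pd j (fun y => u y i * u y j) x =
          u x i * pd j (fun y => u y j) x + u x j * pd j (fun y => u y i) x := fun j =>
        pd_mul ((hui i).differentiable one_ne_zero x) ((hui j).differentiable one_ne_zero x) j
      simp only [h3, ← Finset.sum_mul, Finset.sum_add_distrib, ← Finset.mul_sum]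
      rw [divergence] at h2
      rw [h2, mul_zero, zero_add, ← add_mul, h1 i, zero_mul]
      rfl
    · exact integrable_finsetSum _ fun j _ => hI' _ (continuous_pd (huu i j) j) i
    · exact hI' _ (continuous_pd hp i) i
    · exact fun j _ => hI' _ (continuous_pd (huu i j) j) i
  · intro η hη hs
    have hη1 : ContDiff ℝ 1 η := hη.of_le (by norm_cast)
    rw [integral_finsetSum]
    · simp only [fun i => integral_mul_pd (hui i) hη1 hs i]
      rw [Finset.sum_neg_distrib, neg_eq_zero, ← integral_finsetSum]
      · refine integral_eq_zero_of_ae ?_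
        filter_upwards [ae_mem_punctured] with x hx
        have h2 := (h x hx).2
        rw [divergence] at h2
        rw [← Finset.sum_mul, h2, zero_mul]
        rfl
      · exact fun i _ => ((continuous_pd (hui i) i).mul
          hη1.continuous).integrable_of_hasCompactSupport hs.mul_left
    · exact fun i _ => ((hui i).continuous.mul
        (continuous_pd hη1 i)).integrable_of_hasCompactSupport (hasCompactSupport_pd hs i).mul_left

/-- Test fields (0, η, 0) see exactly the second component of the curl. If all pairings vanished,
this continuous component would vanish almost everywhere, hence everywhere. -/
theorem rotationalDistributional_of_curl_one {u : E3 → E3} (hu : ContDiff ℝ 1 u) {x₀ : E3}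
    (hx : curl u x₀ 1 ≠ 0) : RotationalDistributional u := by
  have hui := fun i => ContDiff.comp_coord hu i
  by_contra hcon
  unfold RotationalDistributional at hcon
  push Not at hcon
  have hcc : Continuous fun x => curl u x 1 :=
    (continuous_pd (hui 0) 2).sub (continuous_pd (hui 2) 0)
  have h0 : ∀ᵐ x : E3, curl u x 1 = 0 := by
    refine ae_eq_zero_of_integral_contDiff_smul_eq_zero hcc.locallyIntegrable fun η hη hs => ?_
    have hη1 : ContDiff ℝ 1 η := hη.of_le (by norm_cast)
    have h1 := hcon (fun y => !₂[0, η y, 0]) (by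
      rw [contDiff_euclidean]
      intro i
      fin_cases i
      · exact contDiff_const
      · exact hη
      · exact contDiff_const)
      (hs.comp_left (g := fun s : ℝ => (!₂[0, s, 0] : E3)) (by ext i; fin_cases i <;> rfl))
    have h2 : ∀ x, ∑ i, u x i * curl (fun y => (!₂[0, η y, 0] : E3)) x i =
        u x 2 * pd 0 η x - u x 0 * pd 2 η x := by
      intro x
      have h3 : ∀ j, pd j (fun _ : E3 => (0 : ℝ)) x = 0 := fun j => by simp [pd]
      rw [Fin.sum_univ_three]
      simp [curl, h3]
      ring
    simp only [h2] at h1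
    have hI : ∀ i j, Integrable fun x => u x i * pd j η x := fun i j =>
      ((hui i).continuous.mul (continuous_pd hη1 j)).integrable_of_hasCompactSupport
        (hasCompactSupport_pd hs j).mul_left
    have hI' : ∀ i j, Integrable fun x => pd j (fun y => u y i) x * η x := fun i j =>
      ((continuous_pd (hui i) j).mul hη1.continuous).integrable_of_hasCompactSupport hs.mul_left
    rw [integral_sub (hI 2 0) (hI 0 2), integral_mul_pd (hui 2) hη1 hs,
      integral_mul_pd (hui 0) hη1 hs] at h1
    have h4 : ∀ x, η x • curl u x 1 =
        pd 2 (fun y => u y 0) x * η x - pd 0 (fun y => u y 2) x * η x := by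
      intro x
      have : curl u x 1 = pd 2 (fun y => u y 0) x - pd 0 (fun y => u y 2) x := rfl
      rw [this, smul_eq_mul]; ring
    simp only [h4]
    rw [integral_sub (hI' 0 2) (hI' 2 0)]
    linarith
  have h5 : (fun x => curl u x 1) = fun _ => 0 :=
    (hcc.ae_eq_iff_eq volume continuous_const).1 h0
  exact hx (congrFun h5 x₀)

/-- For k > 4 the angular coefficients have degrees k - 3, k - 2 and 2k - 4, all larger than 1. The
flow is therefore C¹ even at the origin, and the weak equations follow from the classical ones. -/
theorem exists_continuousSolution {α : ℝ} (hα : α < -2) :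
    ∃ (u : E3 → E3) (p : E3 → ℝ), ContinuousSolution α u p ∧
      NonconstantBernoulli univ u p ∧ ContDiffOn ℝ 1 (poloidal u) offAxis ∧
      Continuous (poloidal u) ∧ ContDiffOn ℝ 1 p offAxis ∧ Continuous p ∧
      Continuous (toroidal u) := by
  have hk : 4 < 2 - α := by linarith
  obtain ⟨q, c, W, V, h, hc, ⟨t, ht, hWt⟩, -⟩ := exists_isProfile (Or.inr hk)
  have hu : ContDiff ℝ 1 (flowVelocity (2 - α) W V) := by
    rw [← contDiffOn_univ]
    refine contDiffOn_E3 (ContDiff.contDiffOn ?_) (ContDiff.contDiffOn ?_) (ContDiff.contDiffOn ?_)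
    · exact ((contDiff_coord 0).mul (contDiff_homFn (by linarith) h.contDiff_radialPart)).neg
    · exact ((contDiff_coord 1).mul (contDiff_homFn (by linarith) h.contDiff_radialPart)).neg
    · exact contDiff_homFn (by linarith) h.contDiff_axialPart
  have hp : ContDiff ℝ 1 (flowPressure (2 - α) q c W V) :=
    contDiff_homFn (by linarith) h.contDiff_pressurePart
  refine ⟨flowVelocity (2 - α) W V, flowPressure (2 - α) q c W V,
    ⟨hu.continuous, hp.continuous, homogeneous_flow _ _ _ _ _ α rfl _,
      h.eulerClassical.distributional hu hp, axisymmetric_flow _ _ _ _,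
      rotationalDistributional_of_curl_one hu (h.curl_meridian_ne_zero hc ht hWt)⟩,
    ?_, ?_, ?_, hp.contDiffOn, hp.continuous, ?_⟩
  · obtain ⟨x, -, y, -, hxy⟩ := h.nonconstantBernoulli hc ht hWt
    exact ⟨x, mem_univ x, y, mem_univ y, hxy⟩
  · rw [poloidal_flowVelocity]; exact hu.contDiffOn
  · rw [poloidal_flowVelocity]; exact hu.continuous
  · rw [toroidal_flowVelocity]; exact continuous_const

/-! ### Rigidity lemmas on `(-1, 1)` -/

/-- A continuous function whose derivative vanishes wherever the function does not is constant. -/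
lemma exists_eq_const_of_hasDerivAt_zero {f : ℝ → ℝ} (hc : ContinuousOn f (Ioo (-1) 1))
    (hd : ∀ t ∈ Ioo (-1 : ℝ) 1, f t ≠ 0 → HasDerivAt f 0 t) :
    ∃ c, ∀ t ∈ Ioo (-1 : ℝ) 1, f t = c := by
  -- Truncating f² from below at ε > 0 removes the points where f may fail to be differentiable:
  -- near a zero of f the truncation is locally constant, and elsewhere it inherits the zero
  -- derivative. Letting ε tend to 0 shows that f² is constant.
  have hmax : ∀ ε > 0, ∀ t ∈ Ioo (-1 : ℝ) 1,
      HasDerivAt (fun t => max (f t ^ 2) ε) 0 t := by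
    intro ε hε t ht
    by_cases h0 : f t = 0
    · have h1 : ∀ᶠ s in 𝓝 t, f s ^ 2 < ε := by
        have := ((hc.continuousAt (isOpen_Ioo.mem_nhds ht)).pow 2).tendsto
        refine this.eventually (gt_mem_nhds ?_)
        simp [h0, hε]
      refine (hasDerivAt_const t ε).congr_of_eventuallyEq ?_
      filter_upwards [h1] with s hs using max_eq_right hs.le
    · have h1 : HasDerivAt (fun t => f t ^ 2) 0 t := by
        refine ((hd t ht h0).fun_pow 2).congr_deriv (by simp)
      rw [hasDerivAt_iff_isLittleO] at h1 ⊢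
      simp only [smul_zero, sub_zero] at h1 ⊢
      refine Asymptotics.IsBigO.trans_isLittleO (Asymptotics.IsBigO.of_bound 1
        (Eventually.of_forall fun s => ?_)) h1
      rw [one_mul, Real.norm_eq_abs, Real.norm_eq_abs]
      exact abs_max_sub_max_le_abs _ _ _
  have hsq : ∀ s ∈ Ioo (-1 : ℝ) 1, ∀ t ∈ Ioo (-1 : ℝ) 1, f s ^ 2 = f t ^ 2 := by
    have hm : ∀ ε > 0, ∀ s ∈ Ioo (-1 : ℝ) 1, ∀ t ∈ Ioo (-1 : ℝ) 1,
        max (f s ^ 2) ε = max (f t ^ 2) ε := by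
      intro ε hε s hs t ht
      exact isOpen_Ioo.is_const_of_deriv_eq_zero isPreconnected_Ioo
        (fun t ht => (hmax ε hε t ht).differentiableAt.differentiableWithinAt)
        (fun t ht => (hmax ε hε t ht).deriv) hs ht
    have hle : ∀ s ∈ Ioo (-1 : ℝ) 1, ∀ t ∈ Ioo (-1 : ℝ) 1, f s ^ 2 ≤ f t ^ 2 := by
      intro s hs t ht
      refine le_of_forall_pos_le_add fun ε hε => ?_
      calc f s ^ 2 ≤ max (f s ^ 2) ε := le_max_left _ _
        _ = max (f t ^ 2) ε := hm ε hε s hs t ht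
        _ ≤ f t ^ 2 + ε := max_le (by linarith) (by nlinarith [sq_nonneg (f t)])
    exact fun s hs t ht => le_antisymm (hle s hs t ht) (hle t ht s hs)
  have h0 : (0 : ℝ) ∈ Ioo (-1 : ℝ) 1 := by norm_num
  by_cases hz : f 0 = 0
  · refine ⟨0, fun t ht => ?_⟩
    have := hsq t ht 0 h0
    rw [hz] at this
    simpa using this
  · have hne : ∀ t ∈ Ioo (-1 : ℝ) 1, f t ≠ 0 := by
      intro t ht h
      have := hsq 0 h0 t ht
      rw [h] at this
      exact hz (by simpa using this)
    refine ⟨f 0, fun t ht => ?_⟩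
    exact isOpen_Ioo.is_const_of_deriv_eq_zero isPreconnected_Ioo
      (fun t ht => (hd t ht (hne t ht)).differentiableAt.differentiableWithinAt)
      (fun t ht => (hd t ht (hne t ht)).deriv) ht h0

lemma tendsto_bound_right {r : ℝ} (hr : 0 < r) (C : ℝ) :
    Tendsto (fun t : ℝ => C * (1 - t ^ 2) ^ r) (𝓝[<] 1) (𝓝 0) := by
  have h : Continuous fun t : ℝ => C * (1 - t ^ 2) ^ r :=
    continuous_const.mul ((by fun_prop : Continuous fun t : ℝ => 1 - t ^ 2).rpow_const
      fun _ => Or.inr hr.le)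
  have h1 := h.tendsto 1
  rw [one_pow, sub_self, Real.zero_rpow hr.ne', mul_zero] at h1
  exact h1.mono_left nhdsWithin_le_nhds

lemma tendsto_bound_left {r : ℝ} (hr : 0 < r) (C : ℝ) :
    Tendsto (fun t : ℝ => C * (1 - t ^ 2) ^ r) (𝓝[>] (-1)) (𝓝 0) := by
  have h : Continuous fun t : ℝ => C * (1 - t ^ 2) ^ r :=
    continuous_const.mul ((by fun_prop : Continuous fun t : ℝ => 1 - t ^ 2).rpow_const
      fun _ => Or.inr hr.le)
  have h1 := h.tendsto (-1)
  rw [neg_one_sq, sub_self, Real.zero_rpow hr.ne', mul_zero] at h1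
  exact h1.mono_left nhdsWithin_le_nhds

lemma tendsto_zero_right {f : ℝ → ℝ} {C r : ℝ} (hr : 0 < r)
    (hb : ∀ t ∈ Ioo (-1 : ℝ) 1, |f t| ≤ C * (1 - t ^ 2) ^ r) : Tendsto f (𝓝[<] 1) (𝓝 0) := by
  refine squeeze_zero_norm' ?_ (tendsto_bound_right hr C)
  filter_upwards [Ioo_mem_nhdsLT (show (-1 : ℝ) < 1 by norm_num)] with t ht using hb t ht

lemma tendsto_zero_left {f : ℝ → ℝ} {C r : ℝ} (hr : 0 < r)
    (hb : ∀ t ∈ Ioo (-1 : ℝ) 1, |f t| ≤ C * (1 - t ^ 2) ^ r) : Tendsto f (𝓝[>] (-1)) (𝓝 0) := by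
  refine squeeze_zero_norm' ?_ (tendsto_bound_left hr C)
  filter_upwards [Ioo_mem_nhdsGT (show (-1 : ℝ) < 1 by norm_num)] with t ht using hb t ht

/-- The main device of the nonexistence proof: a quantity conserved wherever it is nonzero is
constant, and decay at the pole makes the constant zero. No information is needed at its zeros
beyond continuity. -/
lemma eq_zero_of_hasDerivAt_zero {f : ℝ → ℝ} (hc : ContinuousOn f (Ioo (-1) 1))
    (hd : ∀ t ∈ Ioo (-1 : ℝ) 1, f t ≠ 0 → HasDerivAt f 0 t) {C r : ℝ} (hr : 0 < r)
    (hb : ∀ t ∈ Ioo (-1 : ℝ) 1, |f t| ≤ C * (1 - t ^ 2) ^ r) :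
    ∀ t ∈ Ioo (-1 : ℝ) 1, f t = 0 := by
  obtain ⟨c, hc⟩ := exists_eq_const_of_hasDerivAt_zero hc hd
  have h1 : Tendsto f (𝓝[<] 1) (𝓝 c) := by
    refine tendsto_const_nhds.congr' ?_
    filter_upwards [Ioo_mem_nhdsLT (show (-1 : ℝ) < 1 by norm_num)] with t ht using (hc t ht).symm
  have h2 := tendsto_nhds_unique h1 (tendsto_zero_right hr hb)
  intro t ht
  rw [hc t ht, h2]

/-- A nondecreasing function with limit 0 at both ends vanishes, and so does its derivative. -/
lemma eq_zero_of_deriv_nonneg {f f' : ℝ → ℝ} (hd : ∀ t ∈ Ioo (-1 : ℝ) 1, HasDerivAt f (f' t) t)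
    (hf' : ∀ t ∈ Ioo (-1 : ℝ) 1, 0 ≤ f' t) {C r : ℝ} (hr : 0 < r)
    (hb : ∀ t ∈ Ioo (-1 : ℝ) 1, |f t| ≤ C * (1 - t ^ 2) ^ r) :
    ∀ t ∈ Ioo (-1 : ℝ) 1, f t = 0 ∧ f' t = 0 := by
  have hmono : MonotoneOn f (Ioo (-1) 1) := by
    refine monotoneOn_of_deriv_nonneg (convex_Ioo _ _)
      (fun t ht => (hd t ht).continuousAt.continuousWithinAt) ?_ ?_
    · rw [interior_Ioo]; exact fun t ht => (hd t ht).differentiableAt.differentiableWithinAt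
    · rw [interior_Ioo]; intro t ht; rw [(hd t ht).deriv]; exact hf' t ht
  have h0 : ∀ t ∈ Ioo (-1 : ℝ) 1, f t = 0 := by
    intro t ht
    apply le_antisymm
    · refine ge_of_tendsto (tendsto_zero_right hr hb) ?_
      filter_upwards [Ioo_mem_nhdsLT ht.2] with s hs
      exact hmono ht ⟨ht.1.trans hs.1, hs.2⟩ hs.1.le
    · refine le_of_tendsto (tendsto_zero_left hr hb) ?_
      filter_upwards [Ioo_mem_nhdsGT ht.1] with s hs
      exact hmono ⟨hs.1, hs.2.trans ht.2⟩ ht hs.2.le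
  intro t ht
  refine ⟨h0 t ht, (hd t ht).unique ?_⟩
  refine (hasDerivAt_const t (0 : ℝ)).congr_of_eventuallyEq ?_
  filter_upwards [isOpen_Ioo.mem_nhds ht] with s hs using h0 s hs

lemma hasDerivAt_abs_rpow_comp {W : ℝ → ℝ} {W' t : ℝ} (r : ℝ) (hW : HasDerivAt W W' t)
    (h0 : W t ≠ 0) : HasDerivAt (fun t => |W t| ^ r) (r * |W t| ^ r * W' / W t) t := by
  have hx0 : 0 < |W t| := abs_pos.2 h0
  refine (((hasDerivAt_abs h0).comp t hW).rpow_const (p := r) (Or.inl hx0.ne')).congr_deriv ?_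
  have h3 : |W t| ^ r = |W t| ^ (r - 1) * |W t| := by
    rw [← Real.rpow_add_one hx0.ne']; congr 1; ring
  simp only [Function.comp]
  rw [h3, eq_div_iff h0]
  have h2 : (SignType.sign (W t) : ℝ) * W t = |W t| := sign_mul_self _
  linear_combination (W' * r * |W t| ^ (r - 1)) * h2

lemma hasDerivAt_one_sub_sq (t : ℝ) : HasDerivAt (fun t : ℝ => 1 - t ^ 2) (-(2 * t)) t := by
  refine (((hasDerivAt_id t).fun_pow 2).const_sub 1).congr_deriv ?_
  simp

lemma abs_rpow_le_of_sq_le {x M s r : ℝ} (hM : 0 ≤ M) (hs : 0 ≤ s) (hr : 0 ≤ r)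
    (h : x ^ 2 ≤ M * s) : |x| ^ r ≤ M ^ (r / 2) * s ^ (r / 2) := by
  rw [← Real.mul_rpow hM hs]
  have : |x| ^ r = (x ^ 2) ^ (r / 2) := by
    rw [← sq_abs, ← Real.rpow_natCast, ← Real.rpow_mul (abs_nonneg x)]
    congr 1; push_cast; ring
  rw [this]
  exact Real.rpow_le_rpow (sq_nonneg x) h (by positivity)

/-- If `W a' ≥ 0` and `W' = -k a` with `k > 0`, then `a'` is not positive at a zero of `W`. -/
lemma not_pos_of_zero {W a a' : ℝ → ℝ} {k t : ℝ} (hk : 0 < k) (ht : t ∈ Ioo (-1 : ℝ) 1)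
    (hW : ∀ s ∈ Ioo (-1 : ℝ) 1, HasDerivAt W (-k * a s) s)
    (ha : ∀ s ∈ Ioo (-1 : ℝ) 1, HasDerivAt a (a' s) s) (hac : ContinuousOn a' (Ioo (-1) 1))
    (hpos : ∀ s ∈ Ioo (-1 : ℝ) 1, 0 ≤ W s * a' s) (h0 : W t = 0) : ¬ 0 < a' t := by
  intro h1
  have h2 : ∀ᶠ s in 𝓝 t, 0 < a' s ∧ s ∈ Ioo (-1 : ℝ) 1 :=
    ((hac.continuousAt (isOpen_Ioo.mem_nhds ht)).eventually (lt_mem_nhds h1)).and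
      (isOpen_Ioo.mem_nhds ht)
  -- If a' were positive near t, then W ≥ 0 there, so t would be a minimum of W and a would vanish
  -- at t. To the right of t, a would be positive and W would fall below 0, contradicting W a' ≥ 0.
  have h3 : IsLocalMin W t := by
    filter_upwards [h2] with s hs
    rw [h0]
    exact nonneg_of_mul_nonneg_left (hpos s hs.2) hs.1
  have h4 : a t = 0 := by
    have := h3.hasDerivAt_eq_zero (hW t ht)
    nlinarith
  obtain ⟨ε, hε, hball⟩ := Metric.eventually_nhds_iff.1 h2
  have hin : ∀ s ∈ Icc t (t + ε / 2), 0 < a' s ∧ s ∈ Ioo (-1 : ℝ) 1 := fun s hs => hball (by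
    rw [Real.dist_eq, abs_of_nonneg (by linarith [hs.1])]; linarith [hs.2])
  have hapos : ∀ s ∈ Ioc t (t + ε / 2), 0 < a s := by
    intro s hs
    have : StrictMonoOn a (Icc t (t + ε / 2)) := by
      refine strictMonoOn_of_deriv_pos (convex_Icc _ _)
        (fun s hs => (ha s (hin s hs).2).continuousAt.continuousWithinAt) fun s hs => ?_
      have hs' := hin s (interior_subset hs)
      rw [(ha s hs'.2).deriv]; exact hs'.1
    have h5 := this (left_mem_Icc.2 (by linarith)) (Ioc_subset_Icc_self hs) hs.1
    rwa [h4] at h5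
  have hWanti : StrictAntiOn W (Icc t (t + ε / 2)) := by
    refine strictAntiOn_of_deriv_neg (convex_Icc _ _)
      (fun s hs => (hW s (hin s hs).2).continuousAt.continuousWithinAt) fun s hs => ?_
    have hs' := hin s (interior_subset hs)
    rw [interior_Icc] at hs
    rw [(hW s hs'.2).deriv]
    have := hapos s ⟨hs.1, hs.2.le⟩
    nlinarith
  have hr : t + ε / 2 ∈ Icc t (t + ε / 2) := right_mem_Icc.2 (by linarith)
  have h6 := hWanti (left_mem_Icc.2 (by linarith)) hr (by linarith)
  rw [h0] at h6
  have h7 := hin _ hr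
  have := hpos _ h7.2
  nlinarith

/-! ### The Euler equations along a meridian -/

/-- The Euler equations for a `(-α)`-homogeneous axisymmetric solution along a meridian of the unit
sphere, parametrized by `t = cos θ`: `a` is the radial velocity, `W` and `γ` are the polar and
azimuthal velocities multiplied by `-sin θ` and `sin θ`, and `P` is the pressure. -/
structure MeridianSystem (α M : ℝ) (a a' W γ γ' P P' : ℝ → ℝ) : Prop where
  hasDerivAt_a : ∀ t ∈ Ioo (-1 : ℝ) 1, HasDerivAt a (a' t) t
  hasDerivAt_W : ∀ t ∈ Ioo (-1 : ℝ) 1, HasDerivAt W (-(2 - α) * a t) t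
  hasDerivAt_γ : ∀ t ∈ Ioo (-1 : ℝ) 1, HasDerivAt γ (γ' t) t
  hasDerivAt_P : ∀ t ∈ Ioo (-1 : ℝ) 1, HasDerivAt P (P' t) t
  continuousOn_a' : ContinuousOn a' (Ioo (-1) 1)
  radial : ∀ t ∈ Ioo (-1 : ℝ) 1,
    W t * a' t - α * a t ^ 2 - (W t ^ 2 + γ t ^ 2) / (1 - t ^ 2) - 2 * α * P t = 0
  swirl : ∀ t ∈ Ioo (-1 : ℝ) 1, W t * γ' t + (1 - α) * a t * γ t = 0
  polar : ∀ t ∈ Ioo (-1 : ℝ) 1,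
    P' t - a t * W t / (1 - t ^ 2) + t * (W t ^ 2 + γ t ^ 2) / (1 - t ^ 2) ^ 2 = 0
  nonneg_M : 0 ≤ M
  abs_a_le : ∀ t ∈ Ioo (-1 : ℝ) 1, |a t| ≤ M
  abs_P_le : ∀ t ∈ Ioo (-1 : ℝ) 1, |P t| ≤ M
  sq_W_le : ∀ t ∈ Ioo (-1 : ℝ) 1, W t ^ 2 ≤ M * (1 - t ^ 2)
  sq_γ_le : ∀ t ∈ Ioo (-1 : ℝ) 1, γ t ^ 2 ≤ M * (1 - t ^ 2)
  sq_a'_le : ∀ t ∈ Ioo (-1 : ℝ) 1, ((1 - t ^ 2) * a' t) ^ 2 ≤ M * (1 - t ^ 2)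

namespace MeridianSystem

variable {α M : ℝ} {a a' W γ γ' P P' : ℝ → ℝ} (h : MeridianSystem α M a a' W γ γ' P P')
include h

lemma continuousOn_W : ContinuousOn W (Ioo (-1) 1) := fun t ht =>
  (h.hasDerivAt_W t ht).continuousAt.continuousWithinAt

lemma continuousOn_a : ContinuousOn a (Ioo (-1) 1) := fun t ht =>
  (h.hasDerivAt_a t ht).continuousAt.continuousWithinAt

lemma continuousOn_γ : ContinuousOn γ (Ioo (-1) 1) := fun t ht =>
  (h.hasDerivAt_γ t ht).continuousAt.continuousWithinAt

lemma a_eq_zero_of_eventually (hα : α ≠ 2) {t : ℝ} (ht : t ∈ Ioo (-1 : ℝ) 1)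
    (hW : ∀ᶠ s in 𝓝 t, W s = 0) : a t = 0 := by
  have h1 : HasDerivAt W 0 t := (hasDerivAt_const t (0 : ℝ)).congr_of_eventuallyEq hW
  have h2 := (h.hasDerivAt_W t ht).unique h1
  have h3 : -(2 - α) ≠ 0 := by
    intro h; apply hα; linarith
  exact (mul_eq_zero.1 h2).resolve_left h3

/-- If the polar and radial velocities vanish, then `P (1 - t²)^α` has derivative zero. -/
lemma hasDerivAt_pressure {t : ℝ} (ht : t ∈ Ioo (-1 : ℝ) 1) (hW : W t = 0) (ha : a t = 0) :
    HasDerivAt (fun t => P t * (1 - t ^ 2) ^ α) 0 t := by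
  have h0 := one_sub_sq_pos ht
  have h1 := h.radial t ht
  have h2 := h.polar t ht
  rw [hW, ha] at h1 h2
  refine ((h.hasDerivAt_P t ht).fun_mul ((hasDerivAt_one_sub_sq t).rpow_const (p := α)
    (Or.inl h0.ne'))).congr_deriv ?_
  have h3 : (1 - t ^ 2) ^ α = (1 - t ^ 2) ^ (α - 1) * (1 - t ^ 2) := by
    rw [← Real.rpow_add_one h0.ne']; congr 1; ring
  have h4 : γ t ^ 2 / (1 - t ^ 2) = -(2 * α * P t) := by
    have : (0 ^ 2 + γ t ^ 2) / (1 - t ^ 2) = γ t ^ 2 / (1 - t ^ 2) := by ring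
    rw [this] at h1; linarith
  have h5 : P' t * (1 - t ^ 2) = 2 * α * t * P t := by
    have h6 : t * (0 ^ 2 + γ t ^ 2) / (1 - t ^ 2) ^ 2 * (1 - t ^ 2) =
        t * (γ t ^ 2 / (1 - t ^ 2)) := by field_simp; ring
    rw [h4] at h6
    have h7 : (P' t - 0 * 0 / (1 - t ^ 2) + t * (0 ^ 2 + γ t ^ 2) / (1 - t ^ 2) ^ 2)
      * (1 - t ^ 2) = 0 := by rw [h2, zero_mul]
    rw [add_mul, h6] at h7
    simp only [mul_zero, zero_div, sub_zero] at h7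
    linarith
  rw [h3]
  linear_combination (1 - t ^ 2) ^ (α - 1) * h5

/-- Without polar and radial velocity there is no swirl. -/
lemma swirl_eq_zero (hα : 0 < α) (hW : ∀ t ∈ Ioo (-1 : ℝ) 1, W t = 0)
    (ha : ∀ t ∈ Ioo (-1 : ℝ) 1, a t = 0) : ∀ t ∈ Ioo (-1 : ℝ) 1, γ t = 0 := by
  have hP : ∀ t ∈ Ioo (-1 : ℝ) 1, P t * (1 - t ^ 2) ^ α = 0 := by
    refine eq_zero_of_hasDerivAt_zero (fun t ht =>
      (h.hasDerivAt_pressure ht (hW t ht) (ha t ht)).continuousAt.continuousWithinAt)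
      (fun t ht _ => h.hasDerivAt_pressure ht (hW t ht) (ha t ht)) (C := M) hα fun t ht => ?_
    have h0 := one_sub_sq_pos ht
    rw [abs_mul, abs_of_pos (Real.rpow_pos_of_pos h0 α)]
    have := h.abs_P_le t ht
    gcongr
  intro t ht
  have h0 := one_sub_sq_pos ht
  have h1 := h.radial t ht
  have h2 := (mul_eq_zero.1 (hP t ht)).resolve_right (Real.rpow_pos_of_pos h0 α).ne'
  rw [hW t ht, ha t ht, h2] at h1
  have h3 : γ t ^ 2 / (1 - t ^ 2) = 0 := by
    have : (0 ^ 2 + γ t ^ 2) / (1 - t ^ 2) = γ t ^ 2 / (1 - t ^ 2) := by ring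
    rw [this] at h1; linarith
  rw [div_eq_zero_iff] at h3
  exact pow_eq_zero_iff two_ne_zero |>.1 (h3.resolve_right h0.ne')

omit h in
/-- The Bernoulli function along the meridian. -/
noncomputable def head (a W γ P : ℝ → ℝ) (t : ℝ) : ℝ :=
  P t + (a t ^ 2 + (W t ^ 2 + γ t ^ 2) / (1 - t ^ 2)) / 2

lemma hasDerivAt_head {t : ℝ} (ht : t ∈ Ioo (-1 : ℝ) 1) :
    HasDerivAt (head a W γ P) (a t * a' t - (1 - α) * a t * W t / (1 - t ^ 2)
      + γ t * γ' t / (1 - t ^ 2)) t := by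
  have h0 := one_sub_sq_pos ht
  have h2 := h.polar t ht
  refine ((h.hasDerivAt_P t ht).fun_add ((((h.hasDerivAt_a t ht).fun_pow 2).fun_add
    ((((h.hasDerivAt_W t ht).fun_pow 2).fun_add ((h.hasDerivAt_γ t ht).fun_pow 2)).fun_div
      (hasDerivAt_one_sub_sq t) h0.ne')).div_const 2)).congr_deriv ?_
  have h3 : P' t = a t * W t / (1 - t ^ 2) - t * (W t ^ 2 + γ t ^ 2) / (1 - t ^ 2) ^ 2 := by
    linarith
  rw [h3]
  have h0' := h0.ne'
  push_cast
  field_simp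
  ring

lemma head_equation {t : ℝ} (ht : t ∈ Ioo (-1 : ℝ) 1) :
    W t * a' t + (α - 1) * ((W t ^ 2 + γ t ^ 2) / (1 - t ^ 2)) = 2 * α * head a W γ P t := by
  have h1 := h.radial t ht
  unfold head
  linarith

lemma abs_head_le {t : ℝ} (ht : t ∈ Ioo (-1 : ℝ) 1) :
    |head a W γ P t| ≤ M + (M ^ 2 + 2 * M) / 2 := by
  have h0 := one_sub_sq_pos ht
  have h1 := abs_le.1 (h.abs_P_le t ht)
  have h2 : a t ^ 2 ≤ M ^ 2 := by
    rw [← sq_abs]; exact pow_le_pow_left₀ (abs_nonneg _) (h.abs_a_le t ht) 2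
  have h3 : (W t ^ 2 + γ t ^ 2) / (1 - t ^ 2) ≤ 2 * M := by
    rw [div_le_iff₀ h0]; linarith [h.sq_W_le t ht, h.sq_γ_le t ht]
  have h4 : 0 ≤ (W t ^ 2 + γ t ^ 2) / (1 - t ^ 2) := by positivity
  have h5 := h.nonneg_M
  unfold head
  rw [abs_le]
  constructor <;> nlinarith [sq_nonneg (a t)]

/-- This is u · ∇Π = 0 for a Bernoulli function homogeneous of degree -2α: its radial derivative
contributes -2αaΠ. -/
lemma head_mul_deriv {t : ℝ} (ht : t ∈ Ioo (-1 : ℝ) 1) :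
    W t * (a t * a' t - (1 - α) * a t * W t / (1 - t ^ 2) + γ t * γ' t / (1 - t ^ 2)) =
      2 * α * a t * head a W γ P t := by
  have h1 := h.head_equation ht
  have h2 := h.swirl t ht
  have h0 := (one_sub_sq_pos ht).ne'
  have h3 : 2 * α * a t * head a W γ P t = a t * (2 * α * head a W γ P t) := by ring
  rw [h3, ← h1]
  field_simp
  linear_combination γ t * h2

/-- From W' = -(2 - α)a and WΠ' = 2αaΠ, the product Π|W|^r with r = 2α/(2 - α) is conserved where
nonzero. It vanishes at the poles together with W, so ΠW = 0. Where Π ≠ 0, therefore, W and with it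
a vanish on a neighbourhood. There Π = (1 - α)P and P(1 - t²)^α is conserved, so the weight (1 -
t²)^α takes over the role of |W|^r. -/
lemma head_eq_zero (hα : 0 < α) (hα2 : α < 2) : ∀ t ∈ Ioo (-1 : ℝ) 1, head a W γ P t = 0 := by
  have hk : 0 < 2 - α := by linarith
  have hcont : ContinuousOn (head a W γ P) (Ioo (-1) 1) := fun t ht =>
    (h.hasDerivAt_head ht).continuousAt.continuousWithinAt
  set r : ℝ := 2 * α / (2 - α) with hr
  have hr0 : 0 < r := by positivity
  have hrk : r * (2 - α) = 2 * α := by rw [hr]; field_simp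
  set C : ℝ := M + (M ^ 2 + 2 * M) / 2 with hC
  have hC0 : 0 ≤ C := by have := h.nonneg_M; positivity
  have hW : ∀ t ∈ Ioo (-1 : ℝ) 1, head a W γ P t * |W t| ^ r = 0 := by
    refine eq_zero_of_hasDerivAt_zero (C := C * M ^ (r / 2)) (r := r / 2)
      (hcont.mul (h.continuousOn_W.abs.rpow_const fun _ _ => Or.inr hr0.le)) ?_
      (by positivity) fun t ht => ?_
    · intro t ht hne
      have hW0 : W t ≠ 0 := by
        intro h0; apply hne; rw [h0, abs_zero, Real.zero_rpow hr0.ne', mul_zero]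
      refine ((h.hasDerivAt_head ht).fun_mul
        (hasDerivAt_abs_rpow_comp r (h.hasDerivAt_W t ht) hW0)).congr_deriv ?_
      have h1 := h.head_mul_deriv ht
      generalize a t * a' t - (1 - α) * a t * W t / (1 - t ^ 2) + γ t * γ' t / (1 - t ^ 2) = X at *
      clear_value r
      have h3 : X * |W t| ^ r + head a W γ P t * (r * |W t| ^ r * (-(2 - α) * a t) / W t) =
          |W t| ^ r / W t * (W t * X - r * (2 - α) * a t * head a W γ P t) := by
        generalize |W t| ^ r = Y
        field_simp
        ring
      rw [h3, h1, hrk]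
      ring
    · have h0 := one_sub_sq_pos ht
      rw [abs_mul, abs_of_nonneg (by positivity : 0 ≤ |W t| ^ r), mul_assoc]
      exact mul_le_mul (h.abs_head_le ht)
        (abs_rpow_le_of_sq_le h.nonneg_M h0.le hr0.le (h.sq_W_le t ht)) (by positivity) hC0
  have hfin : ∀ t ∈ Ioo (-1 : ℝ) 1, head a W γ P t * (1 - t ^ 2) ^ α = 0 := by
    refine eq_zero_of_hasDerivAt_zero (C := C) (r := α)
      (hcont.mul ((by fun_prop : Continuous fun t : ℝ => 1 - t ^ 2).continuousOn.rpow_const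
        fun _ _ => Or.inr hα.le)) ?_ hα fun t ht => ?_
    · intro t ht hne
      have hne' : head a W γ P t ≠ 0 := left_ne_zero_of_mul hne
      have hev : ∀ᶠ s in 𝓝 t, W s = 0 ∧ s ∈ Ioo (-1 : ℝ) 1 := by
        filter_upwards [(hcont.continuousAt (isOpen_Ioo.mem_nhds ht)).eventually_ne hne',
          isOpen_Ioo.mem_nhds ht] with s hs hs'
        refine ⟨?_, hs'⟩
        have h1 := (mul_eq_zero.1 (hW s hs')).resolve_left hs
        exact abs_eq_zero.1 ((Real.rpow_eq_zero (abs_nonneg _) hr0.ne').1 h1)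
      have hev2 : ∀ᶠ s in 𝓝 t, W s = 0 ∧ a s = 0 ∧ s ∈ Ioo (-1 : ℝ) 1 := by
        filter_upwards [eventually_eventually_nhds.2 hev, hev] with s hs hs'
        exact ⟨hs'.1, h.a_eq_zero_of_eventually hα2.ne hs'.2 (hs.mono fun _ hx => hx.1), hs'.2⟩
      obtain ⟨hWt, hat, -⟩ := hev2.self_of_nhds
      have h1 := (h.hasDerivAt_pressure ht hWt hat).const_mul (1 - α)
      rw [mul_zero] at h1
      refine h1.congr_of_eventuallyEq ?_
      filter_upwards [hev2] with s hs
      obtain ⟨hs1, hs2, hs3⟩ := hs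
      have h2 := h.radial s hs3
      unfold head
      rw [hs1, hs2] at h2 ⊢
      linear_combination (-(1 - s ^ 2) ^ α / 2) * h2
    · have h0 := one_sub_sq_pos ht
      rw [abs_mul, abs_of_pos (Real.rpow_pos_of_pos h0 α)]
      have := h.abs_head_le ht
      gcongr
  intro t ht
  exact (mul_eq_zero.1 (hfin t ht)).resolve_right
    (Real.rpow_pos_of_pos (one_sub_sq_pos ht) α).ne'

lemma abs_W_le {t : ℝ} (ht : t ∈ Ioo (-1 : ℝ) 1) : |W t| ≤ √M * (1 - t ^ 2) ^ (1 / 2 : ℝ) := by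
  rw [← Real.sqrt_eq_rpow, ← Real.sqrt_mul h.nonneg_M, ← Real.sqrt_sq_eq_abs]
  exact Real.sqrt_le_sqrt (h.sq_W_le t ht)

/-- With Π = 0 the derivative of WW' = -(2 - α)aW is W'² plus a term with the factor α - 1 ≥ 0. So
WW' is nondecreasing and tends to 0 at both poles, which makes it zero. Then W is constant, hence
zero, and the pressure argument removes the swirl. -/
theorem eq_zero_of_one_le (hα : 1 ≤ α) (hα2 : α < 2) :
    ∀ t ∈ Ioo (-1 : ℝ) 1, W t = 0 ∧ a t = 0 ∧ γ t = 0 := by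
  have hk : 0 < 2 - α := by linarith
  have hM := h.nonneg_M
  have hZ := eq_zero_of_deriv_nonneg (f := fun t => -(2 - α) * a t * W t)
    (f' := fun t => (2 - α) * ((α - 1) * ((W t ^ 2 + γ t ^ 2) / (1 - t ^ 2)))
      + ((2 - α) * a t) ^ 2) (C := (2 - α) * M * √M) (r := 1 / 2)
    (fun t ht => by
      refine ((((h.hasDerivAt_a t ht).const_mul (-(2 - α)))).fun_mul
        (h.hasDerivAt_W t ht)).congr_deriv ?_
      have h1 := h.head_equation ht
      rw [h.head_eq_zero (by linarith) hα2 t ht] at h1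
      linear_combination -(2 - α) * h1)
    (fun t ht => by
      have h0 := one_sub_sq_pos ht
      have : 0 ≤ α - 1 := by linarith
      positivity) (by norm_num)
    (fun t ht => by
      rw [abs_mul, abs_mul, abs_neg, abs_of_pos hk, mul_assoc ((2 - α) * M)]
      have h1 := h.abs_a_le t ht
      have h2 := h.abs_W_le ht
      gcongr)
  have hW : ∀ t ∈ Ioo (-1 : ℝ) 1, W t = 0 := by
    refine eq_zero_of_hasDerivAt_zero h.continuousOn_W (fun t ht hne => ?_)
      (by norm_num : (0 : ℝ) < 1 / 2) fun t ht => h.abs_W_le ht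
    have h1 := (hZ t ht).1
    refine (h.hasDerivAt_W t ht).congr_deriv ((mul_eq_zero.1 h1).resolve_right hne)
  have ha : ∀ t ∈ Ioo (-1 : ℝ) 1, a t = 0 := fun t ht => by
    refine h.a_eq_zero_of_eventually hα2.ne ht ?_
    filter_upwards [isOpen_Ioo.mem_nhds ht] with s hs using hW s hs
  have hγ := h.swirl_eq_zero (by linarith) hW ha
  exact fun t ht => ⟨hW t ht, ha t ht, hγ t ht⟩

/-- Homogeneity `-2`: the flow is radial. -/
theorem exists_radial_of_eq_two (hα : α = 2) :
    ∃ c, ∀ t ∈ Ioo (-1 : ℝ) 1, W t = 0 ∧ a t = c ∧ γ t = 0 := by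
  have hM := h.nonneg_M
  have hW : ∀ t ∈ Ioo (-1 : ℝ) 1, W t = 0 :=
    eq_zero_of_hasDerivAt_zero h.continuousOn_W
      (fun t ht _ => (h.hasDerivAt_W t ht).congr_deriv (by rw [hα]; ring))
      (by norm_num : (0 : ℝ) < 1 / 2) fun t ht => h.abs_W_le ht
  have hrad : ∀ t ∈ Ioo (-1 : ℝ) 1,
      2 * a t ^ 2 * (1 - t ^ 2) + γ t ^ 2 + 4 * P t * (1 - t ^ 2) = 0 := by
    intro t ht
    have h0 := (one_sub_sq_pos ht).ne'
    have h1 := h.radial t ht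
    rw [hW t ht, hα] at h1
    field_simp at h1
    linear_combination -h1
  -- For W = 0 the swirl equation reads aγ = 0. Where γ ≠ 0 the radial velocity thus vanishes, and
  -- γ²(1 - t²) = -4P(1 - t²)² is conserved.
  have hγ : ∀ t ∈ Ioo (-1 : ℝ) 1, γ t ^ 2 * (1 - t ^ 2) = 0 := by
    refine eq_zero_of_hasDerivAt_zero (C := M) (r := 2)
      ((h.continuousOn_γ.pow 2).mul (by fun_prop)) (fun t ht hne => ?_) two_pos fun t ht => ?_
    · have hγ0 : γ t ≠ 0 := by
        intro h0; apply hne; rw [h0]; ring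
      have hev : ∀ᶠ s in 𝓝 t, a s = 0 ∧ s ∈ Ioo (-1 : ℝ) 1 := by
        filter_upwards [((h.hasDerivAt_γ t ht).continuousAt).eventually_ne hγ0,
          isOpen_Ioo.mem_nhds ht] with s hs hs'
        refine ⟨?_, hs'⟩
        have h1 := h.swirl s hs'
        rw [hW s hs', hα] at h1
        have h2 : a s * γ s = 0 := by linarith
        exact (mul_eq_zero.1 h2).resolve_right hs
      have h1 := (h.hasDerivAt_pressure ht (hW t ht) hev.self_of_nhds.1).const_mul (-4)
      rw [mul_zero] at h1
      refine h1.congr_of_eventuallyEq ?_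
      filter_upwards [hev] with s hs
      have h2 := hrad s hs.2
      rw [hs.1] at h2
      rw [hα, Real.rpow_two]
      linear_combination (1 - s ^ 2) * h2
    · have h0 := one_sub_sq_pos ht
      rw [abs_of_nonneg (by positivity), Real.rpow_two, sq (1 - t ^ 2), ← mul_assoc]
      exact mul_le_mul_of_nonneg_right (h.sq_γ_le t ht) h0.le
  have hγ' : ∀ t ∈ Ioo (-1 : ℝ) 1, γ t = 0 := fun t ht =>
    pow_eq_zero_iff two_ne_zero |>.1
      ((mul_eq_zero.1 (hγ t ht)).resolve_right (one_sub_sq_pos ht).ne')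
  have hrad' : ∀ t ∈ Ioo (-1 : ℝ) 1, a t ^ 2 = -2 * P t := by
    intro t ht
    have h1 := hrad t ht
    rw [hγ' t ht] at h1
    have h2 : (1 - t ^ 2) * (a t ^ 2 - -2 * P t) = 0 := by linear_combination h1 / 2
    exact sub_eq_zero.1 ((mul_eq_zero.1 h2).resolve_left (one_sub_sq_pos ht).ne')
  obtain ⟨c, hc⟩ := exists_eq_const_of_hasDerivAt_zero h.continuousOn_a fun t ht hne => by
    have h1 := (h.hasDerivAt_P t ht).const_mul (-2)
    have h2 : HasDerivAt (fun s => a s ^ 2) (-2 * P' t) t := by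
      refine h1.congr_of_eventuallyEq ?_
      filter_upwards [isOpen_Ioo.mem_nhds ht] with s hs using hrad' s hs
    have h3 := ((h.hasDerivAt_a t ht).fun_pow 2).unique h2
    have h4 : P' t = 0 := by
      have := h.polar t ht
      rw [hW t ht, hγ' t ht] at this
      simpa using this
    rw [h4] at h3
    have h5 : a' t = 0 := by
      have : a t * a' t = 0 := by
        push_cast at h3
        linear_combination h3 / 2
      exact (mul_eq_zero.1 this).resolve_left hne
    exact h5 ▸ h.hasDerivAt_a t ht
  exact ⟨c, fun t ht => ⟨hW t ht, hc t ht, hγ' t ht⟩⟩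

/-! ### The range 0 ≤ α < 1 -/

section LessThanOne

/-- For α > 0 the Bernoulli term vanishes with Π; for α = 0 its coefficient 2α does. -/
lemma polar_mul_deriv (hα : 0 ≤ α) (hα1 : α < 1) {t : ℝ} (ht : t ∈ Ioo (-1 : ℝ) 1) :
    W t * ((1 - t ^ 2) * a' t) = (1 - α) * (W t ^ 2 + γ t ^ 2) := by
  have h0 := (one_sub_sq_pos ht).ne'
  have h1 := h.head_equation ht
  have h2 : 2 * α * head a W γ P t = 0 := by
    rcases hα.eq_or_lt with h3 | h3
    · rw [← h3]; ring
    · rw [h.head_eq_zero h3 (by linarith) t ht, mul_zero]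
  rw [h2] at h1
  field_simp at h1
  linear_combination h1

/-- The relation just proved gives W a' ≥ 0, which `not_pos_of_zero` turns into an upper bound for
a' at a zero of W. The sign change (W, a) ↦ (-W, -a) gives the opposite bound. -/
lemma deriv_eq_zero_of_polar_eq_zero (hα : 0 ≤ α) (hα1 : α < 1) {t : ℝ}
    (ht : t ∈ Ioo (-1 : ℝ) 1) (hW : W t = 0) : a' t = 0 := by
  have hpos : ∀ s ∈ Ioo (-1 : ℝ) 1, 0 ≤ W s * a' s := by
    intro s hs
    have h0 := one_sub_sq_pos hs
    have h1 := h.polar_mul_deriv hα hα1 hs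
    have h2 : 0 ≤ (1 - α) * (W s ^ 2 + γ s ^ 2) := by
      have : 0 ≤ 1 - α := by linarith
      positivity
    rw [← h1] at h2
    have h3 : W s * ((1 - s ^ 2) * a' s) = (1 - s ^ 2) * (W s * a' s) := by ring
    rw [h3] at h2
    exact nonneg_of_mul_nonneg_right h2 h0
  have hk : 0 < 2 - α := by linarith
  have h1 := not_pos_of_zero hk ht h.hasDerivAt_W h.hasDerivAt_a h.continuousOn_a' hpos hW
  have h2 := not_pos_of_zero (W := fun s => -W s) (a := fun s => -a s) (a' := fun s => -a' s) hk ht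
    (fun s hs => (h.hasDerivAt_W s hs).fun_neg.congr_deriv (by ring))
    (fun s hs => (h.hasDerivAt_a s hs).fun_neg) h.continuousOn_a'.neg
    (fun s hs => by rw [neg_mul_neg]; exact hpos s hs) (by simp [hW])
  linarith

/-- Let D = (1 - t²)a' - (1 - α)W. Where W ≠ 0 this is (1 - α)γ²/W, and the swirl equation makes
D|W|^e conserved for a suitable e. At the zeros of W the function D vanishes because a' does.
Boundedness of the velocity gradient makes D small at the poles, so D = 0, and then γ = 0. -/
lemma deriv_radial (hα : 0 ≤ α) (hα1 : α < 1) :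
    ∀ t ∈ Ioo (-1 : ℝ) 1, (1 - t ^ 2) * a' t = (1 - α) * W t ∧ γ t = 0 := by
  have hM := h.nonneg_M
  have hδ : 0 < 1 - α := by linarith
  have hk : 0 < 2 - α := by linarith
  -- Where W ≠ 0, γ² is locally proportional to |W|^(2(1-α)/(2-α)). The exponent e is the complement
  -- of this power to 1, so that γ²|W|^e/W is locally constant.
  set e : ℝ := α / (2 - α) with he
  have he0 : 0 ≤ e := by positivity
  have hek : e * (2 - α) = α := by rw [he]; field_simp
  clear_value e
  have hD0 : ∀ t ∈ Ioo (-1 : ℝ) 1, W t = 0 → (1 - t ^ 2) * a' t - (1 - α) * W t = 0 := by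
    intro t ht hW
    rw [hW, h.deriv_eq_zero_of_polar_eq_zero hα hα1 ht hW]; ring
  have hF : ∀ t ∈ Ioo (-1 : ℝ) 1, ((1 - t ^ 2) * a' t - (1 - α) * W t) * |W t| ^ e = 0 := by
    refine eq_zero_of_hasDerivAt_zero (C := (√M + (1 - α) * √M) * M ^ (e / 2))
      (r := 1 / 2 + e / 2) ?_ (fun t ht hne => ?_) (by positivity) fun t ht => ?_
    · refine ContinuousOn.mul ?_ (h.continuousOn_W.abs.rpow_const fun _ _ => Or.inr he0)
      exact ((by fun_prop : Continuous fun t : ℝ => 1 - t ^ 2).continuousOn.mul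
        h.continuousOn_a').sub (continuousOn_const.mul h.continuousOn_W)
    · have hW0 : W t ≠ 0 := fun hW => hne (by rw [hD0 t ht hW, zero_mul])
      have h1 : HasDerivAt (fun s => (1 - α) * (γ s ^ 2 * |W s| ^ e / W s)) 0 t := by
        refine (((((h.hasDerivAt_γ t ht).fun_pow 2).fun_mul
          (hasDerivAt_abs_rpow_comp e (h.hasDerivAt_W t ht) hW0)).fun_div
          (h.hasDerivAt_W t ht) hW0).const_mul (1 - α)).congr_deriv ?_
        have h2 := h.swirl t ht
        have h3 : γ' t = -((1 - α) * a t * γ t) / W t := by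
          rw [eq_div_iff hW0]; linarith
        rw [h3]
        generalize |W t| ^ e = Y
        push_cast
        field_simp
        linear_combination ((α - 1) * Y * a t * γ t ^ 2) * hek
      refine h1.congr_of_eventuallyEq ?_
      filter_upwards [(h.hasDerivAt_W t ht).continuousAt.eventually_ne hW0,
        isOpen_Ioo.mem_nhds ht] with s hs hs'
      have h2 := h.polar_mul_deriv hα hα1 hs'
      have h3 : (1 - s ^ 2) * a' s - (1 - α) * W s = (1 - α) * γ s ^ 2 / W s := by
        rw [eq_div_iff hs]; linear_combination h2
      rw [h3]; ring
    · have h0 := one_sub_sq_pos ht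
      rw [abs_mul, abs_of_nonneg (by positivity : 0 ≤ |W t| ^ e), Real.rpow_add h0,
        mul_mul_mul_comm]
      have h1 : |(1 - t ^ 2) * a' t| ≤ √M * (1 - t ^ 2) ^ (1 / 2 : ℝ) := by
        rw [← Real.sqrt_eq_rpow, ← Real.sqrt_mul h.nonneg_M, ← Real.sqrt_sq_eq_abs]
        exact Real.sqrt_le_sqrt (h.sq_a'_le t ht)
      refine mul_le_mul ?_ (abs_rpow_le_of_sq_le hM h0.le he0 (h.sq_W_le t ht)) (by positivity)
        (by positivity)
      refine (abs_sub _ _).trans ?_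
      rw [abs_mul (1 - α), abs_of_pos hδ, add_mul, mul_assoc (1 - α)]
      exact add_le_add h1 (mul_le_mul_of_nonneg_left (h.abs_W_le ht) hδ.le)
  intro t ht
  have hD : (1 - t ^ 2) * a' t - (1 - α) * W t = 0 := by
    by_cases hW : W t = 0
    · exact hD0 t ht hW
    · exact (mul_eq_zero.1 (hF t ht)).resolve_right
        (Real.rpow_pos_of_pos (abs_pos.2 hW) e).ne'
  refine ⟨sub_eq_zero.1 hD, ?_⟩
  have h2 := h.polar_mul_deriv hα hα1 ht
  have h3 : (1 - α) * γ t ^ 2 = 0 := by linear_combination W t * hD - h2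
  exact pow_eq_zero_iff two_ne_zero |>.1 ((mul_eq_zero.1 h3).resolve_left hδ.ne')

/-- The polar velocity vanishes linearly at the axis. -/
lemma abs_W_le_linear (hα : α < 2) {t : ℝ} (ht : t ∈ Ioo (-1 : ℝ) 1) :
    |W t| ≤ (2 - α) * M * (1 - t ^ 2) := by
  have hk : 0 < 2 - α := by linarith
  have hM := h.nonneg_M
  have hlip : ∀ s ∈ Ioo (-1 : ℝ) 1, |W t - W s| ≤ (2 - α) * M * |t - s| := by
    intro s hs
    refine (convex_Ioo (-1 : ℝ) 1).norm_image_sub_le_of_norm_hasDerivWithin_le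
      (fun x hx => (h.hasDerivAt_W x hx).hasDerivWithinAt) (fun x hx => ?_) hs ht
    rw [Real.norm_eq_abs, abs_mul, abs_neg, abs_of_pos hk]
    exact mul_le_mul_of_nonneg_left (h.abs_a_le x hx) hk.le
  have hb : ∀ x ∈ Ioo (-1 : ℝ) 1, |W x| ≤ √M * (1 - x ^ 2) ^ (1 / 2 : ℝ) := fun x hx =>
    h.abs_W_le hx
  -- W is Lipschitz, since a is bounded, and tends to 0 at the poles. Letting the second point tend
  -- to the pole e bounds |W t| by a multiple of |t - e|; the nearer pole is used in the end.
  have key : ∀ (l : Filter ℝ) [l.NeBot] (e : ℝ), l ≤ 𝓝 e → Tendsto W l (𝓝 0) →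
      (∀ᶠ s in l, s ∈ Ioo (-1 : ℝ) 1) → |W t| ≤ (2 - α) * M * |t - e| := by
    intro l _ e hl hWl hmem
    have h1 : Tendsto (fun s => |W t - W s|) l (𝓝 |W t - 0|) :=
      (tendsto_const_nhds.sub hWl).abs
    have h2 : Tendsto (fun s => (2 - α) * M * |t - s|) l (𝓝 ((2 - α) * M * |t - e|)) :=
      (((by fun_prop : Continuous fun s : ℝ => (2 - α) * M * |t - s|).tendsto e)).mono_left hl
    rw [sub_zero] at h1
    exact le_of_tendsto_of_tendsto h1 h2 (hmem.mono hlip)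
  have hr := key (𝓝[<] 1) 1 nhdsWithin_le_nhds (tendsto_zero_right (by norm_num) hb)
    (Ioo_mem_nhdsLT (by norm_num))
  have hl := key (𝓝[>] (-1)) (-1) nhdsWithin_le_nhds (tendsto_zero_left (by norm_num) hb)
    (Ioo_mem_nhdsGT (by norm_num))
  rw [abs_of_neg (show t - 1 < 0 by linarith [ht.2])] at hr
  rw [abs_of_pos (show 0 < t - -1 by linarith [ht.1])] at hl
  have hkM : 0 ≤ (2 - α) * M := by positivity
  rcases le_total 0 t with h0 | h0
  · refine hr.trans (mul_le_mul_of_nonneg_left ?_ hkM)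
    nlinarith [ht.2]
  · refine hl.trans (mul_le_mul_of_nonneg_left ?_ hkM)
    nlinarith [ht.1]

/-- Now (1 - t²)W'' + (1 - α)(2 - α)W = 0. For α = 0 this is solved by 1 - t², and the proof
compares W with that solution. The function WW' + 2tW²/(1 - t²) is (1 - t²)²VV' for W = (1 - t²)V.
Its derivative is the displayed sum, hence nonnegative, and the linear decay of W makes it vanish at
both poles. -/
lemma sq_add_eq_zero (hα : 0 ≤ α) (hα1 : α < 1) {t : ℝ} (ht : t ∈ Ioo (-1 : ℝ) 1) :
    (-(2 - α) * a t + 2 * t * W t / (1 - t ^ 2)) ^ 2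
      + α * (3 - α) * (W t ^ 2 / (1 - t ^ 2)) = 0 := by
  have hk : 0 < 2 - α := by linarith
  have hM := h.nonneg_M
  refine (eq_zero_of_deriv_nonneg
    (f := fun t => -(2 - α) * a t * W t + 2 * t * W t ^ 2 / (1 - t ^ 2))
    (f' := fun t => (-(2 - α) * a t + 2 * t * W t / (1 - t ^ 2)) ^ 2
      + α * (3 - α) * (W t ^ 2 / (1 - t ^ 2))) (C := 3 * ((2 - α) * M) ^ 2) (r := 1)
    (fun t ht => ?_) (fun t ht => ?_) one_pos (fun t ht => ?_) t ht).2
  · have h0 := (one_sub_sq_pos ht).ne'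
    refine ((((h.hasDerivAt_a t ht).const_mul (-(2 - α))).fun_mul (h.hasDerivAt_W t ht)).fun_add
      ((((hasDerivAt_id' t).const_mul 2).fun_mul ((h.hasDerivAt_W t ht).fun_pow 2)).fun_div
        (hasDerivAt_one_sub_sq t) h0)).congr_deriv ?_
    have h1 : a' t = (1 - α) * W t / (1 - t ^ 2) := by
      rw [eq_div_iff h0, mul_comm]; exact (h.deriv_radial hα hα1 t ht).1
    rw [h1]
    push_cast
    field_simp
    ring
  · have h0 := one_sub_sq_pos ht
    have : 0 ≤ 3 - α := by linarith
    positivity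
  · have h0 := one_sub_sq_pos ht
    have h1 := h.abs_W_le_linear (by linarith) ht
    have h2 := h.abs_a_le t ht
    have h3 : |t| ≤ 1 := abs_le.2 ⟨ht.1.le, ht.2.le⟩
    rw [Real.rpow_one]
    have h4 : |-(2 - α) * a t * W t| ≤ ((2 - α) * M) ^ 2 * (1 - t ^ 2) := by
      rw [abs_mul, abs_mul, abs_neg, abs_of_pos hk, sq, mul_assoc ((2 - α) * M)]
      gcongr
    have h5 : |2 * t * W t ^ 2 / (1 - t ^ 2)| ≤ 2 * (((2 - α) * M) ^ 2 * (1 - t ^ 2)) := by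
      rw [abs_div, abs_of_pos h0, div_le_iff₀ h0, abs_mul, abs_mul, abs_two, abs_pow]
      calc 2 * |t| * |W t| ^ 2 ≤ 2 * 1 * ((2 - α) * M * (1 - t ^ 2)) ^ 2 := by gcongr
        _ = _ := by ring
    refine (abs_add_le _ _).trans ?_
    linarith

theorem eq_zero_of_lt_one (hα : 0 < α) (hα1 : α < 1) :
    ∀ t ∈ Ioo (-1 : ℝ) 1, W t = 0 ∧ a t = 0 ∧ γ t = 0 := by
  have hW : ∀ t ∈ Ioo (-1 : ℝ) 1, W t = 0 := by
    intro t ht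
    have h0 := one_sub_sq_pos ht
    have h1 := h.sq_add_eq_zero hα.le hα1 ht
    have h3 : 0 < α * (3 - α) := mul_pos hα (by linarith)
    have h4 : 0 ≤ W t ^ 2 / (1 - t ^ 2) := by positivity
    have h5 : W t ^ 2 / (1 - t ^ 2) = 0 := by
      nlinarith [sq_nonneg (-(2 - α) * a t + 2 * t * W t / (1 - t ^ 2))]
    rw [div_eq_zero_iff] at h5
    exact pow_eq_zero_iff two_ne_zero |>.1 (h5.resolve_right h0.ne')
  refine fun t ht => ⟨hW t ht, h.a_eq_zero_of_eventually (by linarith) ht ?_,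
    (h.deriv_radial hα.le hα1 t ht).2⟩
  filter_upwards [isOpen_Ioo.mem_nhds ht] with s hs using hW s hs

/-- Homogeneity `0`: the flow is uniform. -/
theorem exists_uniform_of_eq_zero (hα : α = 0) :
    ∃ c, ∀ t ∈ Ioo (-1 : ℝ) 1, W t = c * (1 - t ^ 2) ∧ a t = c * t ∧ γ t = 0 := by
  -- For α = 0 only the square remains. Its vanishing says that W/(1 - t²) has derivative zero.
  have h1 : ∀ t ∈ Ioo (-1 : ℝ) 1, a t = t * (W t / (1 - t ^ 2)) := by
    intro t ht
    have h2 := h.sq_add_eq_zero hα.ge (by linarith) ht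
    rw [hα] at h2
    have h3 := pow_eq_zero_iff two_ne_zero |>.1
      (show (-(2 - 0) * a t + 2 * t * W t / (1 - t ^ 2)) ^ 2 = 0 by linarith)
    rw [mul_div_assoc] at h3
    linarith
  have hd : ∀ t ∈ Ioo (-1 : ℝ) 1, HasDerivAt (fun t => W t / (1 - t ^ 2)) 0 t := by
    intro t ht
    have h0 := (one_sub_sq_pos ht).ne'
    refine ((h.hasDerivAt_W t ht).fun_div (hasDerivAt_one_sub_sq t) h0).congr_deriv ?_
    rw [h1 t ht, hα]
    field_simp
    ring
  obtain ⟨c, hc⟩ := exists_eq_const_of_hasDerivAt_zero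
    (fun t ht => (hd t ht).continuousAt.continuousWithinAt) fun t ht _ => hd t ht
  refine ⟨c, fun t ht => ⟨?_, ?_, (h.deriv_radial hα.ge (by linarith) t ht).2⟩⟩
  · rw [← hc t ht, div_mul_cancel₀ _ (one_sub_sq_pos ht).ne']
  · rw [h1 t ht, hc t ht, mul_comm]

end LessThanOne

end MeridianSystem

/-! ### Reduction to the meridian -/

/-- The rotation about the `x₃`-axis as a continuous linear map. -/
noncomputable def rotL (s : ℝ) : E3 →L[ℝ] E3 :=
  LinearMap.toContinuousLinearMap
    { toFun := rotZ s
      map_add' := fun x y => by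
        refine ext_E3 ?_ ?_ ?_ <;> simp [rotZ] <;> ring
      map_smul' := fun c x => by
        refine ext_E3 ?_ ?_ ?_ <;> simp [rotZ] <;> ring }

lemma rotL_apply (s : ℝ) (x : E3) : rotL s x = rotZ s x := rfl

/-- The generator of the rotations about the `x₃`-axis. -/
noncomputable def rotGen (x : E3) : E3 := !₂[-x 1, x 0, 0]

lemma hasDerivAt_E3 {f : ℝ → E3} {f' : E3} {t : ℝ} (h : ∀ i, HasDerivAt (fun s => f s i) (f' i) t) :
    HasDerivAt f f' t := by
  rw [hasDerivAt_iff_hasFDerivAt, ← hasFDerivWithinAt_univ, hasFDerivWithinAt_euclidean]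
  intro i
  rw [hasFDerivWithinAt_univ]
  refine (h i).hasFDerivAt.congr_fderiv ?_
  ext; simp

lemma HasDerivAt.coord {f : ℝ → E3} {f' : E3} {t : ℝ} (h : HasDerivAt f f' t) (i : Fin 3) :
    HasDerivAt (fun s => f s i) (f' i) t :=
  (coordL i).hasFDerivAt.comp_hasDerivAt t h

lemma hasDerivAt_rotZ (x : E3) (s : ℝ) : HasDerivAt (fun s => rotZ s x) (rotGen (rotZ s x)) s := by
  refine hasDerivAt_E3 fun i => ?_
  have hc := Real.hasDerivAt_cos s
  have hs := Real.hasDerivAt_sin s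
  fin_cases i
  · exact ((hc.mul_const (x 0)).fun_sub (hs.mul_const (x 1))).congr_deriv (by
      simp [rotGen, rotZ]; ring)
  · exact ((hs.mul_const (x 0)).fun_add (hc.mul_const (x 1))).congr_deriv (by
      simp [rotGen, rotZ]; ring)
  · exact (hasDerivAt_const s (x 2)).congr_deriv (by simp [rotGen])

lemma rotZ_zero_angle (x : E3) : rotZ 0 x = x := by
  refine ext_E3 ?_ ?_ ?_ <;> simp [rotZ]

lemma rotZ_ne_zero {x : E3} (hx : x ≠ 0) (s : ℝ) : rotZ s x ≠ 0 := by
  rw [← norm_ne_zero_iff, norm_rotZ]; exact norm_ne_zero_iff.2 hx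

lemma rotZ_two_pi (x : E3) : rotZ (2 * Real.pi) x = x := by
  refine ext_E3 ?_ ?_ ?_ <;> simp [rotZ]

lemma inner_rotZ (s : ℝ) (x y : E3) : inner ℝ (rotZ s x) (rotZ s y) = inner ℝ x y := by
  rw [inner_E3, inner_E3]
  simp [rotZ]
  linear_combination (x 0 * y 0 + x 1 * y 1) * Real.sin_sq_add_cos_sq s

lemma rotGen_rotZ (s : ℝ) (x : E3) : rotGen (rotZ s x) = rotZ s (rotGen x) := by
  refine ext_E3 ?_ ?_ ?_ <;> simp [rotZ, rotGen] <;> ring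

lemma clm_apply_E3 (A : E3 →L[ℝ] E3) (v : E3) (i : Fin 3) :
    A v i = ∑ j, v j * A (EuclideanSpace.single j 1) i := by
  have hv : v = ∑ j, v j • EuclideanSpace.single j (1 : ℝ) := by
    refine ext_E3 ?_ ?_ ?_ <;> simp [Fin.sum_univ_three]
  conv_lhs => rw [hv]
  rw [map_sum]
  simp [Fin.sum_univ_three]

lemma clm_apply_E3_real (A : E3 →L[ℝ] ℝ) (v : E3) :
    A v = ∑ j, v j * A (EuclideanSpace.single j 1) := by
  have hv : v = ∑ j, v j • EuclideanSpace.single j (1 : ℝ) := by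
    refine ext_E3 ?_ ?_ ?_ <;> simp [Fin.sum_univ_three]
  conv_lhs => rw [hv]
  rw [map_sum]
  simp

lemma pd_component {u : E3 → E3} {A : E3 →L[ℝ] E3} {x : E3} (h : HasFDerivAt u A x) (i j : Fin 3) :
    pd j (fun y => u y i) x = A (EuclideanSpace.single j 1) i := by
  have h1 : HasFDerivAt (fun y => u y i) ((coordL i).comp A) x :=
    (coordL i).hasFDerivAt.comp x h
  rw [pd_eq h1]
  rfl

/-! ### Infinitesimal homogeneity and axial symmetry -/

section Identities

variable {α : ℝ} {u : E3 → E3} {p : E3 → ℝ}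

lemma fderiv_self_of_homogeneous (h : Homogeneous α punctured u p) {x : E3} (hx : x ≠ 0)
    {A : E3 →L[ℝ] E3} (hA : HasFDerivAt u A x) : A x = -α • u x := by
  have h1 : HasDerivAt (fun c : ℝ => c • x) x 1 := by
    simpa using (hasDerivAt_id (1 : ℝ)).smul_const x
  have h2 : HasDerivAt (fun c : ℝ => u (c • x)) (A x) 1 := by
    have hA' : HasFDerivAt u A ((1 : ℝ) • x) := by rwa [one_smul]
    exact hA'.comp_hasDerivAt 1 h1
  have h3 : HasDerivAt (fun c : ℝ => c ^ (-α) • u x) (-α • u x) 1 := by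
    simpa using (Real.hasDerivAt_rpow_const (p := -α) (Or.inl one_ne_zero)).smul_const (u x)
  refine h2.unique (h3.congr_of_eventuallyEq ?_)
  filter_upwards [lt_mem_nhds (zero_lt_one' ℝ)] with c hc
  rw [(h c hc x hx).1, smul_smul, ← Real.rpow_add hc, neg_add_cancel, Real.rpow_zero, one_smul]

lemma fderiv_pressure_self_of_homogeneous (h : Homogeneous α punctured u p) {x : E3} (hx : x ≠ 0)
    {B : E3 →L[ℝ] ℝ} (hB : HasFDerivAt p B x) : B x = -(2 * α) * p x := by
  have h1 : HasDerivAt (fun c : ℝ => c • x) x 1 := by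
    simpa using (hasDerivAt_id (1 : ℝ)).smul_const x
  have h2 : HasDerivAt (fun c : ℝ => p (c • x)) (B x) 1 := by
    have hB' : HasFDerivAt p B ((1 : ℝ) • x) := by rwa [one_smul]
    exact hB'.comp_hasDerivAt 1 h1
  have h3 : HasDerivAt (fun c : ℝ => c ^ (-(2 * α)) * p x) (-(2 * α) * p x) 1 := by
    simpa using (Real.hasDerivAt_rpow_const (p := -(2 * α)) (Or.inl one_ne_zero)).mul_const (p x)
  refine h2.unique (h3.congr_of_eventuallyEq ?_)
  filter_upwards [lt_mem_nhds (zero_lt_one' ℝ)] with c hc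
  rw [(h c hc x hx).2, ← mul_assoc, ← Real.rpow_add hc, neg_add_cancel, Real.rpow_zero, one_mul]

lemma fderiv_rotGen_of_axisymmetric (h : Axisymmetric punctured u) {x : E3} (hx : x ≠ 0)
    {A : E3 →L[ℝ] E3} (hA : HasFDerivAt u A x) : A (rotGen x) = rotGen (u x) := by
  have h1 := hasDerivAt_rotZ x 0
  have h2 := hasDerivAt_rotZ (u x) 0
  rw [rotZ_zero_angle] at h1 h2
  have h3 : HasDerivAt (fun s => u (rotZ s x)) (A (rotGen x)) 0 := by
    have hA' : HasFDerivAt u A (rotZ 0 x) := by rwa [rotZ_zero_angle]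
    exact hA'.comp_hasDerivAt 0 h1
  refine h3.unique (h2.congr_of_eventuallyEq (Eventually.of_forall fun s => ?_))
  exact h s x hx

lemma fderiv_rotZ_of_axisymmetric (h : Axisymmetric punctured u) {x : E3} (hx : x ≠ 0) (s : ℝ)
    (v : E3) {A A' : E3 →L[ℝ] E3} (hA : HasFDerivAt u A x) (hA' : HasFDerivAt u A' (rotZ s x)) :
    A' (rotZ s v) = rotZ s (A v) := by
  have h1 : HasFDerivAt (fun y => u (rotL s y)) (A'.comp (rotL s)) x :=
    HasFDerivAt.comp x (f := rotL s) hA' (rotL s).hasFDerivAt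
  have h2 : HasFDerivAt (fun y => rotL s (u y)) ((rotL s).comp A) x :=
    (rotL s).hasFDerivAt.comp x hA
  have h3 := h1.unique (h2.congr_of_eventuallyEq (by
    filter_upwards [isOpen_punctured.mem_nhds hx] with y hy using h s y hy))
  exact DFunLike.congr_fun h3 v

lemma euler_inner (h : EulerClassical punctured u p) {x : E3} (hx : x ≠ 0)
    {A : E3 →L[ℝ] E3} {B : E3 →L[ℝ] ℝ} (hA : HasFDerivAt u A x) (hB : HasFDerivAt p B x) (v : E3) :
    inner ℝ (A (u x)) v + B v = 0 := by
  have h1 := (h x hx).1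
  rw [inner_E3, clm_apply_E3_real B v, Fin.sum_univ_three]
  have h2 : ∀ i, A (u x) i + B (EuclideanSpace.single i 1) = 0 := by
    intro i
    rw [clm_apply_E3, ← h1 i, pd_eq hB]
    simp only [pd_component hA]
  linear_combination v 0 * h2 0 + v 1 * h2 1 + v 2 * h2 2

end Identities

namespace PuncturedSolution

variable {α : ℝ} {u : E3 → E3} {p : E3 → ℝ} (h : PuncturedSolution 1 α u p)
include h

lemma hasFDerivAt_velocity {x : E3} (hx : x ≠ 0) : HasFDerivAt u (fderiv ℝ u x) x :=
  ((h.contDiffOn_velocity.differentiableOn one_ne_zero).differentiableAt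
    (isOpen_punctured.mem_nhds hx)).hasFDerivAt

lemma hasFDerivAt_pressure {x : E3} (hx : x ≠ 0) : HasFDerivAt p (fderiv ℝ p x) x :=
  ((h.contDiffOn_pressure.differentiableOn one_ne_zero).differentiableAt
    (isOpen_punctured.mem_nhds hx)).hasFDerivAt

/-- The pressure is axisymmetric: its derivative along a circle is constant and the pressure is
periodic. -/
lemma fderiv_pressure_rotGen {x : E3} (hx : x ≠ 0) : fderiv ℝ p x (rotGen x) = 0 := by
  set c := fderiv ℝ p x (rotGen x) with hc
  have hd : ∀ s, HasDerivAt (fun s => p (rotZ s x)) c s := by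
    intro s
    have hx' := rotZ_ne_zero hx s
    refine ((h.hasFDerivAt_pressure hx').comp_hasDerivAt s (hasDerivAt_rotZ x s)).congr_deriv ?_
    -- The momentum equation expresses the derivative of p along the circle through u · ∇u, which
    -- commutes with rotations. Symmetry of the pressure is thus derived, not assumed.
    have h1 := euler_inner h.euler hx' (h.hasFDerivAt_velocity hx') (h.hasFDerivAt_pressure hx')
      (rotGen (rotZ s x))
    have h2 := euler_inner h.euler hx (h.hasFDerivAt_velocity hx) (h.hasFDerivAt_pressure hx)
      (rotGen x)
    rw [h.axisymmetric s x hx, fderiv_rotZ_of_axisymmetric h.axisymmetric hx s (u x)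
      (h.hasFDerivAt_velocity hx) (h.hasFDerivAt_velocity hx'), rotGen_rotZ, inner_rotZ] at h1
    rw [rotGen_rotZ]
    linarith
  have h1 : ∀ s, HasDerivAt (fun s => p (rotZ s x) - c * s) 0 s := fun s =>
    ((hd s).fun_sub ((hasDerivAt_id' s).const_mul c)).congr_deriv (by ring)
  have h2 := is_const_of_deriv_eq_zero (fun s => (h1 s).differentiableAt)
    (fun s => (h1 s).deriv) 0 (2 * Real.pi)
  rw [rotZ_two_pi, rotZ_zero_angle] at h2
  have h3 : c * (2 * Real.pi) = 0 := by linarith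
  exact (mul_eq_zero.1 h3).resolve_right (by positivity)

end PuncturedSolution

/-! ### The meridian system of a solution -/

/-- The velocity of the curve `meridian`. -/
noncomputable def meridianDeriv (t : ℝ) : E3 := !₂[-t / √(1 - t ^ 2), 0, 1]

lemma hasDerivAt_sqrt_one_sub_sq {t : ℝ} (ht : t ∈ Ioo (-1 : ℝ) 1) :
    HasDerivAt (fun t : ℝ => √(1 - t ^ 2)) (-t / √(1 - t ^ 2)) t := by
  have h0 := one_sub_sq_pos ht
  refine ((hasDerivAt_one_sub_sq t).sqrt h0.ne').congr_deriv ?_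
  have := (Real.sqrt_pos.2 h0).ne'
  field_simp

lemma hasDerivAt_meridian {t : ℝ} (ht : t ∈ Ioo (-1 : ℝ) 1) :
    HasDerivAt meridian (meridianDeriv t) t := by
  refine hasDerivAt_E3 fun i => ?_
  fin_cases i
  · exact hasDerivAt_sqrt_one_sub_sq ht
  · exact hasDerivAt_const t 0
  · exact hasDerivAt_id' t

namespace PuncturedSolution

variable {α : ℝ} {u : E3 → E3} {p : E3 → ℝ} (h : PuncturedSolution 1 α u p)
include h

lemma exists_bound : ∃ C, 0 ≤ C ∧ ∀ x : E3, ‖x‖ = 1 → ‖u x‖ ≤ C ∧ |p x| ≤ C ∧ ‖fderiv ℝ u x‖ ≤ C := by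
  have hK : IsCompact (Metric.sphere (0 : E3) 1) := isCompact_sphere _ _
  have hsub : Metric.sphere (0 : E3) 1 ⊆ punctured := fun x hx => by
    have : ‖x‖ = 1 := by simpa using hx
    exact norm_ne_zero_iff.1 (by rw [this]; exact one_ne_zero)
  obtain ⟨C1, h1⟩ := hK.exists_bound_of_continuousOn (h.contDiffOn_velocity.continuousOn.mono hsub)
  obtain ⟨C2, h2⟩ := hK.exists_bound_of_continuousOn (h.contDiffOn_pressure.continuousOn.mono hsub)
  obtain ⟨C3, h3⟩ := hK.exists_bound_of_continuousOn
    ((h.contDiffOn_velocity.continuousOn_fderiv_of_isOpen isOpen_punctured le_rfl).mono hsub)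
  refine ⟨max 0 (max C1 (max C2 C3)), le_max_left _ _, fun x hx => ?_⟩
  have hx' : x ∈ Metric.sphere (0 : E3) 1 := by simpa using hx
  refine ⟨(h1 x hx').trans ?_, (h2 x hx').trans ?_, (h3 x hx').trans ?_⟩ <;> simp

/-- The algebraic relations between the values and the derivatives of a solution along the
meridian. -/
lemma meridian_relations {t : ℝ} (ht : t ∈ Ioo (-1 : ℝ) 1) {s : ℝ} (hs : s = √(1 - t ^ 2))
    {v X : E3} (hv : v = u (meridian t)) (hX : X = fderiv ℝ u (meridian t) (meridianDeriv t))
    {P Y : ℝ} (hP : P = p (meridian t)) (hY : Y = fderiv ℝ p (meridian t) (meridianDeriv t)) :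
    (-α * s * v 0 - t * s * X 0 + v 0 / s - α * t * v 2 + s ^ 2 * X 2 = 0) ∧
    ((-α * s * v 0 - t * s * X 0) * v 0 - v 1 ^ 2 / s + (-α * t * v 0 + s ^ 2 * X 0) * v 2
      + (-2 * α * P * s - t * s * Y) = 0) ∧
    ((-α * s * v 1 - t * s * X 1) * v 0 + v 0 * v 1 / s + (-α * t * v 1 + s ^ 2 * X 1) * v 2 = 0) ∧
    ((-α * s * v 2 - t * s * X 2) * v 0 + (-α * t * v 2 + s ^ 2 * X 2) * v 2
      + (-2 * α * P * t + s ^ 2 * Y) = 0) := by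
  have h0 := one_sub_sq_pos ht
  have hs0 : 0 < s := hs ▸ Real.sqrt_pos.2 h0
  have hs2 : s ^ 2 = 1 - t ^ 2 := by rw [hs]; exact Real.sq_sqrt h0.le
  have hx := meridian_ne_zero (Ioo_subset_Icc_self ht)
  have hA := h.hasFDerivAt_velocity hx
  have hB := h.hasFDerivAt_pressure hx
  have m0 : meridian t 0 = s := hs.symm
  have m1 : meridian t 1 = 0 := rfl
  have m2 : meridian t 2 = t := rfl
  have d0 : meridianDeriv t 0 = -t / s := by rw [hs]; rfl
  have d1 : meridianDeriv t 1 = 0 := rfl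
  have d2 : meridianDeriv t 2 = 1 := rfl
  have hdiv := (h.euler _ hx).2
  have hE := fun i => (h.euler _ hx).1 i
  have hself := fderiv_self_of_homogeneous h.homogeneous hx hA
  have hrot := fderiv_rotGen_of_axisymmetric h.axisymmetric hx hA
  have hpself := fderiv_pressure_self_of_homogeneous h.homogeneous hx hB
  have hprot := h.fderiv_pressure_rotGen hx
  have r0 : rotGen (meridian t) 0 = 0 := by simp [rotGen, m1]
  have r1 : rotGen (meridian t) 1 = s := m0
  have r2 : rotGen (meridian t) 2 = 0 := rfl
  unfold divergence at hdiv
  simp only [pd_component hA, pd_eq hB, Fin.sum_univ_three, ← hv] at hdiv hE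
  have hself' := fun i => congrArg (fun w : E3 => w i) hself
  have hrot' := fun i => congrArg (fun w : E3 => w i) hrot
  have hX' := fun i => congrArg (fun w : E3 => w i) hX
  simp only [clm_apply_E3 _ (meridian t), clm_apply_E3 _ (rotGen (meridian t)),
    clm_apply_E3 _ (meridianDeriv t), Fin.sum_univ_three, m0, m1, m2, d0, d1, d2, r0, r1, r2,
    ← hv, PiLp.smul_apply, smul_eq_mul] at hself' hrot' hX'
  rw [clm_apply_E3_real, Fin.sum_univ_three] at hpself hprot hY
  simp only [m0, m1, m2, d0, d1, d2, r0, r1, r2, ← hP] at hpself hprot hY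
  generalize fderiv ℝ u (meridian t) = A at *
  generalize fderiv ℝ p (meridian t) = B at *
  have q0 : rotGen v 0 = -v 1 := rfl
  have q1 : rotGen v 1 = v 0 := rfl
  have q2 : rotGen v 2 = 0 := rfl
  have hs0' := hs0.ne'
  -- The Jacobian is known along three independent directions: radially by homogeneity, azimuthally
  -- by axial symmetry, and along the meridian by X. Solving for its columns uses s² + t² = 1. The
  -- same is done for ∇p.
  have A1 : ∀ i, A (EuclideanSpace.single 1 1) i = rotGen v i / s := by
    intro i; rw [eq_div_iff hs0']; linear_combination hrot' i
  have A0 : ∀ i, A (EuclideanSpace.single 0 1) i = -α * s * v i - t * s * X i := by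
    intro i
    have e1 := hX' i
    field_simp at e1
    linear_combination s * hself' i + t * e1 - A (EuclideanSpace.single 0 1) i * hs2
  have A2 : ∀ i, A (EuclideanSpace.single 2 1) i = -α * t * v i + s ^ 2 * X i := by
    intro i
    have e1 := hX' i
    field_simp at e1
    linear_combination t * hself' i - s * e1 - A (EuclideanSpace.single 2 1) i * hs2
  have B1 : B (EuclideanSpace.single 1 1) = 0 := by
    have : s * B (EuclideanSpace.single 1 1) = 0 := by linarith
    exact (mul_eq_zero.1 this).resolve_left hs0'
  field_simp at hY
  have B0 : B (EuclideanSpace.single 0 1) = -2 * α * P * s - t * s * Y := by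
    linear_combination s * hpself + t * hY - B (EuclideanSpace.single 0 1) * hs2
  have B2 : B (EuclideanSpace.single 2 1) = -2 * α * P * t + s ^ 2 * Y := by
    linear_combination t * hpself - s * hY - B (EuclideanSpace.single 2 1) * hs2
  have hE0 := hE 0
  have hE1 := hE 1
  have hE2 := hE 2
  rw [A0, A1, A2, q0, B0] at hE0
  rw [A0, A1, A2, q1, B1] at hE1
  rw [A0, A1, A2, q2, B2] at hE2
  rw [A0, A1, A2, q1] at hdiv
  refine ⟨?_, ?_, ?_, ?_⟩
  · linear_combination hdiv
  · linear_combination hE0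
  · linear_combination hE1
  · linear_combination hE2

end PuncturedSolution

lemma continuousOn_meridianDeriv : ContinuousOn meridianDeriv (Ioo (-1) 1) := by
  refine (PiLp.continuous_toLp 2 _).comp_continuousOn (continuousOn_pi.2 fun i => ?_)
  fin_cases i
  · refine ContinuousOn.div (by fun_prop) (by fun_prop) fun t ht => ?_
    exact (Real.sqrt_pos.2 (one_sub_sq_pos ht)).ne'
  · exact continuousOn_const
  · exact continuousOn_const

lemma norm_sqrt_smul_meridianDeriv {t : ℝ} (ht : t ∈ Ioo (-1 : ℝ) 1) :
    ‖√(1 - t ^ 2) • meridianDeriv t‖ = 1 := by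
  have h0 := one_sub_sq_pos ht
  have h1 := (Real.sqrt_pos.2 h0).ne'
  have h2 : √(1 - t ^ 2) * (-t / √(1 - t ^ 2)) = -t := by field_simp
  have h3 := Real.sq_sqrt h0.le
  rw [← sq_eq_sq₀ (norm_nonneg _) zero_le_one, norm_sq_E3]
  simp only [meridianDeriv, PiLp.smul_apply, smul_eq_mul, Matrix.cons_val_zero, Matrix.cons_val_one,
    Matrix.cons_val, mul_zero, mul_one]
  rw [h2, h3]
  ring

/-! ### From Cartesian to polar components on the meridian -/

section Algebra

variable {α s t v₀ v₁ v₂ X₀ X₁ X₂ P Y : ℝ}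

lemma polar_deriv_identity (hs : s ≠ 0) (h2 : s ^ 2 = 1 - t ^ 2)
    (h : -α * s * v₀ - t * s * X₀ + v₀ / s - α * t * v₂ + s ^ 2 * X₂ = 0) :
    -t / s * (-(t * v₀) + s * v₂) + s * (-(v₀ + t * X₀) + (-t / s * v₂ + s * X₂)) =
      -(2 - α) * (s * v₀ + t * v₂) := by
  field_simp at h ⊢
  grind

lemma radial_identity (hs : s ≠ 0) (h2 : s ^ 2 = 1 - t ^ 2)
    (h : (-α * s * v₀ - t * s * X₀) * v₀ - v₁ ^ 2 / s + (-α * t * v₀ + s ^ 2 * X₀) * v₂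
      + (-2 * α * P * s - t * s * Y) = 0)
    (h' : (-α * s * v₂ - t * s * X₂) * v₀ + (-α * t * v₂ + s ^ 2 * X₂) * v₂
      + (-2 * α * P * t + s ^ 2 * Y) = 0) :
    (s * (-(t * v₀) + s * v₂)) * (-t / s * v₀ + s * X₀ + (v₂ + t * X₂))
      - α * (s * v₀ + t * v₂) ^ 2
      - ((s * (-(t * v₀) + s * v₂)) ^ 2 + (s * v₁) ^ 2) / s ^ 2 - 2 * α * P = 0 := by
  field_simp at h h' ⊢
  grind

lemma swirl_identity (hs : s ≠ 0) (h2 : s ^ 2 = 1 - t ^ 2)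
    (h : (-α * s * v₁ - t * s * X₁) * v₀ + v₀ * v₁ / s + (-α * t * v₁ + s ^ 2 * X₁) * v₂ = 0) :
    (s * (-(t * v₀) + s * v₂)) * (-t / s * v₁ + s * X₁)
      + (1 - α) * (s * v₀ + t * v₂) * (s * v₁) = 0 := by
  field_simp at h ⊢
  grind

lemma polar_identity (hs : s ≠ 0) (h2 : s ^ 2 = 1 - t ^ 2)
    (h : -α * s * v₀ - t * s * X₀ + v₀ / s - α * t * v₂ + s ^ 2 * X₂ = 0)
    (h' : (-α * s * v₀ - t * s * X₀) * v₀ - v₁ ^ 2 / s + (-α * t * v₀ + s ^ 2 * X₀) * v₂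
      + (-2 * α * P * s - t * s * Y) = 0)
    (h'' : (-α * s * v₂ - t * s * X₂) * v₀ + (-α * t * v₂ + s ^ 2 * X₂) * v₂
      + (-2 * α * P * t + s ^ 2 * Y) = 0) :
    Y - (s * v₀ + t * v₂) * (s * (-(t * v₀) + s * v₂)) / s ^ 2
      + t * ((s * (-(t * v₀) + s * v₂)) ^ 2 + (s * v₁) ^ 2) / (s ^ 2) ^ 2 = 0 := by
  field_simp at h h' h'' ⊢
  grind

end Algebra

namespace PuncturedSolution

variable {α : ℝ} {u : E3 → E3} {p : E3 → ℝ} (h : PuncturedSolution 1 α u p)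
include h

theorem exists_meridianSystem : ∃ M a' γ' P', MeridianSystem α M
    (fun t => √(1 - t ^ 2) * u (meridian t) 0 + t * u (meridian t) 2) a'
    (fun t => √(1 - t ^ 2) * (-(t * u (meridian t) 0) + √(1 - t ^ 2) * u (meridian t) 2))
    (fun t => √(1 - t ^ 2) * u (meridian t) 1) γ' (fun t => p (meridian t)) P' := by
  obtain ⟨C, hC, hb⟩ := h.exists_bound
  set X : ℝ → E3 := fun t => fderiv ℝ u (meridian t) (meridianDeriv t) with hX
  set Y : ℝ → ℝ := fun t => fderiv ℝ p (meridian t) (meridianDeriv t) with hY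
  have hne : ∀ t ∈ Ioo (-1 : ℝ) 1, meridian t ≠ 0 := fun t ht =>
    meridian_ne_zero (Ioo_subset_Icc_self ht)
  have hu : ∀ t ∈ Ioo (-1 : ℝ) 1, ∀ i, HasDerivAt (fun t => u (meridian t) i) (X t i) t :=
    fun t ht => HasDerivAt.coord ((h.hasFDerivAt_velocity (hne t ht)).comp_hasDerivAt t
      (hasDerivAt_meridian ht))
  have hs := fun t ht => hasDerivAt_sqrt_one_sub_sq (t := t) ht
  have hs0 : ∀ t ∈ Ioo (-1 : ℝ) 1, √(1 - t ^ 2) ≠ 0 := fun t ht =>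
    (Real.sqrt_pos.2 (one_sub_sq_pos ht)).ne'
  have hs2 : ∀ t ∈ Ioo (-1 : ℝ) 1, √(1 - t ^ 2) ^ 2 = 1 - t ^ 2 := fun t ht =>
    Real.sq_sqrt (one_sub_sq_pos ht).le
  have hrel := fun t (ht : t ∈ Ioo (-1 : ℝ) 1) => h.meridian_relations ht rfl
    (v := u (meridian t)) rfl (X := X t) rfl (P := p (meridian t)) rfl (Y := Y t) rfl
  have hmc : ContinuousOn meridian (Ioo (-1) 1) := fun t ht =>
    (hasDerivAt_meridian ht).continuousAt.continuousWithinAt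
  have hXc : ContinuousOn X (Ioo (-1) 1) :=
    ((h.contDiffOn_velocity.continuousOn_fderiv_of_isOpen isOpen_punctured le_rfl).comp hmc
      hne).clm_apply continuousOn_meridianDeriv
  have hXi : ∀ i, ContinuousOn (fun t => X t i) (Ioo (-1) 1) := fun i =>
    (coordL i).continuous.comp_continuousOn hXc
  have hui : ∀ i, ContinuousOn (fun t => u (meridian t) i) (Ioo (-1) 1) := fun i t ht =>
    (hu t ht i).continuousAt.continuousWithinAt
  have hsc : ContinuousOn (fun t : ℝ => √(1 - t ^ 2)) (Ioo (-1) 1) := by fun_prop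
  have hub : ∀ t ∈ Ioo (-1 : ℝ) 1, ∀ i, |u (meridian t) i| ≤ C := fun t ht i =>
    (PiLp.norm_apply_le (u (meridian t)) i).trans
      (hb _ (norm_meridian (Ioo_subset_Icc_self ht))).1
  -- The parameter t has unbounded speed at the poles; multiplied by √(1 - t²), the tangent becomes
  -- a unit vector.
  have hXb : ∀ t ∈ Ioo (-1 : ℝ) 1, ∀ i, |√(1 - t ^ 2) * X t i| ≤ C := by
    intro t ht i
    have h1 : √(1 - t ^ 2) * X t i =
        (fderiv ℝ u (meridian t) (√(1 - t ^ 2) • meridianDeriv t)) i := by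
      rw [map_smul]; rfl
    rw [h1]
    refine (PiLp.norm_apply_le _ i).trans
      (((fderiv ℝ u (meridian t)).le_opNorm (√(1 - t ^ 2) • meridianDeriv t)).trans ?_)
    rw [norm_sqrt_smul_meridianDeriv ht, mul_one]
    exact (hb _ (norm_meridian (Ioo_subset_Icc_self ht))).2.2
  have hs1 : ∀ t ∈ Ioo (-1 : ℝ) 1, |√(1 - t ^ 2)| ≤ 1 := fun t ht => by
    rw [abs_of_nonneg (Real.sqrt_nonneg _), Real.sqrt_le_one]
    linarith [sq_nonneg t]
  have ht1 : ∀ t ∈ Ioo (-1 : ℝ) 1, |t| ≤ 1 := fun t ht => abs_le.2 ⟨ht.1.le, ht.2.le⟩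
  have hmul : ∀ {x y : ℝ}, |x| ≤ 1 → |y| ≤ C → |x * y| ≤ C := fun {x y} hx hy => by
    rw [abs_mul]
    calc |x| * |y| ≤ 1 * C := mul_le_mul hx hy (abs_nonneg y) zero_le_one
      _ = C := one_mul C
  have hsq : ∀ {y N z : ℝ}, |y| ≤ N → N ^ 2 ≤ 16 * C ^ 2 → 0 ≤ z →
      z * y ^ 2 ≤ (2 * C + 16 * C ^ 2) * z := fun {y N z} hy hN hz => by
    have h1 : y ^ 2 ≤ N ^ 2 := by
      rw [← sq_abs]; exact pow_le_pow_left₀ (abs_nonneg y) hy 2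
    rw [mul_comm]
    exact mul_le_mul_of_nonneg_right (by linarith) hz
  -- The term 2C covers the linear bounds, and 16C² covers squares of sums of at most four terms
  -- bounded by C.
  refine ⟨2 * C + 16 * C ^ 2,
    fun t => -t / √(1 - t ^ 2) * u (meridian t) 0 + √(1 - t ^ 2) * X t 0
      + (u (meridian t) 2 + t * X t 2),
    fun t => -t / √(1 - t ^ 2) * u (meridian t) 1 + √(1 - t ^ 2) * X t 1, Y, ?_⟩
  constructor
  · intro t ht
    refine (((hs t ht).fun_mul (hu t ht 0)).fun_add
      ((hasDerivAt_id' t).fun_mul (hu t ht 2))).congr_deriv (by ring)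
  · intro t ht
    refine ((hs t ht).fun_mul ((((hasDerivAt_id' t).fun_mul (hu t ht 0)).fun_neg).fun_add
      ((hs t ht).fun_mul (hu t ht 2)))).congr_deriv ?_
    rw [← polar_deriv_identity (hs0 t ht) (hs2 t ht) (hrel t ht).1, one_mul]
  · exact fun t ht => (hs t ht).fun_mul (hu t ht 1)
  · exact fun t ht => (h.hasFDerivAt_pressure (hne t ht)).comp_hasDerivAt t
      (hasDerivAt_meridian ht)
  · exact (((continuousOn_id.neg.div hsc hs0).mul (hui 0)).add (hsc.mul (hXi 0))).add
      ((hui 2).add (continuousOn_id.mul (hXi 2)))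
  · intro t ht
    have h1 := radial_identity (hs0 t ht) (hs2 t ht) (hrel t ht).2.1 (hrel t ht).2.2.2
    rw [← hs2 t ht] at *
    simpa only [Real.sqrt_sq (Real.sqrt_nonneg _)] using h1
  · intro t ht
    exact swirl_identity (hs0 t ht) (hs2 t ht) (hrel t ht).2.2.1
  · intro t ht
    have h1 := polar_identity (hs0 t ht) (hs2 t ht) (hrel t ht).1 (hrel t ht).2.1
      (hrel t ht).2.2.2
    rw [← hs2 t ht] at *
    simpa only [Real.sqrt_sq (Real.sqrt_nonneg _)] using h1
  · positivity
  · intro t ht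
    refine (abs_add_le _ _).trans ?_
    have h1 := hmul (hs1 t ht) (hub t ht 0)
    have h2 := hmul (ht1 t ht) (hub t ht 2)
    nlinarith [sq_nonneg C]
  · intro t ht
    have h1 := (hb _ (norm_meridian (Ioo_subset_Icc_self ht))).2.1
    refine h1.trans ?_
    nlinarith [sq_nonneg C]
  · intro t ht
    rw [mul_pow, hs2 t ht]
    refine hsq (N := 2 * C) ((abs_add_le _ _).trans ?_) (by nlinarith [sq_nonneg C])
      (one_sub_sq_pos ht).le
    rw [abs_neg]
    linarith [hmul (ht1 t ht) (hub t ht 0), hmul (hs1 t ht) (hub t ht 2)]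
  · intro t ht
    rw [mul_pow, hs2 t ht]
    exact hsq (hub t ht 1) (by nlinarith [sq_nonneg C]) (one_sub_sq_pos ht).le
  · intro t ht
    have h0 := hs0 t ht
    have h1 : (1 - t ^ 2) * (-t / √(1 - t ^ 2) * u (meridian t) 0 + √(1 - t ^ 2) * X t 0
        + (u (meridian t) 2 + t * X t 2)) = √(1 - t ^ 2) * (-(t * u (meridian t) 0)
        + √(1 - t ^ 2) * (√(1 - t ^ 2) * X t 0) + (√(1 - t ^ 2) * u (meridian t) 2
        + t * (√(1 - t ^ 2) * X t 2))) := by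
      have h2 := hs2 t ht
      generalize √(1 - t ^ 2) = s at *
      rw [← h2]
      field_simp
    rw [h1, mul_pow, hs2 t ht]
    refine hsq (N := 4 * C) ?_ (by nlinarith [sq_nonneg C]) (one_sub_sq_pos ht).le
    refine (abs_add_le _ _).trans (le_trans (add_le_add (abs_add_le _ _) (abs_add_le _ _)) ?_)
    rw [abs_neg]
    linarith [hmul (ht1 t ht) (hub t ht 0), hmul (hs1 t ht) (hub t ht 2),
      hmul (hs1 t ht) (hXb t ht 0), hmul (ht1 t ht) (hXb t ht 2)]

end PuncturedSolution

/-! ### Nonexistence -/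

lemma exists_rotZ_meridian {x : E3} (hx : x ∈ offAxis) :
    0 < ‖x‖ ∧ ∃ t ∈ Ioo (-1 : ℝ) 1, ∃ s, x = ‖x‖ • rotZ s (meridian t) := by
  have hr : 0 < cylRadius x := lt_of_le_of_ne (Real.sqrt_nonneg _) (Ne.symm hx)
  have hr2 : cylRadius x ^ 2 = x 0 ^ 2 + x 1 ^ 2 := Real.sq_sqrt (by positivity)
  have hn2 := norm_sq_E3 x
  have hn : 0 < ‖x‖ := by
    refine lt_of_le_of_ne (norm_nonneg x) fun h0 => ?_
    rw [← h0] at hn2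
    nlinarith [sq_nonneg (x 2)]
  have hlt : (x 2 / ‖x‖) ^ 2 < 1 := by
    rw [div_pow, div_lt_one (by positivity)]
    nlinarith
  have ht : x 2 / ‖x‖ ∈ Ioo (-1 : ℝ) 1 := by
    rw [sq_lt_one_iff_abs_lt_one, abs_lt] at hlt
    exact hlt
  have hs : √(1 - (x 2 / ‖x‖) ^ 2) = cylRadius x / ‖x‖ := by
    rw [Real.sqrt_eq_iff_mul_self_eq_of_pos (by positivity)]
    field_simp
    linarith
  -- The rotation angle is the argument of the horizontal part read as a complex number.
  set z : ℂ := ⟨x 0, x 1⟩ with hz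
  have hzn : ‖z‖ = cylRadius x := by
    rw [Complex.norm_def, Complex.normSq_mk, cylRadius, sq, sq]
  have hc := Complex.norm_mul_cos_arg z
  have hsn := Complex.norm_mul_sin_arg z
  rw [hzn] at hc hsn
  refine ⟨hn, _, ht, z.arg, ?_⟩
  refine ext_E3 ?_ ?_ ?_
  · simp only [rotZ, meridian, hs, PiLp.smul_apply, smul_eq_mul, Matrix.cons_val_zero,
      Matrix.cons_val_one, mul_zero, sub_zero]
    field_simp
    rw [mul_comm, hc]
  · simp only [rotZ, meridian, hs, PiLp.smul_apply, smul_eq_mul, Matrix.cons_val_zero,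
      Matrix.cons_val_one, mul_zero, add_zero]
    field_simp
    rw [mul_comm, hsn]
  · simp only [rotZ, meridian, PiLp.smul_apply, smul_eq_mul, Matrix.cons_val]
    field_simp

lemma isOpen_offAxis : IsOpen offAxis := by
  have : Continuous cylRadius := by
    unfold cylRadius; fun_prop
  exact isOpen_ne_fun this continuous_const

lemma curl_congr {u v : E3 → E3} {x : E3} (h : u =ᶠ[𝓝 x] v) : curl u x = curl v x := by
  have hi : ∀ i, (fun y => u y i) =ᶠ[𝓝 x] fun y => v y i := fun i => h.mono fun y hy => by
    simp only [hy]
  unfold curl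
  simp only [fun i j => pd_congr (hi i) j]

lemma rotZ_smul (s c : ℝ) (x : E3) : rotZ s (c • x) = c • rotZ s x := (rotL s).map_smul c x

lemma curl_const (v : E3) (x : E3) : curl (fun _ => v) x = 0 := by
  refine ext_E3 ?_ ?_ ?_ <;> simp [curl, pd]

lemma curl_radial (m c : ℝ) {x : E3} (hx : x ≠ 0) : curl (fun y => (c * ‖y‖ ^ m) • y) x = 0 := by
  have hd : DifferentiableAt ℝ (fun y : E3 => c * ‖y‖ ^ m) x :=
    ((hasFDerivAt_norm_E3 hx).differentiableAt.rpow_const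
      (Or.inl (norm_ne_zero_iff.2 hx))).const_mul c
  have hpd : ∀ j, pd j (fun y : E3 => c * ‖y‖ ^ m) x = c * (m * ‖x‖ ^ (m - 1) * ‖x‖⁻¹) * x j := by
    intro j
    rw [pd_eq (((hasFDerivAt_norm_E3 hx).rpow_const
      (Or.inl (norm_ne_zero_iff.2 hx))).const_mul c)]
    simp [mul_assoc, EuclideanSpace.inner_single_right]
  have hij : ∀ i j, i ≠ j → pd j (fun y : E3 => ((c * ‖y‖ ^ m) • y) i) x =
      c * (m * ‖x‖ ^ (m - 1) * ‖x‖⁻¹) * x i * x j := by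
    intro i j hij
    have : (fun y : E3 => ((c * ‖y‖ ^ m) • y) i) = fun y => (c * ‖y‖ ^ m) * y i := rfl
    rw [this, pd_mul hd (hasFDerivAt_coord i x).differentiableAt, pd_coord, hpd, if_neg hij]
    ring
  refine ext_E3 ?_ ?_ ?_
  · change pd 1 (fun y : E3 => ((c * ‖y‖ ^ m) • y) 2) x -
      pd 2 (fun y : E3 => ((c * ‖y‖ ^ m) • y) 1) x = 0
    rw [hij 2 1 (by decide), hij 1 2 (by decide)]; ring
  · change pd 2 (fun y : E3 => ((c * ‖y‖ ^ m) • y) 0) x -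
      pd 0 (fun y : E3 => ((c * ‖y‖ ^ m) • y) 2) x = 0
    rw [hij 2 0 (by decide), hij 0 2 (by decide)]; ring
  · change pd 0 (fun y : E3 => ((c * ‖y‖ ^ m) • y) 1) x -
      pd 1 (fun y : E3 => ((c * ‖y‖ ^ m) • y) 0) x = 0
    rw [hij 1 0 (by decide), hij 0 1 (by decide)]; ring

namespace PuncturedSolution

variable {α : ℝ} {u : E3 → E3} {p : E3 → ℝ} (h : PuncturedSolution 1 α u p)
include h

lemma velocity_eq {ρ t : ℝ} (hρ : 0 < ρ) (ht : t ∈ Ioo (-1 : ℝ) 1) (s : ℝ) :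
    u (ρ • rotZ s (meridian t)) = ρ ^ (-α) • rotZ s (u (meridian t)) := by
  have hx := meridian_ne_zero (Ioo_subset_Icc_self ht)
  rw [← h.axisymmetric s _ hx, (h.homogeneous ρ hρ _ (rotZ_ne_zero hx s)).1, smul_smul,
    ← Real.rpow_add hρ, neg_add_cancel, Real.rpow_zero, one_smul]

/-- A solution that is irrotational away from the axis is irrotational. -/
lemma false_of_curl_eq_zero (hcurl : ∀ x ∈ offAxis, curl u x = 0) : False := by
  obtain ⟨x, hx, hne⟩ := h.rotational
  by_cases hxa : x ∈ offAxis
  · exact hne (hcurl x hxa)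
  have hx01 : x 0 = 0 ∧ x 1 = 0 := by
    have h0 : cylRadius x = 0 := not_not.1 hxa
    unfold cylRadius at h0
    rw [Real.sqrt_eq_zero (by positivity)] at h0
    constructor <;> nlinarith [sq_nonneg (x 0), sq_nonneg (x 1)]
  have hDc : ContinuousAt (fderiv ℝ u) x :=
    (h.contDiffOn_velocity.continuousOn_fderiv_of_isOpen isOpen_punctured le_rfl).continuousAt
      (isOpen_punctured.mem_nhds hx)
  have hpd : ∀ i j, ContinuousAt (fun y => fderiv ℝ u y (EuclideanSpace.single j 1) i) x :=
    fun i j => (coordL i).continuous.continuousAt.comp (hDc.clm_apply continuousAt_const)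
  have hγ : Tendsto (fun ε : ℝ => x + ε • EuclideanSpace.single (0 : Fin 3) (1 : ℝ)) (𝓝[>] 0)
      (𝓝 x) := by
    have : Continuous fun ε : ℝ => x + ε • EuclideanSpace.single (0 : Fin 3) (1 : ℝ) := by
      fun_prop
    have h1 := this.tendsto 0
    rw [zero_smul, add_zero] at h1
    exact h1.mono_left nhdsWithin_le_nhds
  have hoff : ∀ ε : ℝ, 0 < ε → x + ε • EuclideanSpace.single (0 : Fin 3) (1 : ℝ) ∈ offAxis := by
    intro ε hε
    unfold offAxis cylRadius
    simp [hx01.1, hx01.2, Real.sqrt_sq hε.le, hε.ne']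
  have key : ∀ i j k l, (∀ y ∈ offAxis, pd j (fun y => u y i) y - pd l (fun y => u y k) y = 0) →
      pd j (fun y => u y i) x - pd l (fun y => u y k) x = 0 := by
    intro i j k l hy
    rw [pd_component (h.hasFDerivAt_velocity hx), pd_component (h.hasFDerivAt_velocity hx)]
    have h1 := ((hpd i j).sub (hpd k l)).tendsto.comp hγ
    refine tendsto_nhds_unique h1 (tendsto_const_nhds.congr' ?_)
    filter_upwards [self_mem_nhdsWithin] with ε hε
    have h2 := hoff ε hε
    have h3 : x + ε • EuclideanSpace.single (0 : Fin 3) (1 : ℝ) ≠ 0 := by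
      intro h0; rw [h0] at h2; exact h2 (by simp [cylRadius])
    have h4 := hy _ h2
    rw [pd_component (h.hasFDerivAt_velocity h3), pd_component (h.hasFDerivAt_velocity h3)] at h4
    exact h4.symm
  refine hne (ext_E3 ?_ ?_ ?_)
  · exact key 2 1 1 2 fun y hy => congrArg (fun w : E3 => w 0) (hcurl y hy)
  · exact key 0 2 2 0 fun y hy => congrArg (fun w : E3 => w 1) (hcurl y hy)
  · exact key 1 0 0 1 fun y hy => congrArg (fun w : E3 => w 2) (hcurl y hy)

lemma false_of_eqOn {V : E3 → E3} (hV : ∀ x ≠ 0, curl V x = 0) (hu : ∀ x ∈ offAxis, u x = V x) :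
    False := by
  refine h.false_of_curl_eq_zero fun x hx => ?_
  have hx0 : x ≠ 0 := norm_pos_iff.1 (exists_rotZ_meridian hx).1
  rw [curl_congr (by filter_upwards [isOpen_offAxis.mem_nhds hx] with y hy using hu y hy), hV x hx0]

omit h in
lemma meridian_components {s t v₀ v₂ A B : ℝ} (h2 : s ^ 2 = 1 - t ^ 2)
    (hA : s * v₀ + t * v₂ = A) (hB : -(t * v₀) + s * v₂ = B) :
    v₀ = s * A - t * B ∧ v₂ = t * A + s * B := by
  subst hA hB
  constructor
  · linear_combination (-v₀) * h2
  · linear_combination (-v₂) * h2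

/-- The system on the meridian leaves only zero, the uniform flow (α = 0) and c x/|x|³ (α = 2).
Scaling and rotation carry each of these to all points off the axis, where it is irrotational.
Continuity of the derivative then excludes vorticity on the axis. -/
theorem false_of_le_two (hα : 0 ≤ α) (hα2 : α ≤ 2) : False := by
  obtain ⟨M, a', γ', P', hS⟩ := h.exists_meridianSystem
  have hs0 : ∀ t ∈ Ioo (-1 : ℝ) 1, √(1 - t ^ 2) ≠ 0 := fun t ht =>
    (Real.sqrt_pos.2 (one_sub_sq_pos ht)).ne'
  have hs2 : ∀ t ∈ Ioo (-1 : ℝ) 1, √(1 - t ^ 2) ^ 2 = 1 - t ^ 2 := fun t ht =>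
    Real.sq_sqrt (one_sub_sq_pos ht).le
  have hzero : (∀ t ∈ Ioo (-1 : ℝ) 1,
      √(1 - t ^ 2) * (-(t * u (meridian t) 0) + √(1 - t ^ 2) * u (meridian t) 2) = 0 ∧
      √(1 - t ^ 2) * u (meridian t) 0 + t * u (meridian t) 2 = 0 ∧
      √(1 - t ^ 2) * u (meridian t) 1 = 0) → False := by
    intro hz
    refine h.false_of_eqOn (V := fun _ => 0) (fun x _ => curl_const 0 x) fun x hx => ?_
    obtain ⟨hn, t, ht, s, hxs⟩ := exists_rotZ_meridian hx
    obtain ⟨h1, h2, h3⟩ := hz t ht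
    have h4 := meridian_components (hs2 t ht) h2 ((mul_eq_zero.1 h1).resolve_left (hs0 t ht))
    have h5 : u (meridian t) = 0 := ext_E3 (by rw [h4.1]; simp)
      ((mul_eq_zero.1 h3).resolve_left (hs0 t ht)) (by rw [h4.2]; simp)
    rw [hxs, h.velocity_eq hn ht, h5, ← rotL_apply, map_zero, smul_zero]
  rcases lt_or_ge α 1 with h1 | h1
  · rcases hα.eq_or_lt with h0 | h0
    · obtain ⟨c, hc⟩ := hS.exists_uniform_of_eq_zero h0.symm
      refine h.false_of_eqOn (V := fun _ => c • eZ) (fun x _ => curl_const _ x) fun x hx => ?_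
      obtain ⟨hn, t, ht, s, hxs⟩ := exists_rotZ_meridian hx
      obtain ⟨h1, h2, h3⟩ := hc t ht
      have h1' : -(t * u (meridian t) 0) + √(1 - t ^ 2) * u (meridian t) 2 = c * √(1 - t ^ 2) := by
        rw [← hs2 t ht] at h1
        refine mul_left_cancel₀ (hs0 t ht) (Eq.trans ?_ (h1.trans ?_))
        · rw [Real.sqrt_sq (Real.sqrt_nonneg _)]
        · ring
      have h4 := meridian_components (hs2 t ht) h2 h1'
      have h5 : u (meridian t) = c • eZ := by
        refine ext_E3 ?_ ?_ ?_
        · rw [h4.1]; simp [eZ]; ring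
        · rw [(mul_eq_zero.1 h3).resolve_left (hs0 t ht)]; simp [eZ]
        · rw [h4.2]; simp [eZ]; linear_combination c * hs2 t ht
      have h6 : rotZ s eZ = eZ := by
        refine ext_E3 ?_ ?_ ?_ <;> simp [rotZ, eZ]
      rw [hxs, h.velocity_eq hn ht, h5, rotZ_smul, h6, ← h0, neg_zero, Real.rpow_zero, one_smul]
    · exact hzero (hS.eq_zero_of_lt_one h0 h1)
  · rcases hα2.eq_or_lt with h0 | h0
    · obtain ⟨c, hc⟩ := hS.exists_radial_of_eq_two h0
      refine h.false_of_eqOn (V := fun y => (c * ‖y‖ ^ (-3 : ℝ)) • y)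
        (fun x hx => curl_radial _ _ hx) fun x hx => ?_
      obtain ⟨hn, t, ht, s, hxs⟩ := exists_rotZ_meridian hx
      obtain ⟨h1, h2, h3⟩ := hc t ht
      have h4 := meridian_components (hs2 t ht) h2 ((mul_eq_zero.1 h1).resolve_left (hs0 t ht))
      have h5 : u (meridian t) = c • meridian t := by
        refine ext_E3 ?_ ?_ ?_
        · rw [h4.1]; simp [meridian]; ring
        · rw [(mul_eq_zero.1 h3).resolve_left (hs0 t ht)]; simp [meridian]
        · rw [h4.2]; simp [meridian]; ring
      have h6 : u x = ‖x‖ ^ (-α) • rotZ s (u (meridian t)) := by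
        rw [← h.velocity_eq hn ht, ← hxs]
      have h7 : rotZ s (meridian t) = ‖x‖⁻¹ • x := by
        rw [eq_inv_smul_iff₀ hn.ne']; exact hxs.symm
      rw [h6, h5, rotZ_smul, h7, smul_smul, smul_smul, h0]
      congr 1
      have h8 : ‖x‖ ^ (-2 : ℝ) * ‖x‖⁻¹ = ‖x‖ ^ (-3 : ℝ) := by
        rw [← Real.rpow_neg_one, ← Real.rpow_add hn]; norm_num
      rw [← h8]; ring
    · exact hzero (hS.eq_zero_of_one_le h1 h0)

end PuncturedSolution

lemma PuncturedSolution.of_two {α : ℝ} {u : E3 → E3} {p : E3 → ℝ}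
    (h : PuncturedSolution 2 α u p) : PuncturedSolution 1 α u p :=
  ⟨h.contDiffOn_velocity.of_le (by norm_cast), h.contDiffOn_pressure.of_le (by norm_cast),
    h.homogeneous, h.euler, h.axisymmetric, h.rotational⟩

end HomEuler

/-! ### The theorem -/

theorem theorem1p5 :
    (∀ α : ℝ, 1 ≤ α → α ≤ 2 →
      ¬ ∃ (u : HomEuler.E3 → HomEuler.E3) (p : HomEuler.E3 → ℝ),
        HomEuler.PuncturedSolution 1 α u p) ∧
    (∀ α : ℝ, 0 ≤ α → α < 1 →
      ¬ ∃ (u : HomEuler.E3 → HomEuler.E3) (p : HomEuler.E3 → ℝ),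
        HomEuler.PuncturedSolution 2 α u p) ∧
    (∀ α : ℝ, 2 < α →
      ∃ (u : HomEuler.E3 → HomEuler.E3) (p : HomEuler.E3 → ℝ),
        HomEuler.PuncturedSolution 1 α u p ∧
        HomEuler.NonconstantBernoulli HomEuler.punctured u p ∧
        ContDiffOn ℝ 2 (HomEuler.poloidal u) HomEuler.punctured ∧
        ContDiffOn ℝ 2 p HomEuler.punctured ∧
        ContDiffOn ℝ 1 (HomEuler.toroidal u) HomEuler.punctured) ∧
    (∀ α : ℝ, α < -2 →
      ∃ (u : HomEuler.E3 → HomEuler.E3) (p : HomEuler.E3 → ℝ),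
        HomEuler.ContinuousSolution α u p ∧
        HomEuler.NonconstantBernoulli Set.univ u p ∧
        ContDiffOn ℝ 1 (HomEuler.poloidal u) HomEuler.offAxis ∧
        Continuous (HomEuler.poloidal u) ∧
        ContDiffOn ℝ 1 p HomEuler.offAxis ∧
        Continuous p ∧
        Continuous (HomEuler.toroidal u)) := by
  refine ⟨?_, ?_, fun α hα => HomEuler.exists_puncturedSolution hα,
    fun α hα => HomEuler.exists_continuousSolution hα⟩
  · rintro α h1 h2 ⟨u, p, h⟩
    exact h.false_of_le_two (by linarith) h2
  · rintro α h0 h1 ⟨u, p, h⟩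
    -- The C¹ argument covers the whole range 0 ≤ α ≤ 2, so the second derivatives are simply
    -- dropped.
    exact h.of_two.false_of_le_two h0 (by linarith)
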